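/- All manifolds are smooth, Hausdorff, second countable, finite-dimensional and without boundary. On $\mathbb TM=TM\oplus T^*M$ use the pairing $\langle u+\xi,v+\eta\rangle=\eta(u)+\xi(v)$ and the Dorfman bracket $[u+\xi,v+\eta]=[u,v]+\mathscr L_u\eta-\iota_v\mathrm d\xi$. A *Lagrangian family* is a subset $L\subset\mathbb TM$ meeting each fibre in a Lagrangian subspace. It is *involutive* if the space $\Gamma(L)$ of smooth sections of $\mathbb TM$ with values in $L$ is closed under the Dorfman bracket, and it is a *Dirac structure* if it is involutive and a smooth vector subbundle of $\mathbb TM$. A Dirac structure *is Poisson* if it is the graph $\{\pi(\xi)+\xi\}$ of a Poisson structure $\pi$. For Lagrangian families $L,R$ put $$L\star R=\{u+\xi+\eta : u+\xi\in L,\ u+\eta\in R\},\qquad L\circledast R=\{u+v+\xi : u+\xi\in L,\ v+\xi\in R\},$$ $\mathcal R_{-1}(L)=\{-u+\xi : u+\xi\in L\}$, $K(L)=L\cap TM$, $\mathrm{Gr}(F)=F\oplus F^\circ$ for $F\subset TM$, and $L[F]=L\cap F^\perp+F$. Dirac structures $L,R$ *concur weakly* if $L\circledast R$ is involutive (it need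 not be smooth). The *Magri recipe* is $$\mathscr M(L,R)=\mathrm{Gr}\big(K(\mathscr N(L,R))\big),\qquad \mathscr N(L,R)=L\star\big(R\circledast\mathcal R_{-1}(L)\big).$$ For a smooth map $\phi:M\to P$ write $u+\xi\sim_\phi v+\eta$ if $\phi_*u=v$ and $\xi=\phi^*\eta$. A Lagrangian family $L$ on $M$ *pushes forward* under $\phi$ to a Lagrangian family $L'=\phi_!L$ on $P$ if for all $x\in M$ and $b\in L'_{\phi(x)}$ there is $a\in L_x$ with $a\sim_\phi b$. **Corollary (Magri diamond).** Let $L$ and $R$ be weakly concurring Dirac structures on $M$, put $E_L=\mathscr M(L,R)\cap TM$, $E_R=\mathscr M(R,L)\cap TM$ and $E=(\mathscr M(L,R)\circledast\mathscr M(R,L))\cap TM$, and suppose that there are surjective submersions $$p_L:M\to M_{E_L},\quad p_R:M\to M_{E_R},\quad r:M\to M_{E_{LR}},\quad q_R:M_{E_L}\to M_{E_{LR}},\quad q_L:M_{E_R}\to M_{E_{LR}}$$ with $q_R\circ p_L=r=q_L\circ p_R$, such that $p_L$, $p_R$ and $r$ have connected fibres and $$\ker (p_L)_*=E_L,\qquad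 \ker (p_R)_*=E_R,\qquad \ker (q_R)_*=E/E_L,\qquad \ker (q_L)_*=E/E_R,$$ where the last two equalities mean $\ker (q_R)_*|_{p_L(x)}=(p_L)_*(E_x)$ and $\ker (q_L)_*|_{p_R(x)}=(p_R)_*(E_x)$ for all $x\in M$. Suppose moreover that, for each of the vertical bundles $F=\ker (p_L)_*,\ \ker (p_R)_*,\ \ker r_*$, the Lagrangian families $L[F]$ and $R[F]$ are smooth vector subbundles of $\mathbb TM$. Then $L$ and $R$ push forward under $p_L$, under $p_R$ and under $r$ to Dirac structures, and at each of the three vertices these two Dirac structures concur weakly. Moreover $q_R$ pushes $(p_L)_!L$ and $(p_L)_!R$ forward to $r_!L$ and $r_!R$, and $q_L$ pushes $(p_R)_!L$ and $(p_R)_!R$ forward to $r_!L$ and $r_!R$. Finally, $(p_L)_!L$, $(p_R)_!R$, $r_!L$ and $r_!R$ are Poisson. -/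

import Mathlib

open scoped Manifold ContDiff Topology

noncomputable section

namespace DiracReduction

section Basic

variable {E : Type*} [NormedAddCommGroup E] [NormedSpace ℝ E]
  {M : Type*} [TopologicalSpace M] [ChartedSpace E M]

/-- The cotangent space `T*ₓM`. -/
abbrev Cotangent (E : Type*) [NormedAddCommGroup E] [NormedSpace ℝ E]
    {M : Type*} [TopologicalSpace M] [ChartedSpace E M] (x : M) : Type _ :=
  TangentSpace 𝓘(ℝ, E) x →L[ℝ] ℝ

/-- The fibre `𝕋ₓM = TₓM ⊕ T*ₓM` of the generalized tangent bundle; `(u, ξ)` stands for `u + ξ`. -/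
abbrev GenTangent (E : Type*) [NormedAddCommGroup E] [NormedSpace ℝ E]
    {M : Type*} [TopologicalSpace M] [ChartedSpace E M] (x : M) : Type _ :=
  TangentSpace 𝓘(ℝ, E) x × Cotangent E x

/-- A family of vector subspaces of the tangent spaces of `M`. -/
abbrev TangentFamily (E : Type*) [NormedAddCommGroup E] [NormedSpace ℝ E]
    (M : Type*) [TopologicalSpace M] [ChartedSpace E M] : Type _ :=
  ∀ x : M, Submodule ℝ (TangentSpace 𝓘(ℝ, E) x)

/-- A family of vector subspaces of the fibres of `𝕋M`. -/
abbrev Family (E : Type*) [NormedAddCommGroup E] [NormedSpace ℝ E]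
    (M : Type*) [TopologicalSpace M] [ChartedSpace E M] : Type _ :=
  ∀ x : M, Submodule ℝ (GenTangent E x)

/-- The symmetric pairing `⟨u + ξ, v + η⟩ = η(u) + ξ(v)`. -/
def pairing {x : M} (a b : GenTangent E x) : ℝ := b.2 a.1 + a.2 b.1

/-- The orthogonal `Iᗮ` with respect to the pairing. -/
def orth (I : Family E M) : Family E M := fun x =>
  { carrier := {a | ∀ b ∈ I x, pairing a b = 0}
    add_mem' := by
      intro a b ha hb c hc
      have h1 := ha c hc
      have h2 := hb c hc
      simp only [pairing, Prod.fst_add, Prod.snd_add, map_add,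
        add_apply] at *
      linarith
    zero_mem' := by
      intro c _
      simp [pairing]
    smul_mem' := by
      intro r a ha c hc
      have h1 := ha c hc
      simp only [pairing, Prod.smul_fst, Prod.smul_snd, map_smul,
        smul_apply, smul_eq_mul] at *
      linear_combination r * h1 }

/-- Lagrangian families: each fibre is its own orthogonal. -/
def IsLagrangian (L : Family E M) : Prop := L = orth L

/-! ### Smooth sections, subbundles and the Dorfman bracket -/

/-- Smoothness on `U` of a vector field. -/
def SmoothVectorFieldOn [IsManifold 𝓘(ℝ, E) ∞ M]
    (u : ∀ x : M, TangentSpace 𝓘(ℝ, E) x) (U : Set M) : Prop :=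
  ContMDiffOn 𝓘(ℝ, E) (𝓘(ℝ, E).prod 𝓘(ℝ, E)) ∞
    (fun x => (Bundle.TotalSpace.mk' E x (u x) : TangentBundle 𝓘(ℝ, E) M)) U

/-- Smoothness on `U` of a one-form, as a section of the cotangent bundle. -/
def SmoothOneFormOn [IsManifold 𝓘(ℝ, E) ∞ M] (ξ : ∀ x : M, Cotangent E x) (U : Set M) : Prop :=
  ContMDiffOn 𝓘(ℝ, E) (𝓘(ℝ, E).prod 𝓘(ℝ, E →L[ℝ] ℝ)) ∞
    (fun x => (Bundle.TotalSpace.mk' (E →L[ℝ] ℝ) x (ξ x) :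
      Bundle.TotalSpace (E →L[ℝ] ℝ) (fun x : M => TangentSpace 𝓘(ℝ, E) x →L[ℝ] ℝ))) U

/-- Smoothness on `U` of a section of `𝕋M`. -/
def SmoothSectionOn [IsManifold 𝓘(ℝ, E) ∞ M] (a : ∀ x : M, GenTangent E x) (U : Set M) : Prop :=
  SmoothVectorFieldOn (fun x => (a x).1) U ∧ SmoothOneFormOn (fun x => (a x).2) U

/-- `Γ(L)`: the smooth global sections of `𝕋M` with values in `L`. -/
def Sections [IsManifold 𝓘(ℝ, E) ∞ M] (L : Family E M) : Set (∀ x : M, GenTangent E x) :=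
  {a | SmoothSectionOn a Set.univ ∧ ∀ x, a x ∈ L x}

/-- `L` is a (smooth) vector subbundle of `𝕋M`: around every point it has a smooth frame. -/
def IsSubbundle [IsManifold 𝓘(ℝ, E) ∞ M] (L : Family E M) : Prop :=
  ∀ x : M, ∃ U ∈ 𝓝 x, ∃ k : ℕ, ∃ s : Fin k → ∀ y : M, GenTangent E y,
    (∀ i, SmoothSectionOn (s i) U) ∧
    ∀ y ∈ U, LinearIndependent ℝ (fun i => s i y) ∧
      Submodule.span ℝ (Set.range (fun i => s i y)) = L y

/-- A one-form read in the preferred chart at `x`, i.e. pulled back by the inverse chart. -/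
def oneFormInChart (x : M) (ξ : ∀ y : M, Cotangent E y) : E → (E →L[ℝ] ℝ) := fun e =>
  (ξ ((extChartAt 𝓘(ℝ, E) x).symm e)).comp
    (mfderiv 𝓘(ℝ, E) 𝓘(ℝ, E) (extChartAt 𝓘(ℝ, E) x).symm e)

/-- The exterior derivative of a one-form at `x`, as `v ↦ (w ↦ dξ(v, w))`, computed in the chart
at `x` by `dξ(v, w) = (D_v ξ)(w) - (D_w ξ)(v)`. -/
def extDerivOneForm (ξ : ∀ y : M, Cotangent E y) (x : M)
    (v : TangentSpace 𝓘(ℝ, E) x) : Cotangent E x :=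
  let A : TangentSpace 𝓘(ℝ, E) x →L[ℝ] E := mfderiv 𝓘(ℝ, E) 𝓘(ℝ, E) (extChartAt 𝓘(ℝ, E) x) x
  let D : E →L[ℝ] (E →L[ℝ] ℝ) := fderiv ℝ (oneFormInChart x ξ) (extChartAt 𝓘(ℝ, E) x x)
  (D (A v)).comp A - (D.flip (A v)).comp A

/-- The Dorfman bracket `[u + ξ, v + η] = [u, v] + 𝓛_u η - ι_v dξ`, with
`𝓛_u η = d(η(u)) + ι_u dη`. -/
def dorfman (a b : ∀ x : M, GenTangent E x) (x : M) : GenTangent E x :=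
  (VectorField.mlieBracket 𝓘(ℝ, E) (fun y => (a y).1) (fun y => (b y).1) x,
    mvfderiv 𝓘(ℝ, E) (fun y => (b y).2 (a y).1) x
      + extDerivOneForm (fun y => (b y).2) x (a x).1
      - extDerivOneForm (fun y => (a y).2) x (b x).1)

/-- `Γ(L)` is closed under the Dorfman bracket. -/
def IsInvolutive [IsManifold 𝓘(ℝ, E) ∞ M] (L : Family E M) : Prop :=
  ∀ a ∈ Sections L, ∀ b ∈ Sections L, ∀ x, dorfman a b x ∈ L x

/-- Dirac structures: involutive Lagrangian vector subbundles of `𝕋M`. -/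
structure IsDirac [IsManifold 𝓘(ℝ, E) ∞ M] (L : Family E M) : Prop where
  lagrangian : IsLagrangian L
  subbundle : IsSubbundle L
  involutive : IsInvolutive L

/-! ### Products and the Magri recipe -/

/-- The tangent product
`L ⋆ R = {u + ξ + η | u + ξ ∈ L, u + η ∈ R}`. -/
def tangentProd (L R : Family E M) : Family E M := fun x =>
  { carrier := {c | ∃ u ξ η, (u, ξ) ∈ L x ∧ (u, η) ∈ R x ∧ c = (u, ξ + η)}
    add_mem' := by
      rintro _ _ ⟨u, ξ, η, hL, hR, rfl⟩ ⟨u', ξ', η', hL', hR', rfl⟩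
      exact ⟨u + u', ξ + ξ', η + η', (L x).add_mem hL hL', (R x).add_mem hR hR',
        by simp only [Prod.mk_add_mk]; congr 1; abel⟩
    zero_mem' := ⟨0, 0, 0, (L x).zero_mem, (R x).zero_mem, by simp [Prod.zero_eq_mk]⟩
    smul_mem' := by
      rintro r _ ⟨u, ξ, η, hL, hR, rfl⟩
      exact ⟨r • u, r • ξ, r • η, (L x).smul_mem r hL, (R x).smul_mem r hR, by simp⟩ }

/-- The cotangent product
`L ⊛ R = {u + v + ξ | u + ξ ∈ L, v + ξ ∈ R}`. -/
def cotangentProd (L R : Family E M) : Family E M := fun x =>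
  { carrier := {c | ∃ u v ξ, (u, ξ) ∈ L x ∧ (v, ξ) ∈ R x ∧ c = (u + v, ξ)}
    add_mem' := by
      rintro _ _ ⟨u, v, ξ, hL, hR, rfl⟩ ⟨u', v', ξ', hL', hR', rfl⟩
      exact ⟨u + u', v + v', ξ + ξ', (L x).add_mem hL hL', (R x).add_mem hR hR',
        by simp only [Prod.mk_add_mk]; congr 1; abel⟩
    zero_mem' := ⟨0, 0, 0, (L x).zero_mem, (R x).zero_mem, by simp [Prod.zero_eq_mk]⟩
    smul_mem' := by
      rintro r _ ⟨u, v, ξ, hL, hR, rfl⟩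
      exact ⟨r • u, r • v, r • ξ, (L x).smul_mem r hL, (R x).smul_mem r hR, by simp⟩ }

/-- The opposite family `𝓡₋₁(L) = {-u + ξ | u + ξ ∈ L}`. -/
def opposite (L : Family E M) : Family E M := fun x =>
  (L x).map ((-LinearMap.id : TangentSpace 𝓘(ℝ, E) x →ₗ[ℝ] TangentSpace 𝓘(ℝ, E) x).prodMap
    (LinearMap.id : Cotangent E x →ₗ[ℝ] Cotangent E x))

/-- The kernel `K(L) = L ∩ TM`. -/
def kernel (L : Family E M) : TangentFamily E M := fun x =>
  (L x).comap (LinearMap.inl ℝ (TangentSpace 𝓘(ℝ, E) x) (Cotangent E x))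

/-- A family `F ⊂ TM`, regarded as an (isotropic) family in `𝕋M`. -/
def ofTangent (F : TangentFamily E M) : Family E M := fun x =>
  (F x).map (LinearMap.inl ℝ (TangentSpace 𝓘(ℝ, E) x) (Cotangent E x))

/-- The graph `Gr(F) = F ⊕ F°`. -/
def graph (F : TangentFamily E M) : Family E M := fun x =>
  { carrier := {a | a.1 ∈ F x ∧ ∀ v ∈ F x, a.2 v = 0}
    add_mem' := by
      rintro a b ⟨ha, ha'⟩ ⟨hb, hb'⟩
      exact ⟨(F x).add_mem ha hb, fun v hv => by simp [ha' v hv, hb' v hv]⟩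
    zero_mem' := ⟨(F x).zero_mem, fun v _ => by simp⟩
    smul_mem' := by
      rintro r a ⟨ha, ha'⟩
      exact ⟨(F x).smul_mem r ha, fun v hv => by simp [ha' v hv]⟩ }

/-- `L[I] = L ∩ Iᗮ + I`. -/
def closestLagrangian (L I : Family E M) : Family E M := fun x => (L x ⊓ orth I x) ⊔ I x

/-- `𝓝(L, R) = L ⋆ (R ⊛ 𝓡₋₁(L))`. -/
def magriN (L R : Family E M) : Family E M := tangentProd L (cotangentProd R (opposite L))

/-- The Magri recipe `𝓜(L, R) = Gr(K(𝓝(L, R)))`. -/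
def magri (L R : Family E M) : Family E M := graph (kernel (magriN L R))

/-- Weak concurrence: the cotangent product, smooth or not, is involutive. -/
def WeaklyConcur [IsManifold 𝓘(ℝ, E) ∞ M] (L R : Family E M) : Prop :=
  IsInvolutive (cotangentProd L R)

/-! ### Poisson structures -/

/-- A bivector at every point, regarded as maps `π : T*ₓM → TₓM`. -/
abbrev BivectorMap (E : Type*) [NormedAddCommGroup E] [NormedSpace ℝ E]
    (M : Type*) [TopologicalSpace M] [ChartedSpace E M] : Type _ :=
  ∀ x : M, Cotangent E x →ₗ[ℝ] TangentSpace 𝓘(ℝ, E) x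

/-- The bracket `{f, g} = dg(π(df))`. -/
def poissonBracket (π : BivectorMap E M) (f g : M → ℝ) : M → ℝ := fun x =>
  mvfderiv 𝓘(ℝ, E) g x (π x (mvfderiv 𝓘(ℝ, E) f x))

/-- `π` is a Poisson structure: a smooth bivector field whose bracket satisfies the Jacobi
identity. -/
structure IsPoissonStructure [IsManifold 𝓘(ℝ, E) ∞ M] (π : BivectorMap E M) : Prop where
  skew : ∀ (x : M) (ξ η : Cotangent E x), η (π x ξ) = -ξ (π x η)
  smooth : ∀ ξ : ∀ x : M, Cotangent E x, SmoothOneFormOn ξ Set.univ →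
    SmoothVectorFieldOn (fun x => π x (ξ x)) Set.univ
  jacobi : ∀ f g h : M → ℝ, ContMDiff 𝓘(ℝ, E) 𝓘(ℝ, ℝ) ∞ f → ContMDiff 𝓘(ℝ, E) 𝓘(ℝ, ℝ) ∞ g →
    ContMDiff 𝓘(ℝ, E) 𝓘(ℝ, ℝ) ∞ h → ∀ x,
      poissonBracket π f (poissonBracket π g h) x
        + poissonBracket π g (poissonBracket π h f) x
        + poissonBracket π h (poissonBracket π f g) x = 0

/-- `L` is (the graph `{π(ξ) + ξ}` of) a Poisson structure. -/
def IsPoisson [IsManifold 𝓘(ℝ, E) ∞ M] (L : Family E M) : Prop :=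
  ∃ π : BivectorMap E M, IsPoissonStructure π ∧
    ∀ (x : M) (a : GenTangent E x), a ∈ L x ↔ a.1 = π x a.2

end Basic

/-! ### Forward maps -/

section Maps

variable {E : Type*} [NormedAddCommGroup E] [NormedSpace ℝ E]
  {M : Type*} [TopologicalSpace M] [ChartedSpace E M]
  {E' : Type*} [NormedAddCommGroup E'] [NormedSpace ℝ E']
  {P : Type*} [TopologicalSpace P] [ChartedSpace E' P]

/-- `u + ξ ∼_φ v + η` iff `φ_* u = v` and `ξ = φ^* η`. -/
def Related (φ : M → P) {x : M} (a : GenTangent E x) (b : GenTangent E' (φ x)) : Prop :=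
  mfderiv 𝓘(ℝ, E) 𝓘(ℝ, E') φ x a.1 = b.1 ∧
    a.2 = b.2.comp (mfderiv 𝓘(ℝ, E) 𝓘(ℝ, E') φ x)

/-- `φ : (M, L) → (P, L')` is forward; for Lagrangian families, `φ_! L = L'`. -/
def IsForward (φ : M → P) (L : Family E M) (L' : Family E' P) : Prop :=
  ∀ (x : M), ∀ b ∈ L' (φ x), ∃ a ∈ L x, Related φ a b

/-- The vertical bundle `ker φ_*`. -/
def vertical (E E' : Type*) [NormedAddCommGroup E] [NormedSpace ℝ E]
    [NormedAddCommGroup E'] [NormedSpace ℝ E']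
    {M : Type*} [TopologicalSpace M] [ChartedSpace E M]
    {P : Type*} [TopologicalSpace P] [ChartedSpace E' P]
    (φ : M → P) : TangentFamily E M := fun x =>
  LinearMap.ker (mfderiv 𝓘(ℝ, E) 𝓘(ℝ, E') φ x).toLinearMap

/-- The image `φ_*(F_x) ⊂ T_{φ(x)}P`; when `ker φ_* ⊂ F` and `φ` is a submersion, this is the
quotient `F_x / ker φ_*`, placed in `T_{φ(x)}P ≃ T_xM / ker φ_*`. -/
def imageAt (E' : Type*) [NormedAddCommGroup E'] [NormedSpace ℝ E']
    {P : Type*} [TopologicalSpace P] [ChartedSpace E' P]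
    (φ : M → P) (F : TangentFamily E M) (x : M) : Submodule ℝ (TangentSpace 𝓘(ℝ, E') (φ x)) :=
  (F x).map (mfderiv 𝓘(ℝ, E) 𝓘(ℝ, E') φ x).toLinearMap

/-- A surjective submersion. -/
def IsSurjectiveSubmersion (E E' : Type*) [NormedAddCommGroup E] [NormedSpace ℝ E]
    [NormedAddCommGroup E'] [NormedSpace ℝ E']
    {M : Type*} [TopologicalSpace M] [ChartedSpace E M]
    {P : Type*} [TopologicalSpace P] [ChartedSpace E' P]
    (φ : M → P) : Prop :=
  Manifold.IsSubmersion 𝓘(ℝ, E) 𝓘(ℝ, E') ∞ φ ∧ Function.Surjective φ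

/-- All fibres of `φ` are connected. -/
def HasConnectedFibres (φ : M → P) : Prop := ∀ y : P, IsConnected (φ ⁻¹' {y})

end Maps

end DiracReduction

end

open DiracReduction

set_option maxSynthPendingDepth 3

noncomputable section

/-! Involutivity of a Lagrangian family is the vanishing of the Courant tensor ⟨[a, b], c⟩
(`courant`) on its sections, and f ∈ K(𝓝(L, R)) means that f + ξ ∈ L, v ∈ L and −v + ξ ∈ R for some
ξ and v (`InMagri`). The heart is an invariance statement. In charts adapted to a submersion the
vertical bundle F is constant. If F contains K(𝓝(L, R)) and a, b are sections of L annihilating F,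
then ⟨D_f a, b⟩ = 0 for f in K(𝓝(L, R)), because it is an alternating sum of Courant tensors on L, R
and L ⊛ R (`ConcurOn.dot_fderiv_left`); sections of R are treated by a longer sum of the same kind
(`ConcurOn.dot_fderiv_right`). The sums use auxiliary vectors linking a and b to R and back to L,
which exist by Lagrangian linear algebra (`exists_chain_left`, `exists_chain_right`).

The auxiliary vectors need not depend smoothly on the point. However, a pointwise solvable linear
system with smooth coefficients has a smooth solution over some nonempty open part of every nonempty
open set, namely where the rank is maximal (`exists_open_smooth_solution`). The identities proved
are equalities of continuous functions, so a dense set of points suffices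
(`eq_zero_of_dense_zeros`).

Invariance and the smoothness of L[F] make L[F], hence the forward image of L, locally constant
along the fibres (`InvariantOn.exists_reduction`); connected fibres make this global
(`exists_pushesTo`). The forward image is involutive because its sections lift to L over dense open
sets and the Courant tensor is natural.

Since K(L) ⊂ E_L, dividing out E_L kills the kernel of L, and a Dirac structure with zero kernel is
Poisson. One factor with zero kernel also makes the product of the two reduced structures Lagrangian
and gives it smooth sections through all its elements, which is what lets weak concurrence descend.
For r the vertical bundle is E_L + E_R, and invariance follows by applying the statement to (L, R)
and to (R, L). The claims about q_R and q_L are the chain rule. -/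

namespace DiracReduction

/-! ### The pairing and the Courant tensor on a vector space -/

section Linear

variable {E : Type*} [NormedAddCommGroup E] [NormedSpace ℝ E]
  {E' : Type*} [NormedAddCommGroup E'] [NormedSpace ℝ E']

/-- The space `E ⊕ E*`. -/
abbrev Pontryagin (E : Type*) [NormedAddCommGroup E] [NormedSpace ℝ E] : Type _ :=
  E × (E →L[ℝ] ℝ)

/-- The symmetric pairing of `E ⊕ E*`. -/
def dot (a b : Pontryagin E) : ℝ := b.2 a.1 + a.2 b.1

lemma dot_comm (a b : Pontryagin E) : dot a b = dot b a := by simp [dot, add_comm]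

lemma dot_add_left (a b c : Pontryagin E) : dot (a + b) c = dot a c + dot b c := by
  simp [dot]; ring

lemma dot_add_right (a b c : Pontryagin E) : dot a (b + c) = dot a b + dot a c := by
  simp [dot]; ring

lemma dot_smul_left (r : ℝ) (a b : Pontryagin E) : dot (r • a) b = r * dot a b := by
  simp [dot]; ring

lemma dot_smul_right (r : ℝ) (a b : Pontryagin E) : dot a (r • b) = r * dot a b := by
  simp [dot]; ring

lemma dot_zero_right (b : Pontryagin E) : dot b 0 = 0 := by simp [dot]

/-- The continuous bilinear map `(u + ξ, v + η) ↦ ξ(v)`. -/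
def dotLAux (E : Type*) [NormedAddCommGroup E] [NormedSpace ℝ E] :
    Pontryagin E →L[ℝ] Pontryagin E →L[ℝ] ℝ :=
  ((ContinuousLinearMap.compL ℝ (Pontryagin E) E ℝ).flip
    (ContinuousLinearMap.fst ℝ E (E →L[ℝ] ℝ))).comp (ContinuousLinearMap.snd ℝ E (E →L[ℝ] ℝ))

/-- The pairing as a continuous bilinear map. -/
def dotL (E : Type*) [NormedAddCommGroup E] [NormedSpace ℝ E] :
    Pontryagin E →L[ℝ] Pontryagin E →L[ℝ] ℝ :=
  dotLAux E + (dotLAux E).flip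

@[simp] lemma dotL_apply (a b : Pontryagin E) : dotL E a b = dot a b := by
  simp [dotL, dotLAux, dot, add_comm]

lemma contDiffOn_dot {G : Type*} [NormedAddCommGroup G] [NormedSpace ℝ G] {n : WithTop ℕ∞}
    {a b : G → Pontryagin E} {s : Set G}
    (ha : ContDiffOn ℝ n a s) (hb : ContDiffOn ℝ n b s) :
    ContDiffOn ℝ n (fun x => dot (a x) (b x)) s := by
  simp only [← dotL_apply]
  exact ((dotL E).contDiff.comp_contDiffOn ha).clm_apply hb

/-- The Courant tensor `⟨[a, b], c⟩` of sections of `E ⊕ E*` over an open subset of `E`. -/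
def courant (a b c : E → Pontryagin E) (e : E) : ℝ :=
  dot (fderiv ℝ b e (a e).1) (c e) - dot (fderiv ℝ a e (b e).1) (c e)
    + dot (fderiv ℝ a e (c e).1) (b e)

lemma courant_mk {u v w : E → E} {ξ η ζ : E → (E →L[ℝ] ℝ)} {e : E}
    (hu : DifferentiableAt ℝ u e) (hv : DifferentiableAt ℝ v e)
    (hξ : DifferentiableAt ℝ ξ e) (hη : DifferentiableAt ℝ η e) :
    courant (fun x => (u x, ξ x)) (fun x => (v x, η x)) (fun x => (w x, ζ x)) e =
      ζ e (fderiv ℝ v e (u e)) + fderiv ℝ η e (u e) (w e)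
        - (ζ e (fderiv ℝ u e (v e)) + fderiv ℝ ξ e (v e) (w e))
        + (η e (fderiv ℝ u e (w e)) + fderiv ℝ ξ e (w e) (v e)) := by
  simp [courant, hu.fderiv_prodMk hξ, hv.fderiv_prodMk hη, dot]

lemma contDiffOn_courant {a b c : E → Pontryagin E} {s : Set E} (hs : IsOpen s)
    (ha : ContDiffOn ℝ ∞ a s) (hb : ContDiffOn ℝ ∞ b s) (hc : ContDiffOn ℝ ∞ c s) :
    ContDiffOn ℝ ∞ (courant a b c) s := by
  have da : ContDiffOn ℝ ∞ (fderiv ℝ a) s := ha.fderiv_of_isOpen hs (by simp)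
  have db : ContDiffOn ℝ ∞ (fderiv ℝ b) s := hb.fderiv_of_isOpen hs (by simp)
  exact ((contDiffOn_dot (db.clm_apply ha.fst) hc).sub
    (contDiffOn_dot (da.clm_apply hb.fst) hc)).add (contDiffOn_dot (da.clm_apply hc.fst) hb)

lemma courant_congr {a b c a' b' c' : E → Pontryagin E} {e : E}
    (ha : a =ᶠ[𝓝 e] a') (hb : b =ᶠ[𝓝 e] b') (hc : c e = c' e) :
    courant a b c e = courant a' b' c' e := by
  simp only [courant, ha.fderiv_eq, hb.fderiv_eq, ha.eq_of_nhds, hb.eq_of_nhds, hc]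

/-- `a` and `b` are related by the differential `D`. -/
def LinRelated (D : E →L[ℝ] E') (a : Pontryagin E) (b : Pontryagin E') : Prop :=
  D a.1 = b.1 ∧ a.2 = b.2.comp D

lemma LinRelated.dot_eq {D : E →L[ℝ] E'} {a b : Pontryagin E} {a' b' : Pontryagin E'}
    (ha : LinRelated D a a') (hb : LinRelated D b b') : dot a b = dot a' b' := by
  simp [dot, ha.2, hb.2, ← ha.1, ← hb.1]

/-- Obtained by differentiating the two relations defining `LinRelated`. The defect from naturality
consists of two terms in the second derivative of ψ; in the Courant tensor these cancel by symmetry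
of second derivatives. -/
lemma dot_fderiv_of_related {ψ : E → E'} {e : E} (hψ : ContDiffAt ℝ 2 ψ e)
    {a : E → Pontryagin E} {b : E' → Pontryagin E'}
    (ha : DifferentiableAt ℝ a e) (hb : DifferentiableAt ℝ b (ψ e))
    (hab : ∀ᶠ x in 𝓝 e, LinRelated (fderiv ℝ ψ x) (a x) (b (ψ x)))
    {c : Pontryagin E} {d : Pontryagin E'} (hcd : LinRelated (fderiv ℝ ψ e) c d) (h : E) :
    dot (fderiv ℝ a e h) c = dot (fderiv ℝ b (ψ e) (fderiv ℝ ψ e h)) d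
      - d.2 ((fderiv ℝ (fderiv ℝ ψ) e h : E →L[ℝ] E') (a e).1)
      + (b (ψ e)).2 ((fderiv ℝ (fderiv ℝ ψ) e h : E →L[ℝ] E') c.1) := by
  have hd : DifferentiableAt ℝ (fderiv ℝ ψ) e :=
    (hψ.fderiv_right (m := 1) (by norm_num)).differentiableAt (by norm_num)
  have hψd : DifferentiableAt ℝ ψ e := hψ.differentiableAt (by norm_num)
  have hbψ : DifferentiableAt ℝ (fun x => b (ψ x)) e := hb.comp e hψd
  have hbψ' : fderiv ℝ (fun x => b (ψ x)) e = (fderiv ℝ b (ψ e)).comp (fderiv ℝ ψ e) :=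
    fderiv_comp e hb hψd
  have h1 : (fun x => fderiv ℝ ψ x (a x).1) =ᶠ[𝓝 e] fun x => (b (ψ x)).1 :=
    hab.mono fun x hx => hx.1
  have h2 : (fun x => (a x).2) =ᶠ[𝓝 e] fun x => (b (ψ x)).2.comp (fderiv ℝ ψ x) :=
    hab.mono fun x hx => hx.2
  have h1' := congrArg (fun T : E →L[ℝ] E' => T h) h1.fderiv_eq
  have h2' := congrArg (fun T : E →L[ℝ] E →L[ℝ] ℝ => T h c.1) h2.fderiv_eq
  rw [fderiv_clm_apply hd ha.fst, fderiv.fst ha, fderiv.fst hbψ, hbψ'] at h1'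
  rw [fderiv_clm_comp hbψ.snd hd, fderiv.snd ha, fderiv.snd hbψ, hbψ'] at h2'
  simp at h1' h2'
  have h3 := congrArg d.2 h1'
  rw [map_add] at h3
  simp only [dot, hcd.2, ContinuousLinearMap.comp_apply, h2', ← hcd.1]
  linarith

/-- The Courant tensor is natural for related sections. -/
lemma courant_eq_of_related {ψ : E → E'} {e : E} (hψ : ContDiffAt ℝ 2 ψ e)
    {a₁ a₂ a₃ : E → Pontryagin E} {b₁ b₂ b₃ : E' → Pontryagin E'}
    (ha₁ : DifferentiableAt ℝ a₁ e) (hb₁ : DifferentiableAt ℝ b₁ (ψ e))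
    (ha₂ : DifferentiableAt ℝ a₂ e) (hb₂ : DifferentiableAt ℝ b₂ (ψ e))
    (h₁ : ∀ᶠ x in 𝓝 e, LinRelated (fderiv ℝ ψ x) (a₁ x) (b₁ (ψ x)))
    (h₂ : ∀ᶠ x in 𝓝 e, LinRelated (fderiv ℝ ψ x) (a₂ x) (b₂ (ψ x)))
    (h₃ : LinRelated (fderiv ℝ ψ e) (a₃ e) (b₃ (ψ e))) :
    courant a₁ a₂ a₃ e = courant b₁ b₂ b₃ (ψ e) := by
  have hs : IsSymmSndFDerivAt ℝ ψ e := hψ.isSymmSndFDerivAt (by simp)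
  have k₁ := h₁.self_of_nhds
  have k₂ := h₂.self_of_nhds
  simp only [courant]
  rw [dot_fderiv_of_related hψ ha₂ hb₂ h₂ h₃, dot_fderiv_of_related hψ ha₁ hb₁ h₁ h₃,
    dot_fderiv_of_related hψ ha₁ hb₁ h₁ k₂, k₁.1, k₂.1, h₃.1,
    hs.eq (a₂ e).1 (a₁ e).1, hs.eq (a₃ e).1 (a₁ e).1, hs.eq (a₃ e).1 (a₂ e).1]
  ring

end Linear

/-! ### Smooth solutions of linear systems over dense open sets -/

section Lifting

variable {E : Type*} [NormedAddCommGroup E] [NormedSpace ℝ E]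
  {Y : Type*} [NormedAddCommGroup Y] [NormedSpace ℝ Y] [FiniteDimensional ℝ Y]
  {Z : Type*} [NormedAddCommGroup Z] [NormedSpace ℝ Z] [FiniteDimensional ℝ Z]

/-- A pointwise solvable linear system with smooth coefficients has a smooth solution over some
nonempty open subset. -/
lemma exists_open_smooth_solution {V : Set E} (hV : IsOpen V) (hne : V.Nonempty)
    {A : E → Y →L[ℝ] Z} (hA : ContDiffOn ℝ ∞ A V) {s : E → Z} (hs : ContDiffOn ℝ ∞ s V)
    (h : ∀ e ∈ V, ∃ y, A e y = s e) :
    ∃ V' ⊆ V, IsOpen V' ∧ V'.Nonempty ∧ ∃ y : E → Y, ContDiffOn ℝ ∞ y V' ∧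
      ∀ e ∈ V', A e (y e) = s e := by
  classical
  -- Work near a point of maximal rank: the rank cannot drop nearby, and by maximality it cannot
  -- grow, so it is locally constant there.
  let rk : E → ℕ := fun e => Module.finrank ℝ (LinearMap.range (A e).toLinearMap)
  obtain ⟨e₀, he₀, hmax⟩ : ∃ e₀ ∈ V, ∀ e ∈ V, rk e ≤ rk e₀ := by
    have hb : BddAbove (rk '' V) := ⟨Module.finrank ℝ Z, by
      rintro _ ⟨e, -, rfl⟩
      exact Submodule.finrank_le _⟩
    obtain ⟨e₀, he₀, h₀⟩ := Nat.sSup_mem (hne.image rk) hb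
    exact ⟨e₀, he₀, fun e he => h₀ ▸ le_csSup hb ⟨e, he, rfl⟩⟩
  obtain ⟨C, hC⟩ := Submodule.exists_isCompl (LinearMap.ker (A e₀).toLinearMap)
  have : CompleteSpace C := FiniteDimensional.complete ℝ C
  let ι : C →L[ℝ] Y := C.subtypeL
  have hinj : LinearMap.ker ((A e₀).comp ι).toLinearMap = ⊥ := by
    rw [LinearMap.ker_eq_bot']
    intro c hc
    have : (c : Y) ∈ LinearMap.ker (A e₀).toLinearMap ⊓ C := ⟨hc, c.2⟩
    rw [hC.inf_eq_bot] at this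
    exact Subtype.ext this
  obtain ⟨Q', hQ'⟩ := LinearMap.exists_leftInverse_of_injective _ hinj
  let Q : Z →L[ℝ] C := LinearMap.toContinuousLinearMap Q'
  have hQ : Q.comp ((A e₀).comp ι) = 1 := by
    ext c
    have := LinearMap.congr_fun hQ' c
    exact congrArg Subtype.val this
  -- `N e` compares `A e` with `A e₀` on a complement of the kernel at `e₀`. It is the identity at
  -- `e₀`, so it is invertible nearby, and its smooth inverse gives the solution formula.
  let N : E → C →L[ℝ] C := fun e => Q.comp ((A e).comp ι)
  have hN : ContDiffOn ℝ ∞ N V :=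
    contDiffOn_const.clm_comp (hA.clm_comp contDiffOn_const)
  obtain ⟨V', hV'V, hV', he₀V', hunit⟩ : ∃ V' ⊆ V, IsOpen V' ∧ e₀ ∈ V' ∧ ∀ e ∈ V', IsUnit (N e) := by
    refine ⟨V ∩ N ⁻¹' {x | IsUnit x}, Set.inter_subset_left,
      hN.continuousOn.isOpen_inter_preimage hV Units.isOpen, ⟨he₀, ?_⟩, fun e he => he.2⟩
    show IsUnit (N e₀)
    rw [show N e₀ = 1 from hQ]
    exact isUnit_one
  have hrk : rk e₀ = Module.finrank ℝ C := by
    have h1 := Submodule.finrank_add_eq_of_isCompl hC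
    have h2 := LinearMap.finrank_range_add_finrank_ker (A e₀).toLinearMap
    show Module.finrank ℝ (LinearMap.range (A e₀).toLinearMap) = _
    omega
  refine ⟨V', hV'V, hV', ⟨e₀, he₀V'⟩, fun e => ι (Ring.inverse (N e) (Q (s e))), ?_, ?_⟩
  · have hinv : ContDiffOn ℝ ∞ (fun e => Ring.inverse (N e)) V' := by
      intro e he
      obtain ⟨w, hw⟩ := hunit e he
      have h1 : ContDiffAt ℝ ∞ Ring.inverse (N e) := hw ▸ contDiffAt_ringInverse ℝ w
      exact h1.comp_contDiffWithinAt e ((hN e (hV'V he)).mono hV'V)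
    exact ι.contDiff.comp_contDiffOn
      (hinv.clm_apply (Q.contDiff.comp_contDiffOn (hs.mono hV'V)))
  · intro e he
    obtain ⟨w, hw⟩ := hunit e he
    have hker : LinearMap.ker ((A e).comp ι).toLinearMap = ⊥ := by
      rw [LinearMap.ker_eq_bot']
      intro c hc
      have h1 : N e c = 0 := by
        show Q (((A e).comp ι) c) = 0
        rw [show ((A e).comp ι) c = 0 from hc, map_zero]
      have h2 : (Ring.inverse (N e) * N e) c = 0 := by
        rw [mul_apply_eq_comp, h1, map_zero]
      rwa [Ring.inverse_mul_cancel _ (hunit e he)] at h2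
    -- Restricting to `C` loses no values: the restriction is injective, so its rank is already the
    -- maximal one.
    have hrange : LinearMap.range ((A e).comp ι).toLinearMap
        = LinearMap.range (A e).toLinearMap := by
      apply Submodule.eq_of_le_of_finrank_le
      · rintro _ ⟨c, rfl⟩
        exact ⟨ι c, rfl⟩
      · rw [LinearMap.finrank_range_of_inj (LinearMap.ker_eq_bot.mp hker), ← hrk]
        exact hmax e (hV'V he)
    obtain ⟨y, hy⟩ := h e (hV'V he)
    have hmem : s e ∈ LinearMap.range ((A e).comp ι).toLinearMap := by
      rw [hrange]
      exact ⟨y, hy⟩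
    obtain ⟨c, hc⟩ := hmem
    have hc' : A e (ι c) = s e := hc
    have h1 : Ring.inverse (N e) (Q (s e)) = c := by
      have : Q (s e) = N e c := by rw [← hc']; rfl
      rw [this, ← mul_apply_eq_comp, Ring.inverse_mul_cancel _ (hunit e he)]
      rfl
    show A e (ι (Ring.inverse (N e) (Q (s e)))) = s e
    rw [h1, hc']

/-- A continuous function vanishing somewhere in every nonempty open subset vanishes. -/
lemma eq_zero_of_dense_zeros {X : Type*} [TopologicalSpace X] {V : Set X} (hV : IsOpen V)
    {g : X → ℝ} (hg : ContinuousOn g V)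
    (h : ∀ W ⊆ V, IsOpen W → W.Nonempty → ∃ e ∈ W, g e = 0) : ∀ e ∈ V, g e = 0 := by
  intro e he
  by_contra hne
  obtain ⟨x, ⟨-, hx⟩, hx0⟩ := h (V ∩ g ⁻¹' {0}ᶜ) Set.inter_subset_left
    (hg.isOpen_inter_preimage hV isOpen_compl_singleton) ⟨e, he, hne⟩
  exact hx hx0

end Lifting

/-! ### Lagrangian linear algebra -/

section LinearLagrangian

variable {E : Type*} [NormedAddCommGroup E] [NormedSpace ℝ E]
  {E' : Type*} [NormedAddCommGroup E'] [NormedSpace ℝ E']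

/-- Lagrangian subspaces of `E ⊕ E*`. -/
def IsLag (Λ : Submodule ℝ (Pontryagin E)) : Prop :=
  ∀ a, a ∈ Λ ↔ ∀ b ∈ Λ, dot a b = 0

lemma IsLag.dot_eq_zero {Λ : Submodule ℝ (Pontryagin E)} (h : IsLag Λ) {a b : Pontryagin E}
    (ha : a ∈ Λ) (hb : b ∈ Λ) : dot a b = 0 := (h a).1 ha b hb

lemma mk_zero_mem (Λ : Submodule ℝ (Pontryagin E)) : ((0 : E), (0 : E →L[ℝ] ℝ)) ∈ Λ :=
  Λ.zero_mem

/-- The pairing as a bilinear form. -/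
def dotForm (E : Type*) [NormedAddCommGroup E] [NormedSpace ℝ E] :
    LinearMap.BilinForm ℝ (Pontryagin E) :=
  LinearMap.mk₂ ℝ dot dot_add_left dot_smul_left dot_add_right dot_smul_right

@[simp] lemma dotForm_apply (a b : Pontryagin E) : dotForm E a b = dot a b := rfl

lemma dotForm_isRefl : (dotForm E).IsRefl := by
  intro a b h
  rwa [dotForm_apply, dot_comm]

variable [FiniteDimensional ℝ E] [FiniteDimensional ℝ E']

lemma dotForm_nondegenerate : (dotForm E).Nondegenerate := by
  refine (LinearMap.BilinForm.nondegenerate_iff_ker_eq_bot).2 ?_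
  rw [LinearMap.ker_eq_bot']
  intro a ha
  have h : ∀ b, dot a b = 0 := fun b => LinearMap.congr_fun ha b
  ext w
  · refine (SeparatingDual.eq_zero_iff_forall_dual_eq_zero (R := ℝ) a.1).2 ?_
    intro g
    simpa [dot] using h (0, g)
  · simpa [dot] using h (w, 0)

/-- Double orthogonality for a sum of two subspaces. -/
lemma mem_sup_of_dot_eq_zero {A B : Submodule ℝ (Pontryagin E)} {x : Pontryagin E}
    (h : ∀ c, (∀ a ∈ A, dot a c = 0) → (∀ b ∈ B, dot b c = 0) → dot c x = 0) : x ∈ A ⊔ B := by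
  rw [← LinearMap.BilinForm.orthogonal_orthogonal dotForm_nondegenerate dotForm_isRefl (A ⊔ B)]
  intro c hc
  exact h c (fun a ha => hc a (Submodule.mem_sup_left ha))
    (fun b hb => hc b (Submodule.mem_sup_right hb))

/-- The hypothesis places x in (Λ ∩ Fᗮ)ᗮ, which is Λ + F by double orthogonality. -/
lemma IsLag.exists_sub_mem {Λ : Submodule ℝ (Pontryagin E)} (hΛ : IsLag Λ) (F : Submodule ℝ E)
    {x : Pontryagin E} (h : ∀ c ∈ Λ, (∀ f ∈ F, c.2 f = 0) → dot c x = 0) :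
    ∃ f ∈ F, (x.1 - f, x.2) ∈ Λ := by
  have : x ∈ Λ ⊔ F.map (LinearMap.inl ℝ E (E →L[ℝ] ℝ)) := by
    refine mem_sup_of_dot_eq_zero fun c h₁ h₂ => h c ?_ ?_
    · exact (hΛ c).2 fun b hb => by rw [dot_comm]; exact h₁ b hb
    · intro f hf
      simpa [dot] using h₂ (f, 0) ⟨f, hf, rfl⟩
  obtain ⟨a, ha, _, ⟨f, hf, rfl⟩, rfl⟩ := Submodule.mem_sup.1 this
  refine ⟨f, hf, ?_⟩
  simpa using ha

lemma finrank_dual_eq : Module.finrank ℝ (E →L[ℝ] ℝ) = Module.finrank ℝ E := by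
  rw [← (LinearMap.toContinuousLinearMap (𝕜 := ℝ) (E := E) (F' := ℝ)).finrank_eq]
  exact Subspace.dual_finrank_eq

/-- Λ equals its orthogonal, and the two dimensions add up to 2 dim E. -/
lemma IsLag.finrank_eq {Λ : Submodule ℝ (Pontryagin E)} (hΛ : IsLag Λ) :
    Module.finrank ℝ Λ = Module.finrank ℝ E := by
  have h : (dotForm E).orthogonal Λ = Λ := by
    ext a
    rw [hΛ a]
    simp only [LinearMap.BilinForm.mem_orthogonal_iff, dotForm_apply]
    exact forall₂_congr fun b _ => by rw [dot_comm]
  have h1 := LinearMap.BilinForm.finrank_orthogonal (dotForm_nondegenerate (E := E)) Λ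
  have h2 := Submodule.finrank_le Λ
  rw [h, Module.finrank_prod, finrank_dual_eq] at h1
  rw [Module.finrank_prod, finrank_dual_eq] at h2
  omega

/-- `Λ[F] = Λ ∩ Fᗮ + F`. -/
def closest (Λ : Submodule ℝ (Pontryagin E)) (F : Submodule ℝ E) :
    Submodule ℝ (Pontryagin E) where
  carrier := {a | (∀ f ∈ F, a.2 f = 0) ∧ ∃ f ∈ F, (a.1 - f, a.2) ∈ Λ}
  add_mem' := by
    rintro a b ⟨ha, f, hf, hfa⟩ ⟨hb, g, hg, hgb⟩
    refine ⟨fun v hv => by simp [ha v hv, hb v hv], f + g, F.add_mem hf hg, ?_⟩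
    convert Λ.add_mem hfa hgb using 1
    ext1
    · simp; abel
    · simp
  zero_mem' := ⟨fun v _ => by simp, 0, F.zero_mem, by
    simpa using mk_zero_mem Λ⟩
  smul_mem' := by
    rintro r a ⟨ha, f, hf, hfa⟩
    refine ⟨fun v hv => by simp [ha v hv], r • f, F.smul_mem r hf, ?_⟩
    convert Λ.smul_mem r hfa using 1
    ext1
    · simp [smul_sub]
    · simp

omit [FiniteDimensional ℝ E] in
lemma mem_closest {Λ : Submodule ℝ (Pontryagin E)} {F : Submodule ℝ E} {a : Pontryagin E} :
    a ∈ closest Λ F ↔ (∀ f ∈ F, a.2 f = 0) ∧ ∃ f ∈ F, (a.1 - f, a.2) ∈ Λ := Iff.rfl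

lemma IsLag.closest {Λ : Submodule ℝ (Pontryagin E)} (hΛ : IsLag Λ) (F : Submodule ℝ E) :
    IsLag (closest Λ F) := by
  intro a
  constructor
  · rintro ⟨ha, f, hf, hfa⟩ b ⟨hb, g, hg, hgb⟩
    have := hΛ.dot_eq_zero hfa hgb
    simpa [dot, ha g hg, hb f hf] using this
  · intro h
    refine ⟨fun f hf => ?_, hΛ.exists_sub_mem F fun c hc hcF => ?_⟩
    · have : ((f, 0) : Pontryagin E) ∈ DiracReduction.closest Λ F :=
        ⟨fun v _ => by simp, f, hf, by simpa using mk_zero_mem Λ⟩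
      simpa [dot] using h _ this
    · rw [dot_comm]
      exact h c ⟨hcF, 0, F.zero_mem, by simpa using hc⟩

/-- The forward image of a subspace. -/
def push (D : E →L[ℝ] E') (Λ : Submodule ℝ (Pontryagin E)) : Submodule ℝ (Pontryagin E') where
  carrier := {b | ∃ a ∈ Λ, LinRelated D a b}
  add_mem' := by
    rintro b b' ⟨a, ha, h⟩ ⟨a', ha', h'⟩
    exact ⟨a + a', Λ.add_mem ha ha', by simp [h.1, h'.1], by
      simp [h.2, h'.2, ContinuousLinearMap.add_comp]⟩
  zero_mem' := ⟨0, Λ.zero_mem, by simp, by simp⟩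
  smul_mem' := by
    rintro r b ⟨a, ha, h⟩
    exact ⟨r • a, Λ.smul_mem r ha, by simp [h.1], by simp [h.2, ContinuousLinearMap.smul_comp]⟩

omit [FiniteDimensional ℝ E'] in
/-- A form which vanishes on the kernel of a surjective linear map factors through it. -/
lemma exists_comp_eq_of_ker {D : E →L[ℝ] E'} (hD : Function.Surjective D) {ξ : E →L[ℝ] ℝ}
    (h : ∀ f, D f = 0 → ξ f = 0) : ∃ β : E' →L[ℝ] ℝ, ξ = β.comp D := by
  have : FiniteDimensional ℝ E' :=
    FiniteDimensional.of_surjective D.toLinearMap hD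
  obtain ⟨σ, hσ⟩ := D.toLinearMap.exists_rightInverse_of_surjective (LinearMap.range_eq_top.2 hD)
  refine ⟨LinearMap.toContinuousLinearMap (ξ.toLinearMap.comp σ), ?_⟩
  ext v
  have h1 : D (σ (D v)) = D v := LinearMap.congr_fun hσ (D v)
  have h2 := h (v - σ (D v)) (by rw [map_sub, h1, sub_self])
  rw [map_sub, sub_eq_zero] at h2
  simpa using h2

-- Isotropy is naturality of the pairing. For maximality, lift b to a vector and a pulled back
-- covector: it is orthogonal to the part of Λ whose covectors descend, so a correction in ker D
-- moves it into Λ.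
omit [FiniteDimensional ℝ E'] in
lemma IsLag.push {D : E →L[ℝ] E'} (hD : Function.Surjective D)
    {Λ : Submodule ℝ (Pontryagin E)} (hΛ : IsLag Λ) : IsLag (push D Λ) := by
  intro b
  constructor
  · rintro ⟨a, ha, h⟩ b' ⟨a', ha', h'⟩
    rw [← h.dot_eq h']
    exact hΛ.dot_eq_zero ha ha'
  · intro h
    obtain ⟨u, hu⟩ := hD b.1
    obtain ⟨f, hf, hfa⟩ := hΛ.exists_sub_mem (LinearMap.ker D.toLinearMap)
      (x := (u, b.2.comp D)) (fun c hc hcF => by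
        obtain ⟨β, hβ⟩ := exists_comp_eq_of_ker hD (ξ := c.2) hcF
        have h1 : LinRelated D c (D c.1, β) := ⟨rfl, hβ⟩
        have h2 : LinRelated D (u, b.2.comp D) b := ⟨hu, rfl⟩
        rw [h1.dot_eq h2, dot_comm]
        exact h _ ⟨c, hc, h1⟩)
    have hf' : D f = 0 := hf
    exact ⟨_, hfa, by simp [hu, hf'], rfl⟩

/-- The condition `f ∈ K(𝓝(Λ, Ρ))`. -/
def InMagri (Λ Ρ : Submodule ℝ (Pontryagin E)) (f : E) : Prop :=
  ∃ ξ v, (f, ξ) ∈ Λ ∧ (v, 0) ∈ Λ ∧ (-v, ξ) ∈ Ρ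

/-- The projection of Λ to covectors is the annihilator of its kernel: `exists_sub_mem` with F the
whole space. -/
lemma exists_mem_of_annihilates {Λ : Submodule ℝ (Pontryagin E)} (hΛ : IsLag Λ)
    {ξ : E →L[ℝ] ℝ} (h : ∀ k, (k, 0) ∈ Λ → ξ k = 0) : ∃ u, (u, ξ) ∈ Λ := by
  obtain ⟨f, -, hf⟩ := hΛ.exists_sub_mem ⊤ (x := (0, ξ)) (fun c hc hcF => by
    have : c.2 = 0 := by ext f; exact hcF f trivial
    have hk : (c.1, 0) ∈ Λ := by rw [← this]; exact hc
    simp [dot, this, h _ hk])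
  exact ⟨_, hf⟩

/-- Duality. The claim is u ∈ K + Q, where K is the kernel of Λ and Q collects the vectors of
elements of Ρ whose covector also occurs in Λ. A functional ξ killing K extends to f + ξ ∈ Λ;
killing Q yields −v + ξ ∈ Ρ with v ∈ K. So f satisfies `InMagri`, α(f) = 0, and isotropy of Λ forces
ξ(u) = 0. Hence no functional separates u from K + Q. -/
lemma exists_chain_left {Λ Ρ : Submodule ℝ (Pontryagin E)} (hΛ : IsLag Λ) (hΡ : IsLag Ρ)
    {u : E} {α : E →L[ℝ] ℝ} (ha : (u, α) ∈ Λ) (hα : ∀ f, InMagri Λ Ρ f → α f = 0) :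
    ∃ k η z, (k, 0) ∈ Λ ∧ (u - k, η) ∈ Ρ ∧ (z, η) ∈ Λ := by
  let K : Submodule ℝ E := Λ.comap (LinearMap.inl ℝ E (E →L[ℝ] ℝ))
  let T : Submodule ℝ (Pontryagin E) :=
    Ρ ⊓ (Λ.map (LinearMap.snd ℝ E (E →L[ℝ] ℝ))).comap (LinearMap.snd ℝ E (E →L[ℝ] ℝ))
  let Q : Submodule ℝ E := T.map (LinearMap.fst ℝ E (E →L[ℝ] ℝ))
  suffices hu : u ∈ K ⊔ Q by
    obtain ⟨k, hk, _, ⟨q, ⟨hq, ⟨z, hz, hzq⟩⟩, rfl⟩, rfl⟩ := Submodule.mem_sup.1 hu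
    refine ⟨k, q.2, z.1, hk, ?_, ?_⟩
    · simpa using hq
    · have : z.2 = q.2 := hzq
      rw [← this]
      exact hz
  by_contra hu
  obtain ⟨g, hgu, hg⟩ := Submodule.exists_le_ker_of_notMem hu
  let ξ : E →L[ℝ] ℝ := LinearMap.toContinuousLinearMap g
  have hK : ∀ k, (k, 0) ∈ Λ → ξ k = 0 := fun k hk =>
    hg (Submodule.mem_sup_left (show k ∈ K from hk))
  obtain ⟨f, hf⟩ := exists_mem_of_annihilates hΛ hK
  obtain ⟨v, hv, hvΡ⟩ := hΡ.exists_sub_mem K (x := (0, ξ)) (fun c hc hcK => by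
    obtain ⟨z, hz⟩ := exists_mem_of_annihilates hΛ (ξ := c.2) (fun k hk => hcK k hk)
    have : c.1 ∈ Q := ⟨c, ⟨hc, ⟨_, hz, rfl⟩⟩, rfl⟩
    have h0 : ξ c.1 = 0 := hg (Submodule.mem_sup_right this)
    simp [dot, h0])
  have h1 := hα f ⟨ξ, v, hf, hv, by simpa using hvΡ⟩
  have h2 := hΛ.dot_eq_zero ha hf
  simp only [dot, h1, add_zero] at h2
  exact hgu h2

/-- Since the kernel of Λ satisfies `InMagri`, η occurs in Λ, and the left chain applies to any
vector realising it; removing the kernel part keeps the covector η. -/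
lemma exists_chain_right {Λ Ρ : Submodule ℝ (Pontryagin E)} (hΛ : IsLag Λ) (hΡ : IsLag Ρ)
    {η : E →L[ℝ] ℝ} (hη : ∀ f, InMagri Λ Ρ f → η f = 0) :
    ∃ z σ y, (z, η) ∈ Λ ∧ (z, σ) ∈ Ρ ∧ (y, σ) ∈ Λ := by
  obtain ⟨u, hu⟩ := exists_mem_of_annihilates hΛ (ξ := η) (fun k hk =>
    hη k ⟨0, 0, hk, Λ.zero_mem, by simpa using mk_zero_mem Ρ⟩)
  obtain ⟨k, σ, y, hk, hσ, hy⟩ := exists_chain_left hΛ hΡ hu hη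
  refine ⟨u - k, σ, y, ?_, hσ, hy⟩
  simpa using Λ.sub_mem hu hk

/-- The cotangent product of subspaces. -/
def cotProd (Λ Ρ : Submodule ℝ (Pontryagin E)) : Set (Pontryagin E) :=
  {c | ∃ u v ξ, (u, ξ) ∈ Λ ∧ (v, ξ) ∈ Ρ ∧ c = (u + v, ξ)}

end LinearLagrangian

/-! ### Families cut out by smooth equations, and weak concurrence on a vector space -/

section Equations

variable {E : Type*} [NormedAddCommGroup E] [NormedSpace ℝ E]
  {W : Type*} [NormedAddCommGroup W] [NormedSpace ℝ W]
  {W' : Type*} [NormedAddCommGroup W'] [NormedSpace ℝ W']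

/-- A family of subspaces cut out by linear equations with smooth coefficients. -/
def HasSmoothEqs (Λ : E → Submodule ℝ W) (U : Set E) : Prop :=
  ∃ (k : ℕ) (q : E → W →L[ℝ] (Fin k → ℝ)), ContDiffOn ℝ ∞ q U ∧
    ∀ e ∈ U, ∀ a, a ∈ Λ e ↔ q e a = 0

lemma HasSmoothEqs.mono {Λ : E → Submodule ℝ W} {U V : Set E} (h : HasSmoothEqs Λ U)
    (hVU : V ⊆ U) : HasSmoothEqs Λ V := by
  obtain ⟨k, q, hq, hqΛ⟩ := h
  exact ⟨k, q, hq.mono hVU, fun e he => hqΛ e (hVU he)⟩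

lemma HasSmoothEqs.prod {Λ : E → Submodule ℝ W} {Ρ : E → Submodule ℝ W'} {U : Set E}
    (hΛ : HasSmoothEqs Λ U) (hΡ : HasSmoothEqs Ρ U) :
    HasSmoothEqs (fun e => (Λ e).prod (Ρ e)) U := by
  obtain ⟨k, q, hq, hqΛ⟩ := hΛ
  obtain ⟨l, p, hp, hpΡ⟩ := hΡ
  -- Any linear isomorphism of the target spaces will do, since only the common zero set of the
  -- equations matters.
  let j : ((Fin k → ℝ) × (Fin l → ℝ)) ≃L[ℝ] (Fin (k + l) → ℝ) :=
    ContinuousLinearEquiv.ofFinrankEq (by simp)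
  let j₁ : (Fin k → ℝ) →L[ℝ] (Fin (k + l) → ℝ) :=
    (j : ((Fin k → ℝ) × (Fin l → ℝ)) →L[ℝ] (Fin (k + l) → ℝ)).comp (ContinuousLinearMap.inl ℝ _ _)
  let j₂ : (Fin l → ℝ) →L[ℝ] (Fin (k + l) → ℝ) :=
    (j : ((Fin k → ℝ) × (Fin l → ℝ)) →L[ℝ] (Fin (k + l) → ℝ)).comp (ContinuousLinearMap.inr ℝ _ _)
  refine ⟨k + l, fun e => j₁.comp ((q e).comp (ContinuousLinearMap.fst ℝ W W')) +
    j₂.comp ((p e).comp (ContinuousLinearMap.snd ℝ W W')), ?_, ?_⟩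
  · exact (contDiffOn_const.clm_comp (hq.clm_comp contDiffOn_const)).add
      (contDiffOn_const.clm_comp (hp.clm_comp contDiffOn_const))
  · intro e he a
    have h : j₁ (q e a.1) + j₂ (p e a.2) = j (q e a.1, p e a.2) := by
      simp [j₁, j₂, ← map_add]
    rw [Submodule.mem_prod, hqΛ e he, hpΡ e he]
    simp only [add_apply, ContinuousLinearMap.comp_apply,
      ContinuousLinearMap.coe_fst', ContinuousLinearMap.coe_snd', h, map_eq_zero_iff j j.injective,
      Prod.mk_eq_zero]

/-- Smooth solutions of a linear condition `s + T y ∈ Λ`, over a nonempty open subset. -/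
lemma HasSmoothEqs.exists_open_smooth {Y : Type*} [NormedAddCommGroup Y] [NormedSpace ℝ Y]
    [FiniteDimensional ℝ Y] {Λ : E → Submodule ℝ W} {U : Set E} (hΛ : HasSmoothEqs Λ U)
    {V : Set E} (hVU : V ⊆ U) (hV : IsOpen V) (hne : V.Nonempty)
    {s : E → W} (hs : ContDiffOn ℝ ∞ s V) (T : Y →L[ℝ] W)
    (h : ∀ e ∈ V, ∃ y, s e + T y ∈ Λ e) :
    ∃ V' ⊆ V, IsOpen V' ∧ V'.Nonempty ∧ ∃ y : E → Y, ContDiffOn ℝ ∞ y V' ∧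
      ∀ e ∈ V', s e + T (y e) ∈ Λ e := by
  obtain ⟨k, q, hq, hqΛ⟩ := hΛ
  have hq' := hq.mono hVU
  obtain ⟨V', hV'V, hV', hne', y, hy, hyA⟩ := exists_open_smooth_solution hV hne
    (A := fun e => (q e).comp T) (s := fun e => - q e (s e))
    (hq'.clm_comp contDiffOn_const) (hq'.clm_apply hs).neg (fun e he => by
      obtain ⟨y, hy⟩ := h e he
      rw [hqΛ e (hVU he), map_add] at hy
      exact ⟨y, eq_neg_of_add_eq_zero_right hy⟩)
  refine ⟨V', hV'V, hV', hne', y, hy, fun e he => ?_⟩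
  rw [hqΛ e (hVU (hV'V he)), map_add]
  have := hyA e he
  rw [ContinuousLinearMap.comp_apply] at this
  rw [this, add_neg_cancel]

/-- The Courant tensor vanishes on smooth local sections with values in `S`. -/
def CourantZero (S : E → Set (Pontryagin E)) (U : Set E) : Prop :=
  ∀ V ⊆ U, IsOpen V → ∀ a b c : E → Pontryagin E,
    ContDiffOn ℝ ∞ a V → ContDiffOn ℝ ∞ b V → ContDiffOn ℝ ∞ c V →
    (∀ e ∈ V, a e ∈ S e) → (∀ e ∈ V, b e ∈ S e) → (∀ e ∈ V, c e ∈ S e) →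
    ∀ e ∈ V, courant a b c e = 0

lemma CourantZero.mono {S : E → Set (Pontryagin E)} {U V : Set E} (h : CourantZero S U)
    (hVU : V ⊆ U) : CourantZero S V := fun W hW => h W (hW.trans hVU)

/-- Two smooth Lagrangian families over an open subset of `E`, closed under the bracket, and
weakly concurring. -/
structure ConcurOn (Λ Ρ : E → Submodule ℝ (Pontryagin E)) (U : Set E) : Prop where
  lag_left : ∀ e ∈ U, IsLag (Λ e)
  lag_right : ∀ e ∈ U, IsLag (Ρ e)
  eqs_left : HasSmoothEqs Λ U
  eqs_right : HasSmoothEqs Ρ U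
  courant_left : CourantZero (fun e => Λ e) U
  courant_right : CourantZero (fun e => Ρ e) U
  courant_prod : CourantZero (fun e => cotProd (Λ e) (Ρ e)) U

lemma cotProd_comm (Λ Ρ : Submodule ℝ (Pontryagin E)) : cotProd Λ Ρ = cotProd Ρ Λ := by
  ext c
  constructor <;>
  · rintro ⟨u, v, ξ, hu, hv, rfl⟩
    exact ⟨v, u, ξ, hv, hu, by rw [add_comm]⟩

lemma ConcurOn.mono {Λ Ρ : E → Submodule ℝ (Pontryagin E)} {U V : Set E} (h : ConcurOn Λ Ρ U)
    (hVU : V ⊆ U) : ConcurOn Λ Ρ V where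
  lag_left := fun e he => h.lag_left e (hVU he)
  lag_right := fun e he => h.lag_right e (hVU he)
  eqs_left := h.eqs_left.mono hVU
  eqs_right := h.eqs_right.mono hVU
  courant_left := h.courant_left.mono hVU
  courant_right := h.courant_right.mono hVU
  courant_prod := h.courant_prod.mono hVU

/-- This and its dual use that F is constant: derivatives of an F-valued map stay in F, and
derivatives of forms annihilating F still annihilate F. It is the reason for working in adapted
charts. -/
lemma form_fderiv_eq_zero {F : Submodule ℝ E} {V : Set E} (hV : IsOpen V) {f : E → E}
    (hf : ContDiffOn ℝ ∞ f V) (hfF : ∀ e ∈ V, f e ∈ F) {α : E →L[ℝ] ℝ} (hα : ∀ g ∈ F, α g = 0)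
    {e : E} (he : e ∈ V) (h : E) : α (fderiv ℝ f e h) = 0 := by
  have hfe : DifferentiableAt ℝ f e :=
    (hf.contDiffAt (hV.mem_nhds he)).differentiableAt (by simp)
  have h1 : (fun x => α (f x)) =ᶠ[𝓝 e] fun _ => (0 : ℝ) :=
    Filter.eventuallyEq_of_mem (hV.mem_nhds he) fun x hx => hα _ (hfF x hx)
  have h2 := h1.fderiv_eq (𝕜 := ℝ)
  have h3 : fderiv ℝ (fun x => α (f x)) e = α.comp (fderiv ℝ f e) :=
    (α.hasFDerivAt.comp e hfe.hasFDerivAt).fderiv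
  rw [h3] at h2
  simpa using congrArg (fun T : E →L[ℝ] ℝ => T h) h2

lemma fderiv_form_eq_zero {F : Submodule ℝ E} {V : Set E} (hV : IsOpen V)
    {α : E → (E →L[ℝ] ℝ)} (hα : ContDiffOn ℝ ∞ α V) (hαF : ∀ e ∈ V, ∀ g ∈ F, α e g = 0)
    {e : E} (he : e ∈ V) (h : E) {g : E} (hg : g ∈ F) : fderiv ℝ α e h g = 0 := by
  have hαe : DifferentiableAt ℝ α e :=
    (hα.contDiffAt (hV.mem_nhds he)).differentiableAt (by simp)
  have h1 : (fun x => α x g) =ᶠ[𝓝 e] fun _ => (0 : ℝ) :=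
    Filter.eventuallyEq_of_mem (hV.mem_nhds he) fun x hx => hαF x hx g hg
  have h2 := h1.fderiv_eq (𝕜 := ℝ)
  rw [fderiv_clm_apply hαe (differentiableAt_const g)] at h2
  simpa using congrArg (fun T : E →L[ℝ] ℝ => T h) h2

end Equations

/-! ### Smooth chains and the invariance computation -/

section Chains

variable {E : Type*} [NormedAddCommGroup E] [NormedSpace ℝ E] [FiniteDimensional ℝ E]

/-- A linear map on a finite-dimensional space, as a continuous linear map. -/
def clmOf {Y W : Type*} [NormedAddCommGroup Y] [NormedSpace ℝ Y] [FiniteDimensional ℝ Y]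
    [NormedAddCommGroup W] [NormedSpace ℝ W] (g : Y → W) (hg : IsLinearMap ℝ g) : Y →L[ℝ] W :=
  LinearMap.toContinuousLinearMap hg.mk'

@[simp] lemma clmOf_apply {Y W : Type*} [NormedAddCommGroup Y] [NormedSpace ℝ Y]
    [FiniteDimensional ℝ Y] [NormedAddCommGroup W] [NormedSpace ℝ W] (g : Y → W)
    (hg : IsLinearMap ℝ g) (y : Y) : clmOf g hg y = g y := rfl

variable {Λ Ρ : E → Submodule ℝ (Pontryagin E)} {U : Set E}

/-- Membership in Λ, Λ and Ρ is one linear condition in the product, so the witnesses ξ and v can be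
chosen smoothly over a smaller open set. The next two lemmas do the same for the left and right
chains. -/
lemma ConcurOn.exists_smooth_magri_chain (h : ConcurOn Λ Ρ U) {V : Set E} (hVU : V ⊆ U)
    (hV : IsOpen V) (hne : V.Nonempty) {f : E → E} (hf : ContDiffOn ℝ ∞ f V)
    (hfm : ∀ e ∈ V, InMagri (Λ e) (Ρ e) (f e)) :
    ∃ V' ⊆ V, IsOpen V' ∧ V'.Nonempty ∧ ∃ (ξ : E → (E →L[ℝ] ℝ)) (v : E → E),
      ContDiffOn ℝ ∞ ξ V' ∧ ContDiffOn ℝ ∞ v V' ∧ ∀ e ∈ V', (f e, ξ e) ∈ Λ e ∧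
        (v e, 0) ∈ Λ e ∧ (-v e, ξ e) ∈ Ρ e := by
  obtain ⟨V', hV'V, hV', hne', y, hy, hyΛ⟩ :=
    ((h.eqs_left.prod (h.eqs_left.prod h.eqs_right)).exists_open_smooth hVU hV hne
      (s := fun e => ((f e, 0), 0, 0)) ((hf.prodMk contDiffOn_const).prodMk contDiffOn_const)
      (clmOf (fun y : (E →L[ℝ] ℝ) × E =>
        (((0, y.1), (y.2, 0), (-y.2, y.1)) : Pontryagin E × Pontryagin E × Pontryagin E))
        (by constructor <;> intros <;> ext <;> (simp; try abel))) (fun e he => by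
          obtain ⟨ξ, v, h1, h2, h3⟩ := hfm e he
          exact ⟨(ξ, v), by simpa [Submodule.mem_prod] using ⟨h1, h2, h3⟩⟩))
  refine ⟨V', hV'V, hV', hne', fun e => (y e).1, fun e => (y e).2, hy.fst, hy.snd,
    fun e he => ?_⟩
  simpa [Submodule.mem_prod] using hyΛ e he

lemma ConcurOn.exists_smooth_chain_left (h : ConcurOn Λ Ρ U) {V : Set E} (hVU : V ⊆ U)
    (hV : IsOpen V) (hne : V.Nonempty) {a : E → Pontryagin E} (ha : ContDiffOn ℝ ∞ a V)
    (haΛ : ∀ e ∈ V, a e ∈ Λ e)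
    (haF : ∀ e ∈ V, ∀ f, InMagri (Λ e) (Ρ e) f → (a e).2 f = 0) :
    ∃ V' ⊆ V, IsOpen V' ∧ V'.Nonempty ∧ ∃ (k : E → E) (η : E → (E →L[ℝ] ℝ)) (z : E → E),
      ContDiffOn ℝ ∞ k V' ∧ ContDiffOn ℝ ∞ η V' ∧ ContDiffOn ℝ ∞ z V' ∧ ∀ e ∈ V',
        (k e, 0) ∈ Λ e ∧ ((a e).1 - k e, η e) ∈ Ρ e ∧ (z e, η e) ∈ Λ e := by
  obtain ⟨V', hV'V, hV', hne', y, hy, hyΛ⟩ :=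
    ((h.eqs_left.prod (h.eqs_right.prod h.eqs_left)).exists_open_smooth hVU hV hne
      (s := fun e => (0, ((a e).1, 0), 0))
      (contDiffOn_const.prodMk ((ha.fst.prodMk contDiffOn_const).prodMk contDiffOn_const))
      (clmOf (fun y : E × (E →L[ℝ] ℝ) × E =>
        (((y.1, 0), (-y.1, y.2.1), (y.2.2, y.2.1)) :
          Pontryagin E × Pontryagin E × Pontryagin E))
        (by constructor <;> intros <;> ext <;> (simp; try abel))) (fun e he => by
          obtain ⟨k, η, z, h1, h2, h3⟩ := exists_chain_left (h.lag_left e (hVU he))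
            (h.lag_right e (hVU he)) (haΛ e he) (haF e he)
          exact ⟨(k, η, z), by simpa [Submodule.mem_prod, ← sub_eq_add_neg] using ⟨h1, h2, h3⟩⟩))
  refine ⟨V', hV'V, hV', hne', fun e => (y e).1, fun e => (y e).2.1, fun e => (y e).2.2,
    hy.fst, hy.snd.fst, hy.snd.snd, fun e he => ?_⟩
  simpa [Submodule.mem_prod, ← sub_eq_add_neg] using hyΛ e he

lemma ConcurOn.exists_smooth_chain_right (h : ConcurOn Λ Ρ U) {V : Set E} (hVU : V ⊆ U)
    (hV : IsOpen V) (hne : V.Nonempty) {η : E → (E →L[ℝ] ℝ)} (hη : ContDiffOn ℝ ∞ η V)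
    (hηF : ∀ e ∈ V, ∀ f, InMagri (Λ e) (Ρ e) f → η e f = 0) :
    ∃ V' ⊆ V, IsOpen V' ∧ V'.Nonempty ∧ ∃ (z : E → E) (σ : E → (E →L[ℝ] ℝ)) (y : E → E),
      ContDiffOn ℝ ∞ z V' ∧ ContDiffOn ℝ ∞ σ V' ∧ ContDiffOn ℝ ∞ y V' ∧ ∀ e ∈ V',
        (z e, η e) ∈ Λ e ∧ (z e, σ e) ∈ Ρ e ∧ (y e, σ e) ∈ Λ e := by
  obtain ⟨V', hV'V, hV', hne', y, hy, hyΛ⟩ :=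
    ((h.eqs_left.prod (h.eqs_right.prod h.eqs_left)).exists_open_smooth hVU hV hne
      (s := fun e => ((0, η e), 0, 0))
      ((contDiffOn_const.prodMk hη).prodMk contDiffOn_const)
      (clmOf (fun y : E × (E →L[ℝ] ℝ) × E =>
        (((y.1, 0), (y.1, y.2.1), (y.2.2, y.2.1)) :
          Pontryagin E × Pontryagin E × Pontryagin E))
        (by constructor <;> intros <;> ext <;> simp)) (fun e he => by
          obtain ⟨z, σ, y, h1, h2, h3⟩ := exists_chain_right (h.lag_left e (hVU he))
            (h.lag_right e (hVU he)) (hηF e he)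
          exact ⟨(z, σ, y), by simpa [Submodule.mem_prod] using ⟨h1, h2, h3⟩⟩))
  refine ⟨V', hV'V, hV', hne', fun e => (y e).1, fun e => (y e).2.1, fun e => (y e).2.2,
    hy.fst, hy.snd.fst, hy.snd.snd, fun e he => ?_⟩
  simpa [Submodule.mem_prod] using hyΛ e he

/-- For the smaller family, the derivative along `K(𝓝(Λ, Ρ))` of a section annihilating a constant
distribution that contains `K(𝓝(Λ, Ρ))`. -/
lemma ConcurOn.dot_fderiv_left (h : ConcurOn Λ Ρ U) {F : Submodule ℝ E}
    (hF : ∀ e ∈ U, ∀ f, InMagri (Λ e) (Ρ e) f → f ∈ F) {V : Set E} (hVU : V ⊆ U)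
    (hV : IsOpen V) {f : E → E} {a b : E → Pontryagin E} (hf : ContDiffOn ℝ ∞ f V)
    (ha : ContDiffOn ℝ ∞ a V) (hb : ContDiffOn ℝ ∞ b V)
    (hfm : ∀ e ∈ V, InMagri (Λ e) (Ρ e) (f e))
    (haΛ : ∀ e ∈ V, a e ∈ Λ e) (hbΛ : ∀ e ∈ V, b e ∈ Λ e)
    (haF : ∀ e ∈ V, ∀ g ∈ F, (a e).2 g = 0) (hbF : ∀ e ∈ V, ∀ g ∈ F, (b e).2 g = 0) :
    ∀ e ∈ V, dot (fderiv ℝ a e (f e)) (b e) = 0 := by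
  refine eq_zero_of_dense_zeros hV (contDiffOn_dot
    ((ha.fderiv_of_isOpen hV (m := ∞) (by simp)).clm_apply hf) hb).continuousOn
    fun W hWV hW hWne => ?_
  obtain ⟨W₁, hW₁, oW₁, neW₁, ξ, v, hξ, hv, hfΛ⟩ := h.exists_smooth_magri_chain
    (hWV.trans hVU) hW hWne (hf.mono hWV) fun e he => hfm e (hWV he)
  have s₁ := hW₁.trans hWV
  obtain ⟨W₂, hW₂, oW₂, neW₂, ka, ηa, za, hka, hηa, hza, haC⟩ := h.exists_smooth_chain_left
    (s₁.trans hVU) oW₁ neW₁ (ha.mono s₁) (fun e he => haΛ e (s₁ he))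
    (fun e he g hg => haF e (s₁ he) g (hF e (hVU (s₁ he)) g hg))
  have s₂ := hW₂.trans s₁
  obtain ⟨W₃, hW₃, oW₃, ⟨e, he⟩, kb, ηb, zb, hkb, hηb, hzb, hbC⟩ := h.exists_smooth_chain_left
    (s₂.trans hVU) oW₂ neW₂ (hb.mono s₂) (fun e he => hbΛ e (s₂ he))
    (fun e he g hg => hbF e (s₂ he) g (hF e (hVU (s₂ he)) g hg))
  have s₃ := hW₃.trans s₂
  refine ⟨e, hW₁ (hW₂ (hW₃ he)), ?_⟩
  replace hξ := hξ.mono (hW₃.trans hW₂)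
  replace hv := hv.mono (hW₃.trans hW₂)
  replace hka := hka.mono hW₃
  replace hηa := hηa.mono hW₃
  replace hza := hza.mono hW₃
  have hfΛ' := fun x (hx : x ∈ W₃) => hfΛ x (hW₂ (hW₃ hx))
  have haC' := fun x (hx : x ∈ W₃) => haC x (hW₃ hx)
  have ha' := ha.mono s₃
  have hb' := hb.mono s₃
  have hf' := hf.mono s₃
  -- The vector `wa` is common to two elements: with the covector of a it lies in Λ, with `ηa` it
  -- lies in Ρ. Likewise for `wb`.
  obtain ⟨wa, hwa⟩ : ∃ w : E → E, w = fun x => (a x).1 - ka x := ⟨_, rfl⟩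
  obtain ⟨wb, hwb⟩ : ∃ w : E → E, w = fun x => (b x).1 - kb x := ⟨_, rfl⟩
  have cwa : ContDiffOn ℝ ∞ wa W₃ := hwa ▸ ha'.fst.sub hka
  have cwb : ContDiffOn ℝ ∞ wb W₃ := hwb ▸ hb'.fst.sub hkb
  have mwa : ∀ x ∈ W₃, (wa x, (a x).2) ∈ Λ x := fun x hx => by
    have := (Λ x).sub_mem (haΛ x (s₃ hx)) (haC' x hx).1
    rw [hwa]; rwa [Prod.sub_def, sub_zero] at this
  have mwb : ∀ x ∈ W₃, (wb x, (b x).2) ∈ Λ x := fun x hx => by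
    have := (Λ x).sub_mem (hbΛ x (s₃ hx)) (hbC x hx).1
    rw [hwb]; rwa [Prod.sub_def, sub_zero] at this
  have nwa : ∀ x ∈ W₃, (wa x, ηa x) ∈ Ρ x := fun x hx => by rw [hwa]; exact (haC' x hx).2.1
  have nwb : ∀ x ∈ W₃, (wb x, ηb x) ∈ Ρ x := fun x hx => by rw [hwb]; exact (hbC x hx).2.1
  have sU := s₃.trans hVU
  -- T1 contains the wanted derivative along f and an unwanted term −dξ(wa, wb). In T2 − T3 the
  -- Λ-parts cancel, leaving the action of v on the Ρ-parts; T4 is the opposite of that action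
  -- together with −dξ(wa, wb). Hence T2 − T3 + T4 is exactly the unwanted term.
  have T1 := h.courant_left W₃ sU oW₃ _ _ _ (hf'.prodMk hξ) (cwa.prodMk ha'.snd)
    (cwb.prodMk hb'.snd) (fun x hx => (hfΛ' x hx).1) mwa mwb e he
  have T2 := h.courant_prod W₃ sU oW₃ (fun x => (v x, 0)) (fun x => (za x + wa x, ηa x))
    (fun x => (zb x + wb x, ηb x)) (hv.prodMk contDiffOn_const) ((hza.add cwa).prodMk hηa)
    ((hzb.add cwb).prodMk hηb)
    (fun x hx => ⟨v x, 0, 0, (hfΛ' x hx).2.1, mk_zero_mem _, by simp⟩)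
    (fun x hx => ⟨za x, wa x, ηa x, (haC' x hx).2.2, nwa x hx, rfl⟩)
    (fun x hx => ⟨zb x, wb x, ηb x, (hbC x hx).2.2, nwb x hx, rfl⟩) e he
  have T3 := h.courant_left W₃ sU oW₃ (fun x => (v x, 0)) (fun x => (za x, ηa x))
    (fun x => (zb x, ηb x)) (hv.prodMk contDiffOn_const) (hza.prodMk hηa) (hzb.prodMk hηb)
    (fun x hx => (hfΛ' x hx).2.1) (fun x hx => (haC' x hx).2.2) (fun x hx => (hbC x hx).2.2) e he
  have T4 := h.courant_right W₃ sU oW₃ _ _ _ (hv.neg.prodMk hξ) (cwa.prodMk hηa)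
    (cwb.prodMk hηb) (fun x hx => (hfΛ' x hx).2.2) nwa nwb e he
  have D : ∀ {G : Type _} [NormedAddCommGroup G] [NormedSpace ℝ G] {g : E → G},
      ContDiffOn ℝ ∞ g W₃ → DifferentiableAt ℝ g e := fun hg =>
    (hg.contDiffAt (oW₃.mem_nhds he)).differentiableAt (by simp)
  have D' : ∀ {g : E → E →L[ℝ] ℝ}, ContDiffOn ℝ ∞ g W₃ → DifferentiableAt ℝ g e := fun hg =>
    (hg.contDiffAt (oW₃.mem_nhds he)).differentiableAt (by simp)
  have d0 : DifferentiableAt ℝ (fun _ : E => (0 : E →L[ℝ] ℝ)) e := differentiableAt_const _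
  rw [courant_mk (D hf') (D cwa) (D' hξ) (D' ha'.snd)] at T1
  rw [courant_mk (D hv) ((D hza).fun_add (D cwa)) d0 (D' hηa),
    fderiv_fun_add (D hza) (D cwa)] at T2
  rw [courant_mk (D hv) (D hza) d0 (D' hηa)] at T3
  rw [courant_mk (D hv.neg) (D cwa) (D' hξ) (D' hηa)] at T4
  -- Kernel vectors satisfy `InMagri` with ξ = 0 and v = 0. Being F-valued, `ka` and `kb` do not
  -- contribute when `wa`, `wb` are replaced by the vectors of a and b (`e3`, `e4`).
  have kaF : ∀ x ∈ W₃, ka x ∈ F := fun x hx => hF x (sU hx) _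
    ⟨0, 0, (haC' x hx).1, mk_zero_mem _, by simpa using mk_zero_mem (Ρ x)⟩
  have kbF : ∀ x ∈ W₃, kb x ∈ F := fun x hx => hF x (sU hx) _
    ⟨0, 0, (hbC x hx).1, mk_zero_mem _, by simpa using mk_zero_mem (Ρ x)⟩
  have fF : ∀ x ∈ W₃, f x ∈ F := fun x hx => hF x (sU hx) _ (hfm x (s₃ hx))
  have e1 := form_fderiv_eq_zero oW₃ hf' fF (hbF e (s₃ he)) he (wa e)
  have e2 := form_fderiv_eq_zero oW₃ hf' fF (haF e (s₃ he)) he (wb e)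
  have e3 := form_fderiv_eq_zero oW₃ hka kaF (hbF e (s₃ he)) he (f e)
  have e4 := fderiv_form_eq_zero oW₃ ha'.snd (fun x hx => haF x (s₃ hx)) he (f e) (kbF e he)
  have dua : fderiv ℝ (fun x => (a x).1) e = fderiv ℝ wa e + fderiv ℝ ka e := by
    rw [hwa, fderiv_fun_sub (D ha'.fst) (D hka), sub_add_cancel]
  have vub : (b e).1 = wb e + kb e := by rw [hwb]; exact (sub_add_cancel _ _).symm
  have goal : dot (fderiv ℝ a e (f e)) (b e) = (b e).2 (fderiv ℝ (fun x => (a x).1) e (f e))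
      + fderiv ℝ (fun x => (a x).2) e (f e) (b e).1 := by
    simp [dot, fderiv.fst (D ha'), fderiv.snd (D ha')]
  rw [goal, dua, vub]
  simp only [fderiv_fun_neg, map_add, map_neg, add_apply, neg_apply, zero_apply, fderiv_fun_const,
    Pi.zero_apply] at T1 T2 T3 T4 ⊢
  linear_combination T1 - T2 + T3 - T4 + e1 - e2 + e3 + e4

/-- For the larger family, the derivative along `K(𝓝(Λ, Ρ))` of a section annihilating a constant
distribution that contains `K(𝓝(Λ, Ρ))`. -/
lemma ConcurOn.dot_fderiv_right (h : ConcurOn Λ Ρ U) {F : Submodule ℝ E}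
    (hF : ∀ e ∈ U, ∀ f, InMagri (Λ e) (Ρ e) f → f ∈ F) {V : Set E} (hVU : V ⊆ U)
    (hV : IsOpen V) {f : E → E} {a b : E → Pontryagin E} (hf : ContDiffOn ℝ ∞ f V)
    (ha : ContDiffOn ℝ ∞ a V) (hb : ContDiffOn ℝ ∞ b V)
    (hfm : ∀ e ∈ V, InMagri (Λ e) (Ρ e) (f e))
    (haΡ : ∀ e ∈ V, a e ∈ Ρ e) (hbΡ : ∀ e ∈ V, b e ∈ Ρ e)
    (haF : ∀ e ∈ V, ∀ g ∈ F, (a e).2 g = 0) (hbF : ∀ e ∈ V, ∀ g ∈ F, (b e).2 g = 0) :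
    ∀ e ∈ V, dot (fderiv ℝ a e (f e)) (b e) = 0 := by
  refine eq_zero_of_dense_zeros hV (contDiffOn_dot
    ((ha.fderiv_of_isOpen hV (m := ∞) (by simp)).clm_apply hf) hb).continuousOn
    fun W hWV hW hWne => ?_
  obtain ⟨W₁, hW₁, oW₁, neW₁, ξ, v, hξ, hv, hfΛ⟩ := h.exists_smooth_magri_chain
    (hWV.trans hVU) hW hWne (hf.mono hWV) fun e he => hfm e (hWV he)
  have s₁ := hW₁.trans hWV
  obtain ⟨W₂, hW₂, oW₂, neW₂, za, σa, ya, hza, hσa, hya, haC⟩ := h.exists_smooth_chain_right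
    (s₁.trans hVU) oW₁ neW₁ (ha.mono s₁).snd
    (fun e he g hg => haF e (s₁ he) g (hF e (hVU (s₁ he)) g hg))
  have s₂ := hW₂.trans s₁
  obtain ⟨W₃, hW₃, oW₃, ⟨e, he⟩, zb, σb, yb, hzb, hσb, hyb, hbC⟩ := h.exists_smooth_chain_right
    (s₂.trans hVU) oW₂ neW₂ (hb.mono s₂).snd
    (fun e he g hg => hbF e (s₂ he) g (hF e (hVU (s₂ he)) g hg))
  have s₃ := hW₃.trans s₂
  refine ⟨e, hW₁ (hW₂ (hW₃ he)), ?_⟩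
  have sU := s₃.trans hVU
  replace hξ := hξ.mono (hW₃.trans hW₂)
  replace hv := hv.mono (hW₃.trans hW₂)
  replace hza := hza.mono hW₃
  replace hσa := hσa.mono hW₃
  replace hya := hya.mono hW₃
  have hfΛ' := fun x (hx : x ∈ W₃) => hfΛ x (hW₂ (hW₃ hx))
  have haC' := fun x (hx : x ∈ W₃) => haC x (hW₃ hx)
  have hf' := hf.mono s₃
  obtain ⟨wa, ηa, hwa⟩ : ∃ (w : E → E) (η : E → (E →L[ℝ] ℝ)), a = fun x => (w x, η x) :=
    ⟨_, _, rfl⟩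
  obtain ⟨wb, ηb, hwb⟩ : ∃ (w : E → E) (η : E → (E →L[ℝ] ℝ)), b = fun x => (w x, η x) :=
    ⟨_, _, rfl⟩
  subst hwa hwb
  have cwa : ContDiffOn ℝ ∞ wa W₃ := (ha.mono s₃).fst
  have cwb : ContDiffOn ℝ ∞ wb W₃ := (hb.mono s₃).fst
  have cηa : ContDiffOn ℝ ∞ ηa W₃ := (ha.mono s₃).snd
  have cηb : ContDiffOn ℝ ∞ ηb W₃ := (hb.mono s₃).snd
  have c0 : ContDiffOn ℝ ∞ (fun _ : E => (0 : E →L[ℝ] ℝ)) W₃ := contDiffOn_const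
  have m0 : ∀ x ∈ W₃, (v x, (0 : E →L[ℝ] ℝ)) ∈ cotProd (Λ x) (Ρ x) := fun x hx =>
    ⟨v x, 0, 0, (hfΛ' x hx).2.1, mk_zero_mem _, by simp⟩
  have mηa : ∀ x ∈ W₃, (za x + wa x, ηa x) ∈ cotProd (Λ x) (Ρ x) := fun x hx =>
    ⟨za x, wa x, ηa x, (haC' x hx).1, haΡ x (s₃ hx), rfl⟩
  have mηb : ∀ x ∈ W₃, (zb x + wb x, ηb x) ∈ cotProd (Λ x) (Ρ x) := fun x hx =>
    ⟨zb x, wb x, ηb x, (hbC x hx).1, hbΡ x (s₃ hx), rfl⟩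
  have mσa : ∀ x ∈ W₃, (ya x + za x, σa x) ∈ cotProd (Λ x) (Ρ x) := fun x hx =>
    ⟨ya x, za x, σa x, (haC' x hx).2.2, (haC' x hx).2.1, rfl⟩
  have mσb : ∀ x ∈ W₃, (yb x + zb x, σb x) ∈ cotProd (Λ x) (Ρ x) := fun x hx =>
    ⟨yb x, zb x, σb x, (hbC x hx).2.2, (hbC x hx).2.1, rfl⟩
  have mf : ∀ x ∈ W₃, (f x + -v x, ξ x) ∈ cotProd (Λ x) (Ρ x) := fun x hx =>
    ⟨f x, -v x, ξ x, (hfΛ' x hx).1, (hfΛ' x hx).2.2, rfl⟩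
  have L0 := fun x hx => (hfΛ' x hx).2.1
  have Rv := fun x hx => (hfΛ' x hx).2.2
  have Lza := fun x hx => (haC' x hx).1
  have Lzb := fun x hx => (hbC x hx).1
  have Rza := fun x hx => (haC' x hx).2.1
  have Rzb := fun x hx => (hbC x hx).2.1
  have Lya := fun x hx => (haC' x hx).2.2
  have Lyb := fun x hx => (hbC x hx).2.2
  have Rwa : ∀ x ∈ W₃, (wa x, ηa x) ∈ Ρ x := fun x hx => haΡ x (s₃ hx)
  have Rwb : ∀ x ∈ W₃, (wb x, ηb x) ∈ Ρ x := fun x hx => hbΡ x (s₃ hx)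
  -- T1 − T2 + T3 − T4 leaves the derivative of (wa, ηa) along f, terms in the derivative of f
  -- killed by `e1` and `e2`, and the mixed terms −dξ(za, wb) − dξ(wa, zb).
  have T1 := h.courant_prod W₃ sU oW₃ _ _ _ ((hf'.add hv.neg).prodMk hξ)
    ((hza.add cwa).prodMk cηa) ((hzb.add cwb).prodMk cηb) mf mηa mηb e he
  have T2 := h.courant_left W₃ sU oW₃ _ _ _ (hf'.prodMk hξ) (hza.prodMk cηa) (hzb.prodMk cηb)
    (fun x hx => (hfΛ' x hx).1) Lza Lzb e he
  have T3 := h.courant_left W₃ sU oW₃ _ _ _ (hv.prodMk c0) (hza.prodMk cηa) (hzb.prodMk cηb)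
    L0 Lza Lzb e he
  have T4 := h.courant_right W₃ sU oW₃ _ _ _ (hv.neg.prodMk hξ) (cwa.prodMk cηa)
    (cwb.prodMk cηb) Rv Rwa Rwb e he
  -- The mixed terms: T5 − T6 + T7 equals −dξ(wa, zb), and symmetrically T8 − T9 + T10 equals
  -- −dξ(za, wb). This is where the extra links `σ` and `y` of the right chain are needed.
  have T5 := h.courant_prod W₃ sU oW₃ _ _ _ (hv.prodMk c0)
    ((hza.add cwa).prodMk cηa) ((hyb.add hzb).prodMk hσb) m0 mηa mσb e he
  have T6 := h.courant_left W₃ sU oW₃ _ _ _ (hv.prodMk c0) (hza.prodMk cηa) (hyb.prodMk hσb)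
    L0 Lza Lyb e he
  have T7 := h.courant_right W₃ sU oW₃ _ _ _ (hv.neg.prodMk hξ) (cwa.prodMk cηa)
    (hzb.prodMk hσb) Rv Rwa Rzb e he
  have T8 := h.courant_prod W₃ sU oW₃ _ _ _ (hv.prodMk c0)
    ((hya.add hza).prodMk hσa) ((hzb.add cwb).prodMk cηb) m0 mσa mηb e he
  have T9 := h.courant_left W₃ sU oW₃ _ _ _ (hv.prodMk c0) (hya.prodMk hσa) (hzb.prodMk cηb)
    L0 Lya Lzb e he
  have T10 := h.courant_right W₃ sU oW₃ _ _ _ (hv.neg.prodMk hξ) (hza.prodMk hσa)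
    (cwb.prodMk cηb) Rv Rza Rwb e he
  have D : ∀ {g : E → E}, ContDiffOn ℝ ∞ g W₃ → DifferentiableAt ℝ g e := fun hg =>
    (hg.contDiffAt (oW₃.mem_nhds he)).differentiableAt (by simp)
  have D' : ∀ {g : E → E →L[ℝ] ℝ}, ContDiffOn ℝ ∞ g W₃ → DifferentiableAt ℝ g e := fun hg =>
    (hg.contDiffAt (oW₃.mem_nhds he)).differentiableAt (by simp)
  rw [courant_mk ((D hf').fun_add (D hv.neg)) ((D hza).fun_add (D cwa)) (D' hξ) (D' cηa),
    fderiv_fun_add (D hza) (D cwa), fderiv_fun_add (D hf') (D hv.neg)] at T1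
  rw [courant_mk (D hf') (D hza) (D' hξ) (D' cηa)] at T2
  rw [courant_mk (D hv) (D hza) (D' c0) (D' cηa)] at T3
  rw [courant_mk (D hv.neg) (D cwa) (D' hξ) (D' cηa)] at T4
  rw [courant_mk (D hv) ((D hza).fun_add (D cwa)) (D' c0) (D' cηa),
    fderiv_fun_add (D hza) (D cwa)] at T5
  rw [courant_mk (D hv) (D hza) (D' c0) (D' cηa)] at T6
  rw [courant_mk (D hv.neg) (D cwa) (D' hξ) (D' cηa)] at T7
  rw [courant_mk (D hv) ((D hya).fun_add (D hza)) (D' c0) (D' hσa),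
    fderiv_fun_add (D hya) (D hza)] at T8
  rw [courant_mk (D hv) (D hya) (D' c0) (D' hσa)] at T9
  rw [courant_mk (D hv.neg) (D hza) (D' hξ) (D' hσa)] at T10
  have fF : ∀ x ∈ W₃, f x ∈ F := fun x hx => hF x (sU hx) _ (hfm x (s₃ hx))
  have e1 := form_fderiv_eq_zero oW₃ hf' fF (hbF e (s₃ he)) he (wa e)
  have e2 := form_fderiv_eq_zero oW₃ hf' fF (haF e (s₃ he)) he (wb e)
  have goal : dot (fderiv ℝ (fun x => (wa x, ηa x)) e (f e)) (wb e, ηb e)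
      = ηb e (fderiv ℝ wa e (f e)) + fderiv ℝ ηa e (f e) (wb e) := by
    simp [dot, (D cwa).fderiv_prodMk (D' cηa)]
  rw [goal]
  simp only [fderiv_fun_neg, map_add, map_neg, add_apply, neg_apply, zero_apply, fderiv_fun_const,
    Pi.zero_apply] at T1 T2 T3 T4 T5 T6 T7 T8 T9 T10 e1 e2 ⊢
  linear_combination T1 - T2 + T3 - T4 - T5 + T6 - T7 - T8 + T9 - T10 + e1 - e2

end Chains

/-! ### Invariance along a constant distribution -/

section Invariance

variable {E : Type*} [NormedAddCommGroup E] [NormedSpace ℝ E] [FiniteDimensional ℝ E]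

/-- The sections of `Λ` annihilating `F` are preserved, up to `Λ[F]`, by derivatives along `F`. -/
def InvariantOn (Λ : E → Submodule ℝ (Pontryagin E)) (F : Submodule ℝ E) (U : Set E) : Prop :=
  ∀ V ⊆ U, IsOpen V → ∀ a b : E → Pontryagin E, ContDiffOn ℝ ∞ a V → ContDiffOn ℝ ∞ b V →
    (∀ e ∈ V, a e ∈ Λ e) → (∀ e ∈ V, b e ∈ Λ e) →
    (∀ e ∈ V, ∀ g ∈ F, (a e).2 g = 0) → (∀ e ∈ V, ∀ g ∈ F, (b e).2 g = 0) →
    ∀ f ∈ F, ∀ e ∈ V, dot (fderiv ℝ a e f) (b e) = 0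

/-- The splitting and all the witnesses of both `InMagri` conditions are solved for together as one
linear system; f₂ is not an unknown but f − f₁. -/
lemma exists_smooth_magri_split {Λ₁ Ρ₁ Λ₂ Ρ₂ : E → Submodule ℝ (Pontryagin E)} {U : Set E}
    (h₁ : ConcurOn Λ₁ Ρ₁ U) (h₂ : ConcurOn Λ₂ Ρ₂ U) {V : Set E} (hVU : V ⊆ U)
    (hV : IsOpen V) (hne : V.Nonempty) {f : E}
    (hf : ∀ e ∈ V, ∃ f₁ f₂, f₁ + f₂ = f ∧ InMagri (Λ₁ e) (Ρ₁ e) f₁ ∧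
      InMagri (Λ₂ e) (Ρ₂ e) f₂) :
    ∃ V' ⊆ V, IsOpen V' ∧ V'.Nonempty ∧ ∃ f₁ f₂ : E → E, ContDiffOn ℝ ∞ f₁ V' ∧
      ContDiffOn ℝ ∞ f₂ V' ∧ ∀ e ∈ V', f₁ e + f₂ e = f ∧ InMagri (Λ₁ e) (Ρ₁ e) (f₁ e) ∧
        InMagri (Λ₂ e) (Ρ₂ e) (f₂ e) := by
  obtain ⟨V', hV'V, hV', hne', y, hy, hyΛ⟩ :=
    ((h₁.eqs_left.prod (h₁.eqs_left.prod h₁.eqs_right)).prod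
      (h₂.eqs_left.prod (h₂.eqs_left.prod h₂.eqs_right))).exists_open_smooth hVU hV hne
      (s := fun _ => ((0, 0, 0), ((f, 0), 0, 0))) contDiffOn_const
      (clmOf (fun y : (E × (E →L[ℝ] ℝ) × E) × (E →L[ℝ] ℝ) × E =>
        ((((y.1.1, y.1.2.1), (y.1.2.2, 0), (-y.1.2.2, y.1.2.1)),
          ((-y.1.1, y.2.1), (y.2.2, 0), (-y.2.2, y.2.1))) :
          (Pontryagin E × Pontryagin E × Pontryagin E) ×
            (Pontryagin E × Pontryagin E × Pontryagin E)))
        (by constructor <;> intros <;> ext <;> (simp; try abel))) (fun e he => by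
          obtain ⟨f₁, f₂, rfl, ⟨ξ, v, h1, h2, h3⟩, ⟨ξ', v', h1', h2', h3'⟩⟩ := hf e he
          exact ⟨((f₁, ξ, v), (ξ', v')), by
            simpa [Submodule.mem_prod] using ⟨⟨h1, h2, h3⟩, h1', h2', h3'⟩⟩)
  refine ⟨V', hV'V, hV', hne', fun e => (y e).1.1, fun e => f - (y e).1.1, hy.fst.fst,
    contDiffOn_const.sub hy.fst.fst, fun e he => ?_⟩
  have := hyΛ e he
  simp only [clmOf_apply, Submodule.mem_prod, Prod.mk_add_mk,
    zero_add] at this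
  obtain ⟨⟨h1, h2, h3⟩, h1', h2', h3'⟩ := this
  exact ⟨add_sub_cancel _ _, ⟨_, _, h1, h2, h3⟩, ⟨_, _, by rwa [← sub_eq_add_neg] at h1', h2', h3'⟩⟩

/-- Invariance along a constant distribution spanned by `K(𝓝(Λ₁, Ρ₁))` and `K(𝓝(Λ₂, Ρ₂))`. -/
lemma invariantOn_of_concurOn {Λ₁ Ρ₁ Λ₂ Ρ₂ Θ : E → Submodule ℝ (Pontryagin E)} {U : Set E}
    (h₁ : ConcurOn Λ₁ Ρ₁ U) (h₂ : ConcurOn Λ₂ Ρ₂ U) {F : Submodule ℝ E}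
    (hF : ∀ e ∈ U, ∀ f, f ∈ F ↔ ∃ f₁ f₂, f₁ + f₂ = f ∧ InMagri (Λ₁ e) (Ρ₁ e) f₁ ∧
      InMagri (Λ₂ e) (Ρ₂ e) f₂)
    (hΘ₁ : Θ = Λ₁ ∨ Θ = Ρ₁) (hΘ₂ : Θ = Λ₂ ∨ Θ = Ρ₂) : InvariantOn Θ F U := by
  intro V hVU hV a b ha hb haΘ hbΘ haF hbF f hf
  have z : ∀ Λ Ρ : Submodule ℝ (Pontryagin E), InMagri Λ Ρ 0 := fun Λ Ρ =>
    ⟨0, 0, mk_zero_mem _, mk_zero_mem _, by simpa using mk_zero_mem Ρ⟩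
  have hF₁ : ∀ e ∈ U, ∀ f, InMagri (Λ₁ e) (Ρ₁ e) f → f ∈ F := fun e he f hf =>
    (hF e he f).2 ⟨f, 0, add_zero f, hf, z _ _⟩
  have hF₂ : ∀ e ∈ U, ∀ f, InMagri (Λ₂ e) (Ρ₂ e) f → f ∈ F := fun e he f hf =>
    (hF e he f).2 ⟨0, f, zero_add f, z _ _, hf⟩
  refine eq_zero_of_dense_zeros hV (contDiffOn_dot
    ((ha.fderiv_of_isOpen hV (m := ∞) (by simp)).clm_apply contDiffOn_const) hb).continuousOn
    fun W hWV hW hWne => ?_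
  obtain ⟨W', hW', oW', ⟨e, he⟩, f₁, f₂, hf₁, hf₂, hff⟩ := exists_smooth_magri_split h₁ h₂
    (hWV.trans hVU) hW hWne (fun e he => (hF e (hVU (hWV he)) f).1 hf)
  refine ⟨e, hW' he, ?_⟩
  have s := hW'.trans hWV
  have m := fun x (hx : x ∈ W') => haΘ x (s hx)
  have n := fun x (hx : x ∈ W') => hbΘ x (s hx)
  have maF := fun x (hx : x ∈ W') => haF x (s hx)
  have mbF := fun x (hx : x ∈ W') => hbF x (s hx)
  have k₁ : dot (fderiv ℝ a e (f₁ e)) (b e) = 0 := by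
    rcases hΘ₁ with rfl | rfl
    · exact h₁.dot_fderiv_left hF₁ (s.trans hVU) oW' hf₁ (ha.mono s) (hb.mono s)
        (fun x hx => (hff x hx).2.1) m n maF mbF e he
    · exact h₁.dot_fderiv_right hF₁ (s.trans hVU) oW' hf₁ (ha.mono s) (hb.mono s)
        (fun x hx => (hff x hx).2.1) m n maF mbF e he
  have k₂ : dot (fderiv ℝ a e (f₂ e)) (b e) = 0 := by
    rcases hΘ₂ with rfl | rfl
    · exact h₂.dot_fderiv_left hF₂ (s.trans hVU) oW' hf₂ (ha.mono s) (hb.mono s)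
        (fun x hx => (hff x hx).2.2) m n maF mbF e he
    · exact h₂.dot_fderiv_right hF₂ (s.trans hVU) oW' hf₂ (ha.mono s) (hb.mono s)
        (fun x hx => (hff x hx).2.2) m n maF mbF e he
  rw [← (hff e he).1, map_add, dot_add_left, k₁, k₂, add_zero]

/-- Sections of `Λ[F]` remain orthogonal to `Λ[F]` when differentiated along `F`. -/
lemma InvariantOn.dot_fderiv_closest {Λ : E → Submodule ℝ (Pontryagin E)} {F : Submodule ℝ E}
    {U : Set E} (h : InvariantOn Λ F U) (hΛ : HasSmoothEqs Λ U)
    {V : Set E} (hVU : V ⊆ U) (hV : IsOpen V) {a b : E → Pontryagin E}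
    (ha : ContDiffOn ℝ ∞ a V) (hb : ContDiffOn ℝ ∞ b V)
    (haΛ : ∀ e ∈ V, a e ∈ closest (Λ e) F) (hbΛ : ∀ e ∈ V, b e ∈ closest (Λ e) F) :
    ∀ f ∈ F, ∀ e ∈ V, dot (fderiv ℝ a e f) (b e) = 0 := by
  intro f hf
  refine eq_zero_of_dense_zeros hV (contDiffOn_dot
    ((ha.fderiv_of_isOpen hV (m := ∞) (by simp)).clm_apply contDiffOn_const) hb).continuousOn
    fun W hWV hW hWne => ?_
  -- An element of Λ[F] becomes an element of Λ after subtracting a vector of F. With that vector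
  -- chosen smoothly, its derivatives remain in F and pair to zero with covectors annihilating F.
  have split : ∀ W ⊆ V, IsOpen W → W.Nonempty → ∀ a : E → Pontryagin E, ContDiffOn ℝ ∞ a V →
      (∀ e ∈ V, a e ∈ closest (Λ e) F) → ∃ W' ⊆ W, IsOpen W' ∧ W'.Nonempty ∧ ∃ y : E → F,
        ContDiffOn ℝ ∞ y W' ∧ ∀ e ∈ W', a e + (-(y e : E), 0) ∈ Λ e := by
    intro W hWV hW hWne a ha haΛ
    exact hΛ.exists_open_smooth (hWV.trans hVU) hW hWne (ha.mono hWV)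
      (clmOf (fun y : F => ((-(y : E), 0) : Pontryagin E))
        (by constructor <;> intros <;> ext <;> (simp; try abel))) (fun e he => by
          obtain ⟨-, g, hg, hga⟩ := haΛ e (hWV he)
          refine ⟨⟨g, hg⟩, ?_⟩
          simpa [Prod.add_def, ← sub_eq_add_neg] using hga)
  obtain ⟨W₁, hW₁, oW₁, neW₁, ya, hya, hyaΛ⟩ := split W hWV hW hWne a ha haΛ
  obtain ⟨W₂, hW₂, oW₂, ⟨e, he⟩, yb, hyb, hybΛ⟩ := split W₁ (hW₁.trans hWV) oW₁ neW₁ b hb hbΛ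
  refine ⟨e, hW₁ (hW₂ he), ?_⟩
  have s := (hW₂.trans hW₁).trans hWV
  have cya : ContDiffOn ℝ ∞ (fun x => (ya x : E)) W₂ :=
    F.subtypeL.contDiff.comp_contDiffOn (hya.mono hW₂)
  have cyb : ContDiffOn ℝ ∞ (fun x => (yb x : E)) W₂ :=
    F.subtypeL.contDiff.comp_contDiffOn hyb
  have ca : ContDiffOn ℝ ∞ (fun x => a x + (-(ya x : E), 0)) W₂ :=
    (ha.mono s).add (cya.neg.prodMk contDiffOn_const)
  have cb : ContDiffOn ℝ ∞ (fun x => b x + (-(yb x : E), 0)) W₂ :=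
    (hb.mono s).add (cyb.neg.prodMk contDiffOn_const)
  have aF : ∀ x ∈ W₂, ∀ g ∈ F, (a x).2 g = 0 := fun x hx => (haΛ x (s hx)).1
  have bF : ∀ x ∈ W₂, ∀ g ∈ F, (b x).2 g = 0 := fun x hx => (hbΛ x (s hx)).1
  have key := h W₂ (s.trans hVU) oW₂ _ _ ca cb (fun x hx => hyaΛ x (hW₂ hx)) hybΛ
    (fun x hx => by simpa using aF x hx) (fun x hx => by simpa using bF x hx) f hf e he
  have da : DifferentiableAt ℝ a e :=
    ((ha.mono s).contDiffAt (oW₂.mem_nhds he)).differentiableAt (by simp)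
  have dya : DifferentiableAt ℝ (fun x => (ya x : E)) e :=
    (cya.contDiffAt (oW₂.mem_nhds he)).differentiableAt (by simp)
  have k₁ := form_fderiv_eq_zero oW₂ cya (fun x _ => (ya x).2) (bF e he) he f
  have k₂ := fderiv_form_eq_zero oW₂ (ha.mono s).snd aF he f (yb e).2
  have d0 : DifferentiableAt ℝ (fun _ : E => (0 : E →L[ℝ] ℝ)) e := differentiableAt_const _
  rw [fderiv_fun_add da (dya.fun_neg.prodMk d0), dya.fun_neg.fderiv_prodMk d0, fderiv_fun_neg]
    at key
  rw [fderiv.snd da] at k₂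
  simp [dot] at key k₁ k₂ ⊢
  linarith

end Invariance

/-! ### Smooth frames and local reduction along a linear projection -/

section Frames

variable {E : Type*} [NormedAddCommGroup E] [NormedSpace ℝ E] [FiniteDimensional ℝ E]
  {E' : Type*} [NormedAddCommGroup E'] [NormedSpace ℝ E'] [FiniteDimensional ℝ E']

/-- A family of subspaces with a smooth frame around `e₀`. -/
def HasFrameAt (Λ : E → Submodule ℝ (Pontryagin E)) (e₀ : E) : Prop :=
  ∃ U, IsOpen U ∧ e₀ ∈ U ∧ ∃ (k : ℕ) (g : Fin k → E → Pontryagin E),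
    (∀ i, ContDiffOn ℝ ∞ (g i) U) ∧
    ∀ e ∈ U, LinearIndependent ℝ (fun i => g i e) ∧
      Submodule.span ℝ (Set.range (fun i => g i e)) = Λ e

-- A Lagrangian family is its own orthogonal, so pairing with the members of a smooth frame gives
-- its equations.
omit [FiniteDimensional ℝ E] in
lemma HasFrameAt.hasSmoothEqs {Λ : E → Submodule ℝ (Pontryagin E)} {e₀ : E}
    (h : HasFrameAt Λ e₀) {U₀ : Set E} (hU₀ : IsOpen U₀) (he₀ : e₀ ∈ U₀)
    (hlag : ∀ e ∈ U₀, IsLag (Λ e)) : ∃ U ⊆ U₀, IsOpen U ∧ e₀ ∈ U ∧ HasSmoothEqs Λ U := by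
  obtain ⟨U, hU, heU, k, g, hg, hgΛ⟩ := h
  refine ⟨U₀ ∩ U, Set.inter_subset_left, hU₀.inter hU, ⟨he₀, heU⟩, k,
    fun e => ContinuousLinearMap.pi fun i => dotL E (g i e), ?_, ?_⟩
  · exact (ContinuousLinearMap.piEquivL ℝ (Pontryagin E) (fun _ : Fin k => ℝ)).contDiff.comp_contDiffOn
      (contDiffOn_pi.2 fun i => (dotL E).contDiff.comp_contDiffOn
        ((hg i).mono Set.inter_subset_right))
  · rintro e ⟨he, heU'⟩ a
    rw [hlag e he a, ← (hgΛ e heU').2]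
    constructor
    · intro h
      ext i
      simpa [dot_comm] using h _ (Submodule.subset_span ⟨i, rfl⟩)
    · intro h b hb
      induction hb using Submodule.span_induction with
      | mem x hx =>
        obtain ⟨i, rfl⟩ := hx
        simpa [dot_comm] using congrFun h i
      | zero => exact dot_zero_right a
      | add x y _ _ hx hy => rw [dot_add_right, hx, hy, add_zero]
      | smul r x _ hx => rw [dot_smul_right, hx, mul_zero]

/-- Near `e₀`, a family with a smooth frame is the graph of a smooth map over its value at `e₀`. -/
lemma HasFrameAt.exists_graph {Λ : E → Submodule ℝ (Pontryagin E)} {e₀ : E}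
    (h : HasFrameAt Λ e₀) {U₀ : Set E} (hU₀ : U₀ ∈ 𝓝 e₀) :
    ∃ r > 0, Metric.ball e₀ r ⊆ U₀ ∧ ∃ (S : E → Λ e₀ →L[ℝ] Pontryagin E)
      (P : Pontryagin E →L[ℝ] Λ e₀), ContDiffOn ℝ ∞ S (Metric.ball e₀ r) ∧
      (∀ d, S e₀ d = d) ∧ ∀ e ∈ Metric.ball e₀ r, (∀ d, S e d ∈ Λ e) ∧ (∀ d, P (S e d) = d) ∧
        ∀ a ∈ Λ e, ∃ d, S e d = a := by
  obtain ⟨U, hU, heU, k, g, hg, hgΛ⟩ := h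
  let Φ : E → (Fin k → ℝ) →L[ℝ] Pontryagin E := fun e =>
    ∑ i, (ContinuousLinearMap.proj (R := ℝ) (φ := fun _ : Fin k => ℝ) i).smulRight (g i e)
  have hΦa : ∀ e c, Φ e c = ∑ i, c i • g i e := fun e c => by simp [Φ]
  have hΦ : ContDiffOn ℝ ∞ Φ U := by
    refine ContDiffOn.sum fun i _ => ?_
    exact (ContinuousLinearMap.smulRightL ℝ (Fin k → ℝ) (Pontryagin E)
      (ContinuousLinearMap.proj i)).contDiff.comp_contDiffOn (hg i)
  have hΦmem : ∀ e ∈ U, ∀ c, Φ e c ∈ Λ e := fun e he c => by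
    rw [hΦa, ← (hgΛ e he).2]
    exact Submodule.sum_mem _ fun i _ =>
      Submodule.smul_mem _ _ (Submodule.subset_span ⟨i, rfl⟩)
  have hΦsurj : ∀ e ∈ U, ∀ a ∈ Λ e, ∃ c, Φ e c = a := fun e he a ha => by
    rw [← (hgΛ e he).2, Submodule.mem_span_range_iff_exists_fun] at ha
    obtain ⟨c, hc⟩ := ha
    exact ⟨c, by rw [hΦa, hc]⟩
  have hΦinj : ∀ e ∈ U, ∀ c, Φ e c = 0 → c = 0 := fun e he c hc => by
    rw [hΦa] at hc
    exact funext (Fintype.linearIndependent_iff.1 (hgΛ e he).1 c hc)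
  obtain ⟨P', hP'⟩ := LinearMap.exists_leftInverse_of_injective (Λ e₀).subtype
    (Submodule.ker_subtype _)
  let P : Pontryagin E →L[ℝ] Λ e₀ := LinearMap.toContinuousLinearMap P'
  have hP : ∀ d : Λ e₀, P (d : Pontryagin E) = d := fun d => LinearMap.congr_fun hP' d
  let j : (Fin k → ℝ) ≃ₗ[ℝ] Λ e₀ := LinearEquiv.ofBijective
    ((P.comp (Φ e₀)).toLinearMap) (by
      constructor
      · rw [← LinearMap.ker_eq_bot, LinearMap.ker_eq_bot']
        intro c hc
        apply hΦinj e₀ heU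
        have h1 : P (Φ e₀ c) = 0 := hc
        rw [show Φ e₀ c = ((⟨Φ e₀ c, hΦmem e₀ heU c⟩ : Λ e₀) : Pontryagin E) from rfl, hP] at h1
        exact congrArg Subtype.val h1
      · intro d
        obtain ⟨c, hc⟩ := hΦsurj e₀ heU d d.2
        refine ⟨c, ?_⟩
        show P (Φ e₀ c) = d
        rw [hc, hP])
  let J : (Fin k → ℝ) ≃L[ℝ] Λ e₀ := j.toContinuousLinearEquiv
  have hJ : ∀ c, J c = P (Φ e₀ c) := fun c => rfl
  -- `N` is the frame projected back to the fibre at `e₀`. Dividing the frame `Φ` by it normalises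
  -- the parametrisation, so that `P` inverts it at every point.
  let N : E → (Fin k → ℝ) →L[ℝ] (Fin k → ℝ) := fun e =>
    (J.symm : Λ e₀ →L[ℝ] (Fin k → ℝ)).comp (P.comp (Φ e))
  have hN : ContDiffOn ℝ ∞ N U := contDiffOn_const.clm_comp (contDiffOn_const.clm_comp hΦ)
  have hN₁ : N e₀ = 1 := by
    ext1 c
    show J.symm (P (Φ e₀ c)) = c
    rw [← hJ, ContinuousLinearEquiv.symm_apply_apply]
  have hN₀ : IsUnit (N e₀) := hN₁ ▸ isUnit_one
  have hopen : IsOpen (U ∩ N ⁻¹' {x | IsUnit x}) :=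
    hN.continuousOn.isOpen_inter_preimage hU Units.isOpen
  obtain ⟨r, hr, hball⟩ := Metric.mem_nhds_iff.1
    (Filter.inter_mem hU₀ (hopen.mem_nhds ⟨heU, hN₀⟩))
  refine ⟨r, hr, fun e he => (hball he).1,
    fun e => (Φ e).comp ((Ring.inverse (N e)).comp (J.symm : Λ e₀ →L[ℝ] (Fin k → ℝ))), P, ?_, ?_, ?_⟩
  · have hinv : ContDiffOn ℝ ∞ (fun e => Ring.inverse (N e)) (Metric.ball e₀ r) := by
      intro e he
      obtain ⟨w, hw⟩ := (hball he).2.2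
      have h1 : ContDiffAt ℝ ∞ Ring.inverse (N e) := hw ▸ contDiffAt_ringInverse ℝ w
      exact h1.comp_contDiffWithinAt e ((hN e (hball he).2.1).mono fun x hx => (hball hx).2.1)
    exact (hΦ.mono fun x hx => (hball hx).2.1).clm_comp (hinv.clm_comp contDiffOn_const)
  · intro d
    have h1 : Ring.inverse (N e₀) (J.symm d) = J.symm d := by
      rw [hN₁, Ring.inverse_one]; rfl
    obtain ⟨c, rfl⟩ := J.surjective d
    show Φ e₀ (Ring.inverse (N e₀) (J.symm (J c))) = _
    rw [h1, ContinuousLinearEquiv.symm_apply_apply, hJ]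
    exact (congrArg Subtype.val (hP ⟨Φ e₀ c, hΦmem e₀ heU c⟩)).symm
  · intro e he
    have hu := (hball he).2.2
    have heU' := (hball he).2.1
    refine ⟨fun d => hΦmem e heU' _, fun d => ?_, fun a ha => ?_⟩
    · have h1 : (N e * Ring.inverse (N e)) (J.symm d) = J.symm d := by
        rw [Ring.mul_inverse_cancel _ hu]; rfl
      have h2 : J.symm (P (Φ e (Ring.inverse (N e) (J.symm d)))) = J.symm d := h1
      exact J.symm.injective h2
    · obtain ⟨c, rfl⟩ := hΦsurj e heU' a ha
      refine ⟨J (N e c), ?_⟩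
      have h1 : (Ring.inverse (N e) * N e) c = c := by
        rw [Ring.inverse_mul_cancel _ hu]; rfl
      show Φ e (Ring.inverse (N e) (J.symm (J (N e c)))) = Φ e c
      rw [ContinuousLinearEquiv.symm_apply_apply]
      exact congrArg (Φ e) h1

omit [FiniteDimensional ℝ E] in
/-- A function on a ball with vanishing derivatives along `F` is constant along `F`. -/
lemma eq_of_fderiv_along_eq_zero {G : Type*} [NormedAddCommGroup G] [NormedSpace ℝ G]
    {F : Submodule ℝ E} {e₀ : E} {r : ℝ} {s : E → G} (hs : ContDiffOn ℝ ∞ s (Metric.ball e₀ r))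
    (h : ∀ e ∈ Metric.ball e₀ r, ∀ f ∈ F, fderiv ℝ s e f = 0) {e e' : E}
    (he : e ∈ Metric.ball e₀ r) (he' : e' ∈ Metric.ball e₀ r) (hF : e' - e ∈ F) : s e' = s e := by
  have hmem : ∀ t ∈ Set.Icc (0 : ℝ) 1, e + t • (e' - e) ∈ Metric.ball e₀ r := fun t ht =>
    (convex_ball e₀ r).add_smul_sub_mem he he' ht
  have hder : ∀ t ∈ Set.Icc (0 : ℝ) 1,
      HasDerivAt (fun t : ℝ => s (e + t • (e' - e))) 0 t := fun t ht => by
    have h1 : HasFDerivAt s (fderiv ℝ s (e + t • (e' - e))) (e + t • (e' - e)) :=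
      ((hs.contDiffAt (Metric.isOpen_ball.mem_nhds (hmem t ht))).differentiableAt
        (by simp)).hasFDerivAt
    have h2 : HasDerivAt (fun t : ℝ => e + t • (e' - e)) (e' - e) t := by
      simpa using ((hasDerivAt_id t).smul_const (e' - e)).const_add e
    have h3 := h1.comp_hasDerivAt t h2
    rwa [h _ (hmem t ht) _ hF] at h3
  have := constant_of_has_deriv_right_zero (f := fun t : ℝ => s (e + t • (e' - e)))
    (fun t ht => (hder t ht).continuousAt.continuousWithinAt)
    (fun t ht => (hder t (Set.Ico_subset_Icc_self ht)).hasDerivWithinAt) 1 (by simp)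
  simpa using this

-- A forward image only sees elements whose covector annihilates ker π, and it forgets vectors in
-- ker π. So Λ[ker π], the family assumed smooth, carries all the information.
omit [FiniteDimensional ℝ E] [FiniteDimensional ℝ E'] in
lemma push_closest (π : E →L[ℝ] E') (Λ : Submodule ℝ (Pontryagin E)) :
    push π (closest Λ (LinearMap.ker π.toLinearMap)) = push π Λ := by
  ext b
  constructor
  · rintro ⟨a, ⟨-, f, hf, hfa⟩, h1, h2⟩
    have hf' : π f = 0 := hf
    exact ⟨_, hfa, by simp [hf', h1], h2⟩
  · rintro ⟨a, ha, h1, h2⟩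
    refine ⟨a, ⟨fun f hf => ?_, 0, Submodule.zero_mem _, by simpa using ha⟩, h1, h2⟩
    have hf' : π f = 0 := hf
    simp [h2, hf']

/-- Local reduction: the forward image under a linear projection of an invariant family is locally
constant along the fibres and has smooth sections through all its elements. -/
lemma InvariantOn.exists_reduction {Λ : E → Submodule ℝ (Pontryagin E)} {U : Set E}
    {π : E →L[ℝ] E'} (hπ : Function.Surjective π)
    (h : InvariantOn Λ (LinearMap.ker π.toLinearMap) U)
    (hΛ : HasSmoothEqs Λ U) (hlag : ∀ e ∈ U, IsLag (Λ e)) (hU : IsOpen U) {e₀ : E} (he₀ : e₀ ∈ U)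
    (hfr : HasFrameAt (fun e => closest (Λ e) (LinearMap.ker π.toLinearMap)) e₀) :
    ∃ r > 0, Metric.ball e₀ r ⊆ U ∧
      (∀ e ∈ Metric.ball e₀ r, ∀ e' ∈ Metric.ball e₀ r, π e = π e' →
        push π (Λ e) = push π (Λ e')) ∧
      ∀ b₀ ∈ push π (Λ e₀), ∃ W, IsOpen W ∧ π e₀ ∈ W ∧ ∃ b : E' → Pontryagin E',
        ContDiffOn ℝ ∞ b W ∧ b (π e₀) = b₀ ∧
        ∀ y ∈ W, ∃ e ∈ Metric.ball e₀ r, π e = y ∧ b y ∈ push π (Λ e) := by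
  obtain ⟨r, hr, hrU, S, P, hS, hS₀, hSΛ⟩ := hfr.exists_graph (hU.mem_nhds he₀)
  have hconst : ∀ e ∈ Metric.ball e₀ r, ∀ e' ∈ Metric.ball e₀ r, π e = π e' → S e' = S e := by
    intro e he e' he' hee'
    ext1 d
    have hSd : ∀ d, ContDiffOn ℝ ∞ (fun x => S x d) (Metric.ball e₀ r) := fun d =>
      hS.clm_apply contDiffOn_const
    refine eq_of_fderiv_along_eq_zero (F := LinearMap.ker π.toLinearMap) (hSd d) ?_ he he'
      (by simp [LinearMap.mem_ker, hee'])
    intro x hx f hf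
    have hL : IsLag (closest (Λ x) (LinearMap.ker π.toLinearMap)) := (hlag x (hrU hx)).closest _
    -- Invariance makes the derivative orthogonal to Λ[F], so it lies in Λ[F] by the Lagrangian
    -- property.
    have hmem : fderiv ℝ (fun x => S x d) x f ∈ closest (Λ x) (LinearMap.ker π.toLinearMap) := by
      rw [hL]
      intro b hb
      obtain ⟨d', rfl⟩ := (hSΛ x hx).2.2 b hb
      exact h.dot_fderiv_closest hΛ hrU Metric.isOpen_ball (hSd d) (hSd d')
        (fun y hy => (hSΛ y hy).1 d) (fun y hy => (hSΛ y hy).1 d') f hf x hx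
    obtain ⟨d', hd'⟩ := (hSΛ x hx).2.2 _ hmem
    -- `P (S x d) = d` does not depend on x, and `P` is injective on each fibre of Λ[F]; so the
    -- derivative itself vanishes and `S` is constant along F.
    have hPd : P (fderiv ℝ (fun x => S x d) x f) = 0 := by
      have h1 : (fun x => P (S x d)) =ᶠ[𝓝 x] fun _ => d :=
        Filter.eventuallyEq_of_mem (Metric.isOpen_ball.mem_nhds hx) fun y hy => (hSΛ y hy).2.1 d
      have h2 := h1.fderiv_eq (𝕜 := ℝ)
      have h3 : fderiv ℝ (fun x => P (S x d)) x = P.comp (fderiv ℝ (fun x => S x d) x) :=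
        (P.hasFDerivAt.comp x (((hSd d).contDiffAt
          (Metric.isOpen_ball.mem_nhds hx)).differentiableAt (by simp)).hasFDerivAt).fderiv
      rw [h3] at h2
      simpa using DFunLike.congr_fun h2 f
    rw [← hd', (hSΛ x hx).2.1] at hPd
    rw [← hd', hPd, map_zero]
  have hrange : ∀ e ∈ Metric.ball e₀ r, ∀ a, a ∈ closest (Λ e) (LinearMap.ker π.toLinearMap) ↔
      ∃ d, S e d = a := fun e he a =>
    ⟨(hSΛ e he).2.2 a, by rintro ⟨d, rfl⟩; exact (hSΛ e he).1 d⟩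
  refine ⟨r, hr, hrU, fun e he e' he' hee' => ?_, fun b₀ hb₀ => ?_⟩
  · rw [← push_closest π (Λ e), ← push_closest π (Λ e')]
    congr 1
    ext a
    rw [hrange e he, hrange e' he', hconst e he e' he' hee']
  · rw [← push_closest] at hb₀
    obtain ⟨a₀, ha₀, h1, h2⟩ := hb₀
    obtain ⟨σ', hσ'⟩ := π.toLinearMap.exists_rightInverse_of_surjective
      (LinearMap.range_eq_top.2 hπ)
    let σ : E' →L[ℝ] E := LinearMap.toContinuousLinearMap σ'
    have hσ : ∀ y, π (σ y) = y := fun y => LinearMap.congr_fun hσ' y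
    -- An affine section of π through `e₀`. The smooth section through `b₀` is `S` along `sec`,
    -- pushed down by π on vectors and by σ on covectors.
    let sec : E' → E := fun y => e₀ + σ (y - π e₀)
    have hsec : ContDiff ℝ ∞ sec :=
      contDiff_const.add (σ.contDiff.comp (contDiff_id.sub contDiff_const))
    have hsec₀ : sec (π e₀) = e₀ := by simp [sec]
    have hπsec : ∀ y, π (sec y) = y := fun y => by simp [sec, hσ]
    have he₀b : e₀ ∈ Metric.ball e₀ r := Metric.mem_ball_self hr
    refine ⟨sec ⁻¹' Metric.ball e₀ r, Metric.isOpen_ball.preimage hsec.continuous, ?_,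
      fun y => (π (S (sec y) ⟨a₀, ha₀⟩).1, (S (sec y) ⟨a₀, ha₀⟩).2.comp σ), ?_, ?_, ?_⟩
    · rw [Set.mem_preimage, hsec₀]
      exact he₀b
    · have h3 : ContDiffOn ℝ ∞ (fun y => S (sec y) ⟨a₀, ha₀⟩) (sec ⁻¹' Metric.ball e₀ r) :=
        (hS.comp hsec.contDiffOn fun y hy => hy).clm_apply contDiffOn_const
      exact (π.contDiff.comp_contDiffOn h3.fst).prodMk (h3.snd.clm_comp contDiffOn_const)
    · have hd' : S e₀ ⟨a₀, ha₀⟩ = a₀ := hS₀ _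
      simp only [hsec₀, hd', h1, h2]
      ext v
      · rfl
      · simp [hσ]
    · intro y hy
      refine ⟨sec y, hy, hπsec y, ?_⟩
      rw [← push_closest]
      have hm := (hSΛ (sec y) hy).1 ⟨a₀, ha₀⟩
      refine ⟨_, hm, rfl, ?_⟩
      obtain ⟨β, hβ⟩ := exists_comp_eq_of_ker hπ (ξ := (S (sec y) ⟨a₀, ha₀⟩).2) hm.1
      ext v
      simp [hβ, hσ]

end Frames

/-! ### Descent of the Courant tensor along linear projections -/

section Descent

variable {E : Type*} [NormedAddCommGroup E] [NormedSpace ℝ E]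
  {E' : Type*} [NormedAddCommGroup E'] [NormedSpace ℝ E']

/-- `b` lifts to smooth sections with values in `S` over a dense collection of open subsets. -/
def LiftsOn (π : E →L[ℝ] E') (S : E → Set (Pontryagin E)) (b : E' → Pontryagin E')
    (V : Set E) : Prop :=
  ∀ V' ⊆ V, IsOpen V' → V'.Nonempty → ∃ V'' ⊆ V', IsOpen V'' ∧ V''.Nonempty ∧
    ∃ a : E → Pontryagin E, ContDiffOn ℝ ∞ a V'' ∧
      ∀ e ∈ V'', a e ∈ S e ∧ LinRelated π (a e) (b (π e))

/-- Shrink three times to lift all three sections at once; at such points the Courant tensor agrees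
with that of the lifts by naturality and so vanishes. Continuity does the rest. -/
lemma courant_eq_zero_of_lifts {π : E →L[ℝ] E'} {S : E → Set (Pontryagin E)} {V : Set E}
    (hS : CourantZero S V) (hV : IsOpen V) {W : Set E'} (hW : IsOpen W)
    (hVW : Set.MapsTo π V W) {b₁ b₂ b₃ : E' → Pontryagin E'} (h₁ : ContDiffOn ℝ ∞ b₁ W)
    (h₂ : ContDiffOn ℝ ∞ b₂ W) (h₃ : ContDiffOn ℝ ∞ b₃ W) (l₁ : LiftsOn π S b₁ V)
    (l₂ : LiftsOn π S b₂ V) (l₃ : LiftsOn π S b₃ V) :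
    ∀ e ∈ V, courant b₁ b₂ b₃ (π e) = 0 := by
  refine eq_zero_of_dense_zeros hV
    (((contDiffOn_courant hW h₁ h₂ h₃).comp π.contDiff.contDiffOn hVW).continuousOn)
    fun V₀ hV₀ oV₀ neV₀ => ?_
  obtain ⟨V₁, hV₁, oV₁, neV₁, a₁, ca₁, m₁⟩ := l₁ V₀ hV₀ oV₀ neV₀
  obtain ⟨V₂, hV₂, oV₂, neV₂, a₂, ca₂, m₂⟩ := l₂ V₁ (hV₁.trans hV₀) oV₁ neV₁
  obtain ⟨V₃, hV₃, oV₃, ⟨e, he⟩, a₃, ca₃, m₃⟩ := l₃ V₂ ((hV₂.trans hV₁).trans hV₀) oV₂ neV₂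
  have s : V₃ ⊆ V := ((hV₃.trans hV₂).trans hV₁).trans hV₀
  refine ⟨e, hV₁ (hV₂ (hV₃ he)), ?_⟩
  have z := hS V₃ s oV₃ a₁ a₂ a₃ (ca₁.mono (hV₃.trans hV₂)) (ca₂.mono hV₃) ca₃
    (fun x hx => (m₁ x (hV₂ (hV₃ hx))).1) (fun x hx => (m₂ x (hV₃ hx)).1)
    (fun x hx => (m₃ x hx).1) e he
  have D : ∀ {b : E' → Pontryagin E'}, ContDiffOn ℝ ∞ b W → DifferentiableAt ℝ b (π e) :=
    fun hb => (hb.contDiffAt (hW.mem_nhds (hVW (s he)))).differentiableAt (by simp)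
  have R : ∀ {a : E → Pontryagin E} {b : E' → Pontryagin E'} {X : Set E}, V₃ ⊆ X →
      (∀ x ∈ X, a x ∈ S x ∧ LinRelated π (a x) (b (π x))) →
      ∀ᶠ x in 𝓝 e, LinRelated (fderiv ℝ π x) (a x) (b (π x)) := fun hX h =>
    Filter.eventually_of_mem (oV₃.mem_nhds he) fun x hx => by
      rw [π.fderiv]
      exact (h x (hX hx)).2
  rw [← courant_eq_of_related π.contDiff.contDiffAt
    ((ca₁.contDiffAt (oV₁.mem_nhds (hV₂ (hV₃ he)))).differentiableAt (by simp)) (D h₁)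
    ((ca₂.contDiffAt (oV₂.mem_nhds (hV₃ he))).differentiableAt (by simp)) (D h₂)
    (R (hV₃.trans hV₂) m₁) (R hV₃ m₂) (R subset_rfl m₃).self_of_nhds, z]

variable [FiniteDimensional ℝ E] [FiniteDimensional ℝ E']

/-- A linear right inverse σ of π gives a smooth lift of the vector part, and the remaining unknown,
a correction in ker π, solves a linear system. -/
lemma HasSmoothEqs.liftsOn_push {Λ : E → Submodule ℝ (Pontryagin E)} {V : Set E}
    (hΛ : HasSmoothEqs Λ V) {π : E →L[ℝ] E'} (hπ : Function.Surjective π) {W : Set E'}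
    (hVW : Set.MapsTo π V W) {b : E' → Pontryagin E'} (hb : ContDiffOn ℝ ∞ b W)
    (hbΛ : ∀ e ∈ V, b (π e) ∈ push π (Λ e)) : LiftsOn π (fun e => Λ e) b V := by
  intro V' hV' oV' neV'
  obtain ⟨σ', hσ'⟩ := π.toLinearMap.exists_rightInverse_of_surjective (LinearMap.range_eq_top.2 hπ)
  let σ : E' →L[ℝ] E := LinearMap.toContinuousLinearMap σ'
  have hσ : ∀ y, π (σ y) = y := fun y => LinearMap.congr_fun hσ' y
  have hbπ : ContDiffOn ℝ ∞ (fun e => b (π e)) V' :=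
    hb.comp π.contDiff.contDiffOn fun e he => hVW (hV' he)
  have cs : ContDiffOn ℝ ∞ (fun e => (σ (b (π e)).1, (b (π e)).2.comp π)) V' :=
    (σ.contDiff.comp_contDiffOn hbπ.fst).prodMk (hbπ.snd.clm_comp contDiffOn_const)
  obtain ⟨V'', hV'', oV'', neV'', y, hy, hyΛ⟩ := hΛ.exists_open_smooth hV' oV' neV' cs
    (clmOf (fun y : LinearMap.ker π.toLinearMap => (((y : E), 0) : Pontryagin E))
      (by constructor <;> intros <;> ext <;> (simp; try abel))) (fun e he => by
        obtain ⟨a, ha, h1, h2⟩ := hbΛ e (hV' he)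
        refine ⟨⟨a.1 - σ (b (π e)).1, ?_⟩, ?_⟩
        · simp [LinearMap.mem_ker, hσ, h1]
        · convert ha using 1
          ext1
          · simp
          · simp [h2])
  refine ⟨V'', hV'', oV'', neV'', _,
    (cs.mono hV'').add ((clmOf _ _).contDiff.comp_contDiffOn hy), fun e he => ⟨hyΛ e he, ?_, ?_⟩⟩
  · have : π (y e) = 0 := (y e).2
    simp [hσ, this]
  · simp

/-- The covector is common to both summands and is pulled back by π; the unknowns are the Λ-summand
of the vector and a correction in ker π. -/
lemma HasSmoothEqs.liftsOn_cotProd {Λ Ρ : E → Submodule ℝ (Pontryagin E)} {V : Set E}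
    (hΛ : HasSmoothEqs Λ V) (hΡ : HasSmoothEqs Ρ V) {π : E →L[ℝ] E'}
    (hπ : Function.Surjective π) {W : Set E'}
    (hVW : Set.MapsTo π V W) {b : E' → Pontryagin E'} (hb : ContDiffOn ℝ ∞ b W)
    (hbΛ : ∀ e ∈ V, b (π e) ∈ cotProd (push π (Λ e)) (push π (Ρ e))) :
    LiftsOn π (fun e => cotProd (Λ e) (Ρ e)) b V := by
  intro V' hV' oV' neV'
  obtain ⟨σ', hσ'⟩ := π.toLinearMap.exists_rightInverse_of_surjective (LinearMap.range_eq_top.2 hπ)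
  let σ : E' →L[ℝ] E := LinearMap.toContinuousLinearMap σ'
  have hσ : ∀ y, π (σ y) = y := fun y => LinearMap.congr_fun hσ' y
  have hbπ : ContDiffOn ℝ ∞ (fun e => b (π e)) V' :=
    hb.comp π.contDiff.contDiffOn fun e he => hVW (hV' he)
  have c2 : ContDiffOn ℝ ∞ (fun e => (b (π e)).2.comp π) V' :=
    hbπ.snd.clm_comp contDiffOn_const
  have cs : ContDiffOn ℝ ∞ (fun e => (((0 : E), (b (π e)).2.comp π),
      (σ (b (π e)).1, (b (π e)).2.comp π))) V' :=
    (contDiffOn_const.prodMk c2).prodMk ((σ.contDiff.comp_contDiffOn hbπ.fst).prodMk c2)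
  obtain ⟨V'', hV'', oV'', neV'', y, hy, hyΛ⟩ := (hΛ.prod hΡ).exists_open_smooth hV' oV' neV' cs
    (clmOf (fun y : E × LinearMap.ker π.toLinearMap =>
      (((y.1, 0), (-y.1 + (y.2 : E), 0)) : Pontryagin E × Pontryagin E))
      (by constructor <;> intros <;> ext <;> (simp; try abel))) (fun e he => by
        obtain ⟨u, v, ξ, ⟨a, ha, h1, h2⟩, ⟨a', ha', h1', h2'⟩, hb'⟩ := hbΛ e (hV' he)
        refine ⟨(a.1, ⟨a.1 + a'.1 - σ (b (π e)).1, ?_⟩), ?_⟩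
        · simp [LinearMap.mem_ker, hσ, h1, h1', hb']
        · rw [Submodule.mem_prod]
          constructor
          · convert ha using 1
            ext1
            · simp
            · simp [h2, hb']
          · convert ha' using 1
            ext1
            · simp; abel
            · simp [h2', hb'])
  refine ⟨V'', hV'', oV'', neV'', fun e => (σ (b (π e)).1 + ((y e).2 : E), (b (π e)).2.comp π),
    ((σ.contDiff.comp_contDiffOn (hbπ.mono hV'').fst).add
      ((LinearMap.ker π.toLinearMap).subtypeL.contDiff.comp_contDiffOn hy.snd)).prodMk (c2.mono hV''),
    fun e he => ⟨?_, ?_, ?_⟩⟩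
  · have := hyΛ e he
    simp only [clmOf_apply, Submodule.mem_prod, Prod.mk_add_mk, zero_add, add_zero] at this
    refine ⟨_, _, _, this.1, this.2, ?_⟩
    ext1
    · show σ (b (π e)).1 + ((y e).2 : E) = (y e).1 + (σ (b (π e)).1 + (-(y e).1 + ((y e).2 : E)))
      abel
    · rfl
  · have : π (y e).2 = 0 := (y e).2.2
    simp [hσ, this]
  · rfl

end Descent

/-! ### Reading sections of 𝕋M in arbitrary charts -/

section Charts

variable {E : Type*} [NormedAddCommGroup E] [NormedSpace ℝ E]
  {M : Type*} [TopologicalSpace M] [ChartedSpace E M]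

/-- The derivative of a chart, as an endomorphism of the model space. -/
def fwd (φ : OpenPartialHomeomorph M E) (x : M) : E →L[ℝ] E := mfderiv 𝓘(ℝ, E) 𝓘(ℝ, E) φ x

/-- The derivative of an inverse chart, as an endomorphism of the model space. -/
def bwd (φ : OpenPartialHomeomorph M E) (e : E) : E →L[ℝ] E :=
  mfderiv 𝓘(ℝ, E) 𝓘(ℝ, E) φ.symm e

/-- The action of a pair of mutually inverse endomorphisms on vectors and covectors. -/
def conj (A B : E →L[ℝ] E) (c : Pontryagin E) : Pontryagin E := (A c.1, c.2.comp B)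

theorem conj_conj {A B : E →L[ℝ] E} (h : B.comp A = ContinuousLinearMap.id ℝ E)
    (c : Pontryagin E) : conj B A (conj A B c) = c := by
  refine Prod.ext (DFunLike.congr_fun h c.1) ?_
  change (c.2.comp B).comp A = c.2
  rw [ContinuousLinearMap.comp_assoc, h, ContinuousLinearMap.comp_id]

/-- A section of `𝕋M` read in a chart. -/
def chartSec (φ : OpenPartialHomeomorph M E) (a : ∀ x : M, GenTangent E x) (e : E) :
    Pontryagin E :=
  conj (E := E) (fwd φ (φ.symm e)) (bwd φ e) (a (φ.symm e))

/-- A section given in a chart, as a section of `𝕋M`. -/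
def ofChart (φ : OpenPartialHomeomorph M E) (c : E → Pontryagin E) (x : M) : GenTangent E x :=
  conj (E := E) (bwd φ (φ x)) (fwd φ x) (c (φ x))

variable {φ : OpenPartialHomeomorph M E}

theorem mdifferentiable_of_mem_maximalAtlas
    (hφ : φ ∈ IsManifold.maximalAtlas 𝓘(ℝ, E) ∞ M) :
    φ.MDifferentiable 𝓘(ℝ, E) 𝓘(ℝ, E) :=
  ⟨(contMDiffOn_of_mem_maximalAtlas hφ).mdifferentiableOn (by simp),
    (contMDiffOn_symm_of_mem_maximalAtlas hφ).mdifferentiableOn (by simp)⟩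

theorem bwd_comp_fwd (hφ : φ ∈ IsManifold.maximalAtlas 𝓘(ℝ, E) ∞ M) {x : M}
    (hx : x ∈ φ.source) : (bwd φ (φ x)).comp (fwd φ x) = ContinuousLinearMap.id ℝ E :=
  (mdifferentiable_of_mem_maximalAtlas hφ).symm_comp_deriv hx

theorem fwd_comp_bwd' (hφ : φ ∈ IsManifold.maximalAtlas 𝓘(ℝ, E) ∞ M) {e : E}
    (he : e ∈ φ.target) : (fwd φ (φ.symm e)).comp (bwd φ e) = ContinuousLinearMap.id ℝ E :=
  (mdifferentiable_of_mem_maximalAtlas hφ).comp_symm_deriv he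

theorem fwd_comp_bwd (hφ : φ ∈ IsManifold.maximalAtlas 𝓘(ℝ, E) ∞ M) {x : M}
    (hx : x ∈ φ.source) : (fwd φ x).comp (bwd φ (φ x)) = ContinuousLinearMap.id ℝ E := by
  have := fwd_comp_bwd' hφ (φ.map_source hx)
  rwa [φ.left_inv hx] at this

theorem bwd_fwd (hφ : φ ∈ IsManifold.maximalAtlas 𝓘(ℝ, E) ∞ M) {x : M}
    (hx : x ∈ φ.source) (v : E) : bwd φ (φ x) (fwd φ x v) = v :=
  DFunLike.congr_fun (bwd_comp_fwd hφ hx) v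

theorem fwd_bwd (hφ : φ ∈ IsManifold.maximalAtlas 𝓘(ℝ, E) ∞ M) {x : M}
    (hx : x ∈ φ.source) (v : E) : fwd φ x (bwd φ (φ x) v) = v :=
  DFunLike.congr_fun (fwd_comp_bwd hφ hx) v

theorem chartSec_apply {x : M} (hx : x ∈ φ.source) (a : ∀ x : M, GenTangent E x) :
    chartSec φ a (φ x) = conj (E := E) (fwd φ x) (bwd φ (φ x)) (a x) := by
  unfold chartSec
  rw [φ.left_inv hx]

theorem chartSec_ofChart (hφ : φ ∈ IsManifold.maximalAtlas 𝓘(ℝ, E) ∞ M)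
    {e : E} (he : e ∈ φ.target) (c : E → Pontryagin E) :
    chartSec φ (ofChart φ c) e = c e := by
  obtain ⟨x, hx, rfl⟩ : ∃ x ∈ φ.source, φ x = e := ⟨φ.symm e, φ.map_target he, φ.right_inv he⟩
  rw [chartSec_apply hx]
  exact conj_conj (E := E) (fwd_comp_bwd hφ hx) _

variable [FiniteDimensional ℝ E] [IsManifold 𝓘(ℝ, E) ∞ M]

theorem contDiffAt_chart_vectorField (hφ : φ ∈ IsManifold.maximalAtlas 𝓘(ℝ, E) ∞ M)
    {x : M} (hx : x ∈ φ.source) {u : ∀ x : M, TangentSpace 𝓘(ℝ, E) x}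
    (hu : ContMDiffAt 𝓘(ℝ, E) (𝓘(ℝ, E).prod 𝓘(ℝ, E)) ∞
      (fun x => (Bundle.TotalSpace.mk' E x (u x) : TangentBundle 𝓘(ℝ, E) M)) x) :
    ContDiffAt ℝ ∞ (fun e => fwd φ (φ.symm e) (u (φ.symm e))) (φ x) := by
  have : IsManifold 𝓘(ℝ, E) 1 M := IsManifold.of_le (n := ∞) (by simp)
  have hs : ContMDiffAt 𝓘(ℝ, E) 𝓘(ℝ, E) ∞ φ.symm (φ x) :=
    contMDiffAt_symm_of_mem_maximalAtlas hφ (φ.map_source hx)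
  have hinv : ∀ y ∈ φ.source,
      (mfderiv 𝓘(ℝ, E) 𝓘(ℝ, E) φ.symm (φ y)).inverse = fwd φ y := fun y hy =>
    ContinuousLinearMap.inverse_eq (bwd_comp_fwd hφ hy) (fwd_comp_bwd hφ hy)
  have hi : (mfderiv 𝓘(ℝ, E) 𝓘(ℝ, E) φ.symm (φ x)).IsInvertible :=
    ContinuousLinearMap.IsInvertible.of_inverse (bwd_comp_fwd hφ hx) (fwd_comp_bwd hφ hx)
  have := ContMDiffAt.mpullback_vectorField_preimage (x₀ := φ x) (f := φ.symm) (V := u)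
    (m := ∞) (n := ∞) (by rwa [φ.left_inv hx]) hs hi (by simp)
  rw [contMDiffAt_vectorSpace_iff_contDiffAt] at this
  refine this.congr_of_eventuallyEq ?_
  filter_upwards [φ.open_target.mem_nhds (φ.map_source hx)] with e he
  have h := hinv (φ.symm e) (φ.map_target he)
  rw [φ.right_inv he] at h
  exact (DFunLike.congr_fun h (u (φ.symm e))).symm

theorem contMDiffAt_ofChart_vectorField (hφ : φ ∈ IsManifold.maximalAtlas 𝓘(ℝ, E) ∞ M)
    {x : M} (hx : x ∈ φ.source) {c : E → E} (hc : ContDiffAt ℝ ∞ c (φ x)) :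
    ContMDiffAt 𝓘(ℝ, E) (𝓘(ℝ, E).prod 𝓘(ℝ, E)) ∞
      (fun x => (Bundle.TotalSpace.mk' E x (bwd φ (φ x) (c (φ x))) : TangentBundle 𝓘(ℝ, E) M))
      x := by
  have : IsManifold 𝓘(ℝ, E) 1 M := IsManifold.of_le (n := ∞) (by simp)
  have hs : ContMDiffAt 𝓘(ℝ, E) 𝓘(ℝ, E) ∞ φ x := contMDiffAt_of_mem_maximalAtlas hφ hx
  have hinv : ∀ y ∈ φ.source,
      (mfderiv 𝓘(ℝ, E) 𝓘(ℝ, E) φ y).inverse = bwd φ (φ y) := fun y hy =>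
    ContinuousLinearMap.inverse_eq (fwd_comp_bwd hφ hy) (bwd_comp_fwd hφ hy)
  have hi : (mfderiv 𝓘(ℝ, E) 𝓘(ℝ, E) φ x).IsInvertible :=
    ContinuousLinearMap.IsInvertible.of_inverse (fwd_comp_bwd hφ hx) (bwd_comp_fwd hφ hx)
  have := ContMDiffAt.mpullback_vectorField_preimage (x₀ := x) (f := φ)
    (V := fun e : E => (c e : TangentSpace 𝓘(ℝ, E) e))
    (m := ∞) (n := ∞) (contMDiffAt_vectorSpace_iff_contDiffAt.2 hc) hs hi (by simp)
  refine this.congr_of_eventuallyEq ?_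
  filter_upwards [φ.open_source.mem_nhds hx] with y hy
  exact congrArg (Bundle.TotalSpace.mk y)
    (DFunLike.congr_fun (hinv y hy) (c (φ y))).symm

-- In finite dimension a linear map is determined by its values on a basis. This reduces smoothness
-- of one-forms to that of vector fields.
omit [IsManifold 𝓘(ℝ, E) ∞ M] in
theorem contDiffAt_clm_of_apply {F G : Type*} [NormedAddCommGroup F] [NormedSpace ℝ F]
    [NormedAddCommGroup G] [NormedSpace ℝ G] {f : G → E →L[ℝ] F} {x : G}
    (h : ∀ w, ContDiffAt ℝ ∞ (fun y => f y w) x) : ContDiffAt ℝ ∞ f x := by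
  have hd : Module.finrank ℝ E = Module.finrank ℝ (Fin (Module.finrank ℝ E) → ℝ) :=
    (Module.finrank_fin_fun ℝ).symm
  let e₁ := ContinuousLinearEquiv.ofFinrankEq hd
  let e₂ := (e₁.arrowCongr (1 : F ≃L[ℝ] F)).trans
    (ContinuousLinearEquiv.piRing (Fin (Module.finrank ℝ E)))
  rw [← Function.id_comp f, ← e₂.symm_comp_self]
  exact e₂.symm.contDiff.contDiffAt.comp x (contDiffAt_pi.mpr fun i => h _)

omit [FiniteDimensional ℝ E] [IsManifold 𝓘(ℝ, E) ∞ M] in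
theorem contMDiffAt_comp_chart (hφ : φ ∈ IsManifold.maximalAtlas 𝓘(ℝ, E) ∞ M)
    {x : M} (hx : x ∈ φ.source) {F : Type*} [NormedAddCommGroup F] [NormedSpace ℝ F]
    {c : E → F} (hc : ContDiffAt ℝ ∞ c (φ x)) :
    ContMDiffAt 𝓘(ℝ, E) 𝓘(ℝ, F) ∞ (fun y => c (φ y)) x :=
  ContMDiffAt.comp x hc.contMDiffAt (contMDiffAt_of_mem_maximalAtlas hφ hx)

omit [FiniteDimensional ℝ E] [IsManifold 𝓘(ℝ, E) ∞ M] in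
theorem contDiffAt_comp_chart_symm (hφ : φ ∈ IsManifold.maximalAtlas 𝓘(ℝ, E) ∞ M)
    {x : M} (hx : x ∈ φ.source) {F : Type*} [NormedAddCommGroup F] [NormedSpace ℝ F]
    {c : M → F} (hc : ContMDiffAt 𝓘(ℝ, E) 𝓘(ℝ, F) ∞ c x) :
    ContDiffAt ℝ ∞ (fun e => c (φ.symm e)) (φ x) := by
  rw [← contMDiffAt_iff_contDiffAt]
  refine ContMDiffAt.comp (φ x) ?_ (contMDiffAt_symm_of_mem_maximalAtlas hφ (φ.map_source hx))
  rwa [φ.left_inv hx]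

theorem contDiffAt_chart_oneForm (hφ : φ ∈ IsManifold.maximalAtlas 𝓘(ℝ, E) ∞ M)
    {x : M} (hx : x ∈ φ.source) {ξ : ∀ x : M, Cotangent E x} {U : Set M} (hU : IsOpen U)
    (hxU : x ∈ U) (hξ : SmoothOneFormOn ξ U) :
    ContDiffAt ℝ ∞ (fun e => ContinuousLinearMap.comp (ξ (φ.symm e) : E →L[ℝ] ℝ) (bwd φ e))
      (φ x) := by
  apply contDiffAt_clm_of_apply
  intro w
  have hw := contMDiffAt_ofChart_vectorField hφ hx (c := fun _ => w) contDiffAt_const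
  have h := ContMDiffAt.clm_bundle_apply (F₂ := ℝ)
    (E₂ := Bundle.Trivial M ℝ) (hξ.contMDiffAt (hU.mem_nhds hxU)) hw
  rw [Bundle.contMDiffAt_totalSpace] at h
  have h2 : ContMDiffAt 𝓘(ℝ, E) 𝓘(ℝ, ℝ) ∞ (fun y => ξ y (bwd φ (φ y) w)) x := h.2
  refine (contDiffAt_comp_chart_symm hφ hx h2).congr_of_eventuallyEq ?_
  filter_upwards [φ.open_target.mem_nhds (φ.map_source hx)] with e he
  simp only [φ.right_inv he]
  rfl

/-- The transpose action of a chart derivative on covectors. -/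
def pullForm (φ : OpenPartialHomeomorph M E) (x : M) (c : E →L[ℝ] ℝ) : Cotangent E x :=
  (c.comp (fwd φ x) : E →L[ℝ] ℝ)

/-- In the preferred trivialisation the form is c composed with the derivative of a chart
transition, whose smoothness is tested on constant vector fields. -/
theorem contMDiffAt_ofChart_oneForm (hφ : φ ∈ IsManifold.maximalAtlas 𝓘(ℝ, E) ∞ M)
    {x : M} (hx : x ∈ φ.source) {c : E → (E →L[ℝ] ℝ)} (hc : ContDiffAt ℝ ∞ c (φ x)) :
    ContMDiffAt 𝓘(ℝ, E) (𝓘(ℝ, E).prod 𝓘(ℝ, E →L[ℝ] ℝ)) ∞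
    (fun x => (Bundle.TotalSpace.mk' (E →L[ℝ] ℝ) x (pullForm φ x (c (φ x))) :
      Bundle.TotalSpace (E →L[ℝ] ℝ) (fun x : M => TangentSpace 𝓘(ℝ, E) x →L[ℝ] ℝ))) x := by
  have : IsManifold 𝓘(ℝ, E) 1 M := IsManifold.of_le (n := ∞) (by simp)
  have h := contMDiffAt_hom_bundle (F₁ := E) (E₁ := fun x : M => TangentSpace 𝓘(ℝ, E) x)
    (F₂ := ℝ) (E₂ := Bundle.Trivial M ℝ) (IM := 𝓘(ℝ, E)) (IB := 𝓘(ℝ, E)) (n := ∞)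
    (fun x => (Bundle.TotalSpace.mk' (E →L[ℝ] ℝ) x (pullForm φ x (c (φ x))) :
      Bundle.TotalSpace (E →L[ℝ] ℝ) (fun x : M => TangentSpace 𝓘(ℝ, E) x →L[ℝ] ℝ))) (x₀ := x)
  refine h.2 ⟨contMDiffAt_id, ?_⟩
  have hφ₀ := IsManifold.subset_maximalAtlas (I := 𝓘(ℝ, E)) (n := ∞) (chart_mem_atlas E x)
  set φ₀ := chartAt E x with hdef
  have hx₀ : x ∈ φ₀.source := mem_chart_source E x
  have key : ContDiffAt ℝ ∞ (fun e => (c (φ (φ₀.symm e))).comp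
      ((fwd φ (φ₀.symm e)).comp (bwd φ₀ e))) (φ₀ x) := by
    have h1 : ContDiffAt ℝ ∞ (fun e => c (φ (φ₀.symm e))) (φ₀ x) :=
      contDiffAt_comp_chart_symm hφ₀ hx₀ (contMDiffAt_comp_chart hφ hx hc)
    refine h1.clm_comp ?_
    apply contDiffAt_clm_of_apply
    intro w
    have hw := contMDiffAt_ofChart_vectorField hφ₀ hx₀ (c := fun _ => w) contDiffAt_const
    have h2 := contMDiffAt_comp_chart hφ hx (contDiffAt_chart_vectorField hφ hx hw)
    refine (contDiffAt_comp_chart_symm hφ₀ hx₀ h2).congr_of_eventuallyEq ?_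
    filter_upwards [φ₀.open_target.mem_nhds (φ₀.map_source hx₀),
      (φ₀.continuousAt_symm (φ₀.map_source hx₀)).preimage_mem_nhds
        (φ.open_source.mem_nhds ((φ₀.left_inv hx₀).symm ▸ hx))] with e he he'
    simp only [φ.left_inv he', φ₀.right_inv he]
    rfl
  refine (contMDiffAt_comp_chart hφ₀ hx₀ key).congr_of_eventuallyEq ?_
  filter_upwards [φ₀.open_source.mem_nhds hx₀] with y hy
  have hsymm := TangentBundle.symmL_trivializationAt (I := 𝓘(ℝ, E)) (x₀ := x) (x := y) hy
  have hsymm' : (trivializationAt E (TangentSpace 𝓘(ℝ, E)) x).symmL ℝ y = bwd φ₀ (φ₀ y) := by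
    rw [hsymm]
    simp only [modelWithCornersSelf_coe, Set.range_id, mfderivWithin_univ]
    rfl
  change ContinuousLinearMap.comp _ (ContinuousLinearMap.comp (pullForm φ y (c (φ y)))
    ((trivializationAt E (TangentSpace 𝓘(ℝ, E)) x).symmL ℝ y)) = _
  rw [hsymm']
  ext w
  simp only [φ₀.left_inv hy]
  simp [pullForm]
  rfl

theorem SmoothSectionOn.contDiffAt_chartSec (hφ : φ ∈ IsManifold.maximalAtlas 𝓘(ℝ, E) ∞ M)
    {x : M} (hx : x ∈ φ.source) {a : ∀ x : M, GenTangent E x} {U : Set M} (hU : IsOpen U)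
    (hxU : x ∈ U) (ha : SmoothSectionOn a U) :
    ContDiffAt ℝ ∞ (chartSec φ a) (φ x) :=
  (contDiffAt_chart_vectorField hφ hx (ha.1.contMDiffAt (hU.mem_nhds hxU))).prodMk
    (contDiffAt_chart_oneForm hφ hx hU hxU ha.2)

theorem SmoothSectionOn.contDiffOn_chartSec (hφ : φ ∈ IsManifold.maximalAtlas 𝓘(ℝ, E) ∞ M)
    {a : ∀ x : M, GenTangent E x} {U : Set M} (hU : IsOpen U)
    (ha : SmoothSectionOn a U) {V : Set E} (hV : ∀ e ∈ V, e ∈ φ.target ∧ φ.symm e ∈ U) :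
    ContDiffOn ℝ ∞ (chartSec φ a) V := by
  intro e he
  have := ha.contDiffAt_chartSec hφ (φ.map_target (hV e he).1) hU (hV e he).2
  rw [φ.right_inv (hV e he).1] at this
  exact this.contDiffWithinAt

theorem smoothSectionOn_ofChart (hφ : φ ∈ IsManifold.maximalAtlas 𝓘(ℝ, E) ∞ M)
    {c : E → Pontryagin E} {W : Set E} (hW : IsOpen W) (hc : ContDiffOn ℝ ∞ c W) {U : Set M}
    (hU : ∀ x ∈ U, x ∈ φ.source ∧ φ x ∈ W) : SmoothSectionOn (ofChart φ c) U := by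
  constructor
  · intro x hx
    exact (contMDiffAt_ofChart_vectorField hφ (hU x hx).1
      (hc.contDiffAt (hW.mem_nhds (hU x hx).2)).fst).contMDiffWithinAt
  · intro x hx
    exact (contMDiffAt_ofChart_oneForm hφ (hU x hx).1
      (hc.contDiffAt (hW.mem_nhds (hU x hx).2)).snd).contMDiffWithinAt

end Charts

/-! ### The Dorfman bracket in charts -/

section Bracket

variable {E : Type*} [NormedAddCommGroup E] [NormedSpace ℝ E] [FiniteDimensional ℝ E]
  {M : Type*} [TopologicalSpace M] [ChartedSpace E M] [IsManifold 𝓘(ℝ, E) ∞ M]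

omit [FiniteDimensional ℝ E] in
theorem chartAt_mem_maximalAtlas (x : M) :
    chartAt E x ∈ IsManifold.maximalAtlas 𝓘(ℝ, E) ∞ M :=
  IsManifold.subset_maximalAtlas (chart_mem_atlas E x)

omit [FiniteDimensional ℝ E] in
theorem mlieBracket_eq (a b : ∀ x : M, GenTangent E x) (x : M) :
    (VectorField.mlieBracket 𝓘(ℝ, E) (fun y => (a y).1) (fun y => (b y).1) x : E) =
      bwd (chartAt E x) (chartAt E x x)
        (fderiv ℝ (fun e => (chartSec (chartAt E x) b e).1) (chartAt E x x)
            (chartSec (chartAt E x) a (chartAt E x x)).1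
          - fderiv ℝ (fun e => (chartSec (chartAt E x) a e).1) (chartAt E x x)
            (chartSec (chartAt E x) b (chartAt E x x)).1) := by
  have hφ := chartAt_mem_maximalAtlas (E := E) x
  have hx := mem_chart_source E x
  have hev : ∀ u : ∀ x : M, TangentSpace 𝓘(ℝ, E) x,
      VectorField.mpullbackWithin 𝓘(ℝ, E) 𝓘(ℝ, E) (extChartAt 𝓘(ℝ, E) x).symm u Set.univ
        =ᶠ[𝓝 (chartAt E x x)]
        fun e => fwd (chartAt E x) ((chartAt E x).symm e) (u ((chartAt E x).symm e)) := by
    intro u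
    filter_upwards [(chartAt E x).open_target.mem_nhds ((chartAt E x).map_source hx)] with e he
    have h1 : (mfderiv 𝓘(ℝ, E) 𝓘(ℝ, E) (chartAt E x).symm e).inverse
        = fwd (chartAt E x) ((chartAt E x).symm e) := by
      have := bwd_comp_fwd hφ ((chartAt E x).map_target he)
      rw [(chartAt E x).right_inv he] at this
      exact ContinuousLinearMap.inverse_eq this (fwd_comp_bwd' hφ he)
    rw [VectorField.mpullbackWithin_apply, mfderivWithin_univ]
    exact DFunLike.congr_fun h1 _
  have hinv : (mfderiv 𝓘(ℝ, E) 𝓘(ℝ, E) (chartAt E x) x).inverse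
      = bwd (chartAt E x) (chartAt E x x) :=
    ContinuousLinearMap.inverse_eq (fwd_comp_bwd hφ hx) (bwd_comp_fwd hφ hx)
  rw [← VectorField.mlieBracketWithin_univ, VectorField.mlieBracketWithin_apply]
  simp only [modelWithCornersSelf_coe, Set.range_id, Set.preimage_univ, Set.univ_inter]
  refine (DFunLike.congr_fun hinv _).trans (congrArg (bwd (chartAt E x) (chartAt E x x)) ?_)
  refine (congrFun (VectorField.lieBracketWithin_univ (𝕜 := ℝ) (E := E)) _).trans ?_
  have key : ∀ u v u' v' : E → E, u =ᶠ[𝓝 (chartAt E x x)] u' → v =ᶠ[𝓝 (chartAt E x x)] v' →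
      VectorField.lieBracket ℝ u v (chartAt E x x) =
        fderiv ℝ v' (chartAt E x x) (u' (chartAt E x x))
          - fderiv ℝ u' (chartAt E x x) (v' (chartAt E x x)) := by
    intro u v u' v' hu hv
    rw [VectorField.lieBracket_eq]
    simp only [hu.fderiv_eq, hv.fderiv_eq, hu.eq_of_nhds, hv.eq_of_nhds]
  exact key _ _ _ _ (hev fun y => (a y).1) (hev fun y => (b y).1)

omit [FiniteDimensional ℝ E] [IsManifold 𝓘(ℝ, E) ∞ M] in
theorem mvfderiv_comp_chart {φ : OpenPartialHomeomorph M E}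
    (hφ : φ ∈ IsManifold.maximalAtlas 𝓘(ℝ, E) ∞ M) {x : M} (hx : x ∈ φ.source) {f : E → ℝ}
    (hf : DifferentiableAt ℝ f (φ x)) (w : TangentSpace 𝓘(ℝ, E) x) :
    mvfderiv 𝓘(ℝ, E) (fun y => f (φ y)) x w = fderiv ℝ f (φ x) (fwd φ x w) := by
  have h := mfderiv_comp (I := 𝓘(ℝ, E)) (I' := 𝓘(ℝ, E)) (I'' := 𝓘(ℝ, ℝ)) x (g := f) (f := φ)
    hf.mdifferentiableAt ((mdifferentiable_of_mem_maximalAtlas hφ).mdifferentiableAt hx)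
  rw [mfderiv_eq_fderiv] at h
  exact DFunLike.congr_fun h w

/-- By the Leibniz rule, d(η(u)) + ι_u dη loses the term (D_w η)(u) and becomes the symmetric
expression appearing in `courant`. -/
theorem pairing_dorfman_chartAt {a b : ∀ x : M, GenTangent E x} {U : Set M}
    (hU : IsOpen U) (ha : SmoothSectionOn a U) (hb : SmoothSectionOn b U)
    (c : ∀ x : M, GenTangent E x) {x : M} (hxU : x ∈ U) :
    pairing (dorfman a b x) (c x) =
      courant (chartSec (chartAt E x) a) (chartSec (chartAt E x) b) (chartSec (chartAt E x) c)
        (chartAt E x x) := by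
  have hφ := chartAt_mem_maximalAtlas (E := E) x
  have hx := mem_chart_source E x
  have ha' := (ha.contDiffAt_chartSec hφ hx hU hxU).differentiableAt (by simp)
  have hb' := (hb.contDiffAt_chartSec hφ hx hU hxU).differentiableAt (by simp)
  have hg : (fun y => (b y).2 (a y).1) =ᶠ[𝓝 x] fun y =>
      (fun e => (chartSec (chartAt E x) b e).2 (chartSec (chartAt E x) a e).1)
        (chartAt E x y) := by
    filter_upwards [(chartAt E x).open_source.mem_nhds hx] with y hy
    simp only [chartSec_apply hy]
    exact congrArg (b y).2 (bwd_fwd hφ hy _).symm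
  have h1 : ∀ w, mvfderiv 𝓘(ℝ, E) (fun y => (b y).2 (a y).1) x w
      = fderiv ℝ (fun e => (chartSec (chartAt E x) b e).2 (chartSec (chartAt E x) a e).1)
          (chartAt E x x) (fwd (chartAt E x) x w) := by
    intro w
    rw [← mvfderiv_comp_chart hφ hx (hb'.snd.clm_apply ha'.fst)]
    have := hg.mfderiv_eq (I := 𝓘(ℝ, E)) (I' := 𝓘(ℝ, ℝ))
    exact DFunLike.congr_fun this w
  have h2 : ∀ (s : ∀ x : M, GenTangent E x) (v w : TangentSpace 𝓘(ℝ, E) x),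
      extDerivOneForm (fun y => (s y).2) x v w =
        fderiv ℝ (fun e => (chartSec (chartAt E x) s e).2) (chartAt E x x)
            (fwd (chartAt E x) x v) (fwd (chartAt E x) x w)
          - fderiv ℝ (fun e => (chartSec (chartAt E x) s e).2) (chartAt E x x)
            (fwd (chartAt E x) x w) (fwd (chartAt E x) x v) := fun s v w => rfl
  have h3 : pairing (dorfman a b x) (c x) =
      (conj (E := E) (fwd (chartAt E x) x) (bwd (chartAt E x) (chartAt E x x)) (c x)).2
        (fderiv ℝ (fun e => (chartSec (chartAt E x) b e).1) (chartAt E x x)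
            (chartSec (chartAt E x) a (chartAt E x x)).1
          - fderiv ℝ (fun e => (chartSec (chartAt E x) a e).1) (chartAt E x x)
            (chartSec (chartAt E x) b (chartAt E x x)).1)
      + (mvfderiv 𝓘(ℝ, E) (fun y => (b y).2 (a y).1) x (c x).1
        + extDerivOneForm (fun y => (b y).2) x (a x).1 (c x).1
        - extDerivOneForm (fun y => (a y).2) x (b x).1 (c x).1) := by
    have := congrArg (c x).2 (mlieBracket_eq a b x)
    exact congrArg (· + (mvfderiv 𝓘(ℝ, E) (fun y => (b y).2 (a y).1) x (c x).1
        + extDerivOneForm (fun y => (b y).2) x (a x).1 (c x).1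
        - extDerivOneForm (fun y => (a y).2) x (b x).1 (c x).1)) this
  rw [h3, h1, h2, h2, fderiv_clm_apply hb'.snd ha'.fst]
  have eta : ∀ s : E → Pontryagin E, s = fun e => ((s e).1, (s e).2) := fun _ => rfl
  have hA : ∀ s : ∀ x : M, GenTangent E x,
    fwd (chartAt E x) x (s x).1 = (chartSec (chartAt E x) s (chartAt E x x)).1 := fun s => by
      rw [chartSec_apply hx]; rfl
  have hC : (conj (E := E) (fwd (chartAt E x) x) (bwd (chartAt E x) (chartAt E x x)) (c x)).2
      = (chartSec (chartAt E x) c (chartAt E x x)).2 := by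
    rw [chartSec_apply hx]
  rw [hC]
  have hA1 := hA a; have hA2 := hA b; have hA3 := hA c
  rw [hA1, hA2, hA3]
  simp only [courant, dot, fderiv.fst ha', fderiv.fst hb', fderiv.snd ha', fderiv.snd hb']
  simp
  ring

omit [FiniteDimensional ℝ E] [IsManifold 𝓘(ℝ, E) ∞ M] in
theorem fderiv_transition {φ ψ : OpenPartialHomeomorph M E}
    (hφ : φ ∈ IsManifold.maximalAtlas 𝓘(ℝ, E) ∞ M)
    (hψ : ψ ∈ IsManifold.maximalAtlas 𝓘(ℝ, E) ∞ M) {e : E} (he : e ∈ φ.target)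
    (he' : φ.symm e ∈ ψ.source) :
    fderiv ℝ (fun e => ψ (φ.symm e)) e = (fwd ψ (φ.symm e)).comp (bwd φ e) := by
  have h := mfderiv_comp (I := 𝓘(ℝ, E)) (I' := 𝓘(ℝ, E)) (I'' := 𝓘(ℝ, E)) e (g := ψ)
    (f := φ.symm)
    ((mdifferentiable_of_mem_maximalAtlas hψ).mdifferentiableAt he')
    ((mdifferentiable_of_mem_maximalAtlas hφ).mdifferentiableAt_symm he)
  rw [mfderiv_eq_fderiv] at h
  exact h

/-- The transition map relates the two readings of a section, so naturality of the Courant tensor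
applies. The bracket is defined in preferred charts; this frees it for adapted ones. -/
theorem courant_chartSec_eq {φ ψ : OpenPartialHomeomorph M E}
    (hφ : φ ∈ IsManifold.maximalAtlas 𝓘(ℝ, E) ∞ M)
    (hψ : ψ ∈ IsManifold.maximalAtlas 𝓘(ℝ, E) ∞ M)
    {a b : ∀ x : M, GenTangent E x} {U : Set M}
    (hU : IsOpen U) (ha : SmoothSectionOn a U) (hb : SmoothSectionOn b U)
    (c : ∀ x : M, GenTangent E x) {x : M} (hxU : x ∈ U) (hxφ : x ∈ φ.source)
    (hxψ : x ∈ ψ.source) :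
    courant (chartSec φ a) (chartSec φ b) (chartSec φ c) (φ x) =
      courant (chartSec ψ a) (chartSec ψ b) (chartSec ψ c) (ψ x) := by
  have hT : ContDiffAt ℝ ∞ (fun e => ψ (φ.symm e)) (φ x) :=
    contDiffAt_comp_chart_symm hφ hxφ (contMDiffAt_of_mem_maximalAtlas hψ hxψ)
  have hval : ψ (φ.symm (φ x)) = ψ x := by rw [φ.left_inv hxφ]
  have rel : ∀ s : ∀ x : M, GenTangent E x, ∀ e ∈ φ.target, φ.symm e ∈ ψ.source →
      LinRelated (fderiv ℝ (fun e => ψ (φ.symm e)) e) (chartSec φ s e)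
        (chartSec ψ s (ψ (φ.symm e))) := by
    intro s e he he'
    rw [fderiv_transition hφ hψ he he', chartSec_apply he']
    have h1 := fwd_comp_bwd hφ (φ.map_target he)
    have h2 := bwd_comp_fwd hφ (φ.map_target he)
    rw [φ.right_inv he] at h1 h2
    constructor
    · exact congrArg (fwd ψ (φ.symm e)) (DFunLike.congr_fun h2 _)
    · have h3 := bwd_comp_fwd hψ he'
      ext w
      exact congrArg (s (φ.symm e)).2 (DFunLike.congr_fun h3 (bwd φ e w)).symm
  have hev : ∀ s : ∀ x : M, GenTangent E x, ∀ᶠ e in 𝓝 (φ x),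
      LinRelated (fderiv ℝ (fun e => ψ (φ.symm e)) e) (chartSec φ s e)
        (chartSec ψ s (ψ (φ.symm e))) := by
    intro s
    filter_upwards [φ.open_target.mem_nhds (φ.map_source hxφ),
      (φ.continuousAt_symm (φ.map_source hxφ)).preimage_mem_nhds
        (ψ.open_source.mem_nhds ((φ.left_inv hxφ).symm ▸ hxψ))] with e he he'
    exact rel s e he he'
  have := courant_eq_of_related (ψ := fun e => ψ (φ.symm e)) (e := φ x)
    (b₁ := chartSec ψ a) (b₂ := chartSec ψ b) (b₃ := chartSec ψ c) (a₃ := chartSec φ c)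
    (hT.of_le (by norm_cast))
    ((ha.contDiffAt_chartSec hφ hxφ hU hxU).differentiableAt (by simp))
    (hval ▸ (ha.contDiffAt_chartSec hψ hxψ hU hxU).differentiableAt (by simp))
    ((hb.contDiffAt_chartSec hφ hxφ hU hxU).differentiableAt (by simp))
    (hval ▸ (hb.contDiffAt_chartSec hψ hxψ hU hxU).differentiableAt (by simp))
    (hev a) (hev b) (hev c).self_of_nhds
  rw [this]
  simp only [hval]

/-- The Dorfman bracket paired with a third section, computed in any chart. -/
theorem pairing_dorfman {φ : OpenPartialHomeomorph M E}
    (hφ : φ ∈ IsManifold.maximalAtlas 𝓘(ℝ, E) ∞ M)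
    {a b : ∀ x : M, GenTangent E x} {U : Set M}
    (hU : IsOpen U) (ha : SmoothSectionOn a U) (hb : SmoothSectionOn b U)
    (c : ∀ x : M, GenTangent E x) {x : M} (hxU : x ∈ U) (hxφ : x ∈ φ.source) :
    pairing (dorfman a b x) (c x) =
      courant (chartSec φ a) (chartSec φ b) (chartSec φ c) (φ x) := by
  rw [pairing_dorfman_chartAt hU ha hb c hxU]
  exact courant_chartSec_eq (chartAt_mem_maximalAtlas x) hφ hU ha hb c hxU
    (mem_chart_source E x) hxφ

end Bracket

/-! ### Invariance of the linear constructions under coordinate changes -/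

section Conjugation

variable {E : Type*} [NormedAddCommGroup E] [NormedSpace ℝ E]

/-- `conj` as a linear map. -/
def conjL (A B : E →L[ℝ] E) : Pontryagin E →ₗ[ℝ] Pontryagin E where
  toFun := conj A B
  map_add' a b := by simp [conj, ContinuousLinearMap.add_comp]
  map_smul' r a := by simp [conj, ContinuousLinearMap.smul_comp]

theorem conjL_apply (A B : E →L[ℝ] E) (c : Pontryagin E) : conjL A B c = conj A B c := rfl

variable {A B : E →L[ℝ] E}

theorem dot_conj (h : B.comp A = ContinuousLinearMap.id ℝ E) (a b : Pontryagin E) :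
    dot (conj A B a) (conj A B b) = dot a b := by
  have h' : ∀ v, B (A v) = v := DFunLike.congr_fun h
  simp [dot, conj, h']

theorem mem_map_conjL (h : B.comp A = ContinuousLinearMap.id ℝ E)
    (h' : A.comp B = ContinuousLinearMap.id ℝ E) {Λ : Submodule ℝ (Pontryagin E)}
    {c : Pontryagin E} : c ∈ Λ.map (conjL A B) ↔ conj B A c ∈ Λ := by
  constructor
  · rintro ⟨a, ha, rfl⟩
    rwa [conjL_apply, conj_conj h]
  · exact fun hc => ⟨conj B A c, hc, conj_conj h' c⟩

theorem IsLag.map_conjL (h : B.comp A = ContinuousLinearMap.id ℝ E)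
    (h' : A.comp B = ContinuousLinearMap.id ℝ E) {Λ : Submodule ℝ (Pontryagin E)}
    (hΛ : IsLag Λ) : IsLag (Λ.map (conjL A B)) := by
  intro a
  rw [mem_map_conjL h h', hΛ]
  constructor
  · rintro H _ ⟨b, hb, rfl⟩
    rw [← H b hb, conjL_apply, ← dot_conj h (conj B A a), conj_conj h']
  · intro H b hb
    rw [← H _ ⟨b, hb, rfl⟩, conjL_apply, ← dot_conj h (conj B A a), conj_conj h']

theorem map_closest (h : B.comp A = ContinuousLinearMap.id ℝ E)
    (h' : A.comp B = ContinuousLinearMap.id ℝ E) (Λ : Submodule ℝ (Pontryagin E))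
    (F : Submodule ℝ E) :
    (closest Λ F).map (conjL A B) = closest (Λ.map (conjL A B)) (F.map A.toLinearMap) := by
  have hBA : ∀ v, B (A v) = v := DFunLike.congr_fun h
  ext c
  rw [mem_map_conjL h h', mem_closest, mem_closest]
  constructor
  · rintro ⟨h1, f, hf, h2⟩
    refine ⟨?_, A f, ⟨f, hf, rfl⟩, ?_⟩
    · rintro _ ⟨g, hg, rfl⟩
      exact h1 g hg
    · rw [mem_map_conjL h h']
      simpa [conj, hBA] using h2
  · rintro ⟨h1, _, ⟨f, hf, rfl⟩, h2⟩
    refine ⟨fun g hg => h1 _ ⟨g, hg, rfl⟩, f, hf, ?_⟩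
    rw [mem_map_conjL h h'] at h2
    simpa [conj, hBA] using h2

theorem mem_cotProd_map (h : B.comp A = ContinuousLinearMap.id ℝ E)
    (h' : A.comp B = ContinuousLinearMap.id ℝ E) {Λ Ρ : Submodule ℝ (Pontryagin E)}
    {c : Pontryagin E} :
    c ∈ cotProd (Λ.map (conjL A B)) (Ρ.map (conjL A B)) ↔ conj B A c ∈ cotProd Λ Ρ := by
  constructor
  · rintro ⟨u, v, ξ, hu, hv, rfl⟩
    rw [mem_map_conjL h h'] at hu hv
    exact ⟨B u, B v, ξ.comp A, hu, hv, by simp [conj]⟩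
  · rintro ⟨u, v, ξ, hu, hv, hc⟩
    refine ⟨A u, A v, ξ.comp B, ⟨_, hu, rfl⟩, ⟨_, hv, rfl⟩, ?_⟩
    rw [← conj_conj h' c, hc]
    simp [conj]

theorem inMagri_map (h : B.comp A = ContinuousLinearMap.id ℝ E)
    (h' : A.comp B = ContinuousLinearMap.id ℝ E) {Λ Ρ : Submodule ℝ (Pontryagin E)} {f : E} :
    InMagri (Λ.map (conjL A B)) (Ρ.map (conjL A B)) f ↔ InMagri Λ Ρ (B f) := by
  constructor
  · rintro ⟨ξ, v, h1, h2, h3⟩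
    rw [mem_map_conjL h h'] at h1 h2 h3
    exact ⟨ξ.comp A, B v, h1, by simpa [conj] using h2, by simpa [conj] using h3⟩
  · rintro ⟨ξ, v, h1, h2, h3⟩
    have hAB : A (B f) = f := DFunLike.congr_fun h' f
    refine ⟨ξ.comp B, A v, ⟨_, h1, ?_⟩, ⟨_, h2, ?_⟩, ⟨_, h3, ?_⟩⟩ <;>
      simp [conjL_apply, conj, hAB]

end Conjugation

/-! ### Families and involutivity in charts -/

section LocalFamilies

variable {E : Type*} [NormedAddCommGroup E] [NormedSpace ℝ E]
  {M : Type*} [TopologicalSpace M] [ChartedSpace E M]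

/-- A fibre of a family, as a subspace of the model space. -/
def fib (L : Family E M) (x : M) : Submodule ℝ (Pontryagin E) := L x

/-- A family read in a chart. -/
def localFam (φ : OpenPartialHomeomorph M E) (L : Family E M) (e : E) :
    Submodule ℝ (Pontryagin E) :=
  (fib L (φ.symm e)).map (conjL (fwd φ (φ.symm e)) (bwd φ e))

theorem isLagrangian_iff (L : Family E M) : IsLagrangian L ↔ ∀ x, IsLag (fib L x) := by
  constructor
  · intro h x a
    have := congrArg (fun K : Family E M => a ∈ K x) h
    exact iff_of_eq this
  · intro h
    funext x
    ext a
    exact h x a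

theorem localFam_apply {φ : OpenPartialHomeomorph M E} {x : M} (hx : x ∈ φ.source)
    (L : Family E M) :
    localFam φ L (φ x) = (fib L x).map (conjL (fwd φ x) (bwd φ (φ x))) := by
  unfold localFam
  rw [φ.left_inv hx]

variable {φ : OpenPartialHomeomorph M E}

theorem mem_localFam (hφ : φ ∈ IsManifold.maximalAtlas 𝓘(ℝ, E) ∞ M) {x : M}
    (hx : x ∈ φ.source) {L : Family E M} {c : Pontryagin E} :
    c ∈ localFam φ L (φ x) ↔ conj (bwd φ (φ x)) (fwd φ x) c ∈ fib L x := by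
  rw [localFam_apply hx, mem_map_conjL (bwd_comp_fwd hφ hx) (fwd_comp_bwd hφ hx)]

theorem ofChart_mem (hφ : φ ∈ IsManifold.maximalAtlas 𝓘(ℝ, E) ∞ M) {x : M}
    (hx : x ∈ φ.source) {L : Family E M} {c : E → Pontryagin E}
    (hc : c (φ x) ∈ localFam φ L (φ x)) : ofChart φ c x ∈ L x :=
  (mem_localFam hφ hx).1 hc

theorem chartSec_mem {e : E} {L : Family E M} {a : ∀ x : M, GenTangent E x}
    (ha : a (φ.symm e) ∈ L (φ.symm e)) : chartSec φ a e ∈ localFam φ L e :=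
  ⟨a (φ.symm e), ha, rfl⟩

theorem IsLagrangian.isLag_localFam (hφ : φ ∈ IsManifold.maximalAtlas 𝓘(ℝ, E) ∞ M)
    {L : Family E M} (hL : IsLagrangian L) {e : E} (he : e ∈ φ.target) :
    IsLag (localFam φ L e) := by
  have h1 := bwd_comp_fwd hφ (φ.map_target he)
  rw [φ.right_inv he] at h1
  exact ((isLagrangian_iff L).1 hL _).map_conjL h1 (fwd_comp_bwd' hφ he)

theorem cotProd_localFam (hφ : φ ∈ IsManifold.maximalAtlas 𝓘(ℝ, E) ∞ M) (L R : Family E M)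
    {e : E} (he : e ∈ φ.target) :
    cotProd (localFam φ L e) (localFam φ R e) = localFam φ (cotangentProd L R) e := by
  have h1 := bwd_comp_fwd hφ (φ.map_target he)
  rw [φ.right_inv he] at h1
  ext c
  exact (mem_cotProd_map h1 (fwd_comp_bwd' hφ he)).trans
    (mem_map_conjL h1 (fwd_comp_bwd' hφ he) (Λ := fib (cotangentProd L R) (φ.symm e))).symm

variable [FiniteDimensional ℝ E] [IsManifold 𝓘(ℝ, E) ∞ M]

theorem IsSubbundle.hasFrameAt (hφ : φ ∈ IsManifold.maximalAtlas 𝓘(ℝ, E) ∞ M)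
    {L : Family E M} (hL : IsSubbundle L) {e : E} (he : e ∈ φ.target) :
    HasFrameAt (localFam φ L) e := by
  obtain ⟨U, hU, k, s, hs, hsL⟩ := hL (φ.symm e)
  obtain ⟨V, hVU, hV, hxV⟩ := mem_nhds_iff.1 hU
  refine ⟨φ.target ∩ φ.symm ⁻¹' V, φ.isOpen_inter_preimage_symm hV, ⟨he, hxV⟩, k,
    fun i => chartSec φ (s i), fun i => ?_, fun e' he' => ?_⟩
  · exact SmoothSectionOn.contDiffOn_chartSec hφ hV
      ⟨(hs i).1.mono hVU, (hs i).2.mono hVU⟩ fun e' he' => he'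
  · obtain ⟨h1, h2⟩ := hsL _ (hVU he'.2)
    have h3 := bwd_comp_fwd hφ (φ.map_target he'.1)
    rw [φ.right_inv he'.1] at h3
    have hker : LinearMap.ker (conjL (fwd φ (φ.symm e')) (bwd φ e')) = ⊥ :=
      LinearMap.ker_eq_bot_of_inverse (g := conjL (bwd φ e') (fwd φ (φ.symm e')))
        (LinearMap.ext fun c => conj_conj h3 c)
    have h1' : LinearIndependent ℝ (fun i => (s i (φ.symm e') : Pontryagin E)) := h1
    refine ⟨h1'.map' _ hker, ?_⟩
    have h4 : Submodule.span ℝ (Set.range fun i => s i (φ.symm e')) = L (φ.symm e') := h2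
    refine Submodule.ext fun c => ?_
    constructor
    · intro hc
      refine (Submodule.span_le (p := localFam φ L e')).2 ?_ hc
      rintro _ ⟨i, rfl⟩
      exact chartSec_mem (h4 ▸ Submodule.subset_span ⟨i, rfl⟩)
    · rintro ⟨d, hd, rfl⟩
      have hd' : d ∈ L (φ.symm e') := hd
      rw [← h4] at hd'
      refine Submodule.span_induction (p := fun (d : GenTangent E (φ.symm e')) _ =>
        conjL (fwd φ (φ.symm e')) (bwd φ e') d ∈
          Submodule.span ℝ (Set.range fun i => chartSec φ (s i) e')) ?_ ?_ ?_ ?_ hd'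
      · rintro _ ⟨i, rfl⟩
        exact Submodule.subset_span ⟨i, rfl⟩
      · exact (map_zero (conjL (fwd φ (φ.symm e')) (bwd φ e'))).symm ▸ Submodule.zero_mem _
      · intro c d _ _ hc hd
        exact (map_add (conjL (fwd φ (φ.symm e')) (bwd φ e')) c d).symm ▸
          Submodule.add_mem _ hc hd
      · intro r c _ hc
        exact (map_smul (conjL (fwd φ (φ.symm e')) (bwd φ e')) r c).symm ▸
          Submodule.smul_mem _ r hc

variable [T2Space M]

/-- A local section can be cut off to a global one without changing its germ at a point. -/
theorem exists_cutoff {a : ∀ x : M, GenTangent E x} {U : Set M} (hU : IsOpen U)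
    (ha : SmoothSectionOn a U) {x : M} (hx : x ∈ U) :
    ∃ ρ : M → ℝ, SmoothSectionOn (fun y => ρ y • a y) Set.univ ∧ (∀ᶠ y in 𝓝 x, ρ y = 1) ∧
      ∀ y ∉ U, ρ y = 0 := by
  -- The closed support lies in U, so the product with the bump function is smooth on all of M.
  obtain ⟨f, -, hf⟩ := (SmoothBumpFunction.nhds_basis_tsupport (I := 𝓘(ℝ, E)) x).mem_iff.1
    (hU.mem_nhds hx)
  refine ⟨f, ⟨?_, ?_⟩, f.eventuallyEq_one, fun y hy => ?_⟩
  · exact (ContMDiffOn.smul_section_of_tsupport f.contMDiff.contMDiffOn hU hf ha.1).contMDiffOn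
  · exact (ContMDiffOn.smul_section_of_tsupport (V := fun x : M => TangentSpace 𝓘(ℝ, E) x →L[ℝ] ℝ)
      f.contMDiff.contMDiffOn hU hf ha.2).contMDiffOn
  · exact image_eq_zero_of_notMem_tsupport fun h => hy (hf h)

/-- Involutivity concerns global sections, and cutting off passes from local to global without
changing germs. Only the first two arguments are cut off, as the third enters by its value alone.
Isotropy suffices, so this also applies to L ⊛ R, which need not be smooth. -/
theorem IsInvolutive.courantZero (hφ : φ ∈ IsManifold.maximalAtlas 𝓘(ℝ, E) ∞ M)
    {L : Family E M} (hL : IsInvolutive L)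
    (hiso : ∀ x, ∀ a ∈ L x, ∀ b ∈ L x, pairing a b = 0) :
    CourantZero (fun e => (localFam φ L e : Set (Pontryagin E))) φ.target := by
  intro V hVt hV a b c ha hb _ haL hbL hcL e he
  have ht := hVt he
  have hV' : IsOpen (φ.source ∩ φ ⁻¹' V) := φ.isOpen_inter_preimage hV
  have hxV : φ.symm e ∈ φ.source ∩ φ ⁻¹' V :=
    ⟨φ.map_target ht, by rw [Set.mem_preimage, φ.right_inv ht]; exact he⟩
  have glob : ∀ s : E → Pontryagin E, ContDiffOn ℝ ∞ s V → (∀ e ∈ V, s e ∈ localFam φ L e) →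
      ∃ t ∈ Sections L, chartSec φ t =ᶠ[𝓝 e] s := by
    intro s hs hsL
    obtain ⟨ρ, h1, h2, h3⟩ := exists_cutoff hV'
      (smoothSectionOn_ofChart hφ hV hs (U := φ.source ∩ φ ⁻¹' V) fun x hx => hx) hxV
    refine ⟨_, ⟨h1, fun x => ?_⟩, ?_⟩
    · by_cases hx : x ∈ φ.source ∩ φ ⁻¹' V
      · exact (L x).smul_mem _ (ofChart_mem hφ hx.1 (hsL _ hx.2))
      · simp only [h3 x hx, zero_smul]
        exact (L x).zero_mem
    · filter_upwards [(φ.continuousAt_symm ht).eventually h2, φ.open_target.mem_nhds ht]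
        with e' he' ht'
      rw [← chartSec_ofChart hφ ht' s]
      unfold chartSec
      simp only [he', one_smul]
  obtain ⟨a', haS, haE⟩ := glob a ha haL
  obtain ⟨b', hbS, hbE⟩ := glob b hb hbL
  have key := pairing_dorfman hφ isOpen_univ haS.1 hbS.1 (ofChart φ c) (Set.mem_univ (φ.symm e))
    (φ.map_target ht)
  rw [φ.right_inv ht, courant_congr haE hbE (chartSec_ofChart hφ ht c)] at key
  rw [← key]
  refine hiso _ _ (hL a' haS b' hbS _) _ (ofChart_mem hφ (φ.map_target ht) ?_)
  rw [φ.right_inv ht]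
  exact hcL e he

-- Membership of the bracket is tested by pairing with each vector of the fibre. The test vector
-- must extend to a smooth local section of the family for the Courant tensor to apply, hence the
-- last hypothesis.
omit [T2Space M] in
theorem isInvolutive_of_courantZero {L : Family E M}
    (hmax : ∀ x, ∀ a : GenTangent E x, (∀ b ∈ L x, pairing a b = 0) → a ∈ L x)
    (h : ∀ x, ∃ φ ∈ IsManifold.maximalAtlas 𝓘(ℝ, E) ∞ M, x ∈ φ.source ∧
      ∀ c₀ ∈ localFam φ L (φ x), ∃ V ⊆ φ.target, IsOpen V ∧ φ x ∈ V ∧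
        CourantZero (fun e => (localFam φ L e : Set (Pontryagin E))) V ∧
        ∃ c : E → Pontryagin E, ContDiffOn ℝ ∞ c V ∧ (∀ e ∈ V, c e ∈ localFam φ L e) ∧
          c (φ x) = c₀) : IsInvolutive L := by
  intro a ha b hb x
  refine hmax x _ fun d hd => ?_
  obtain ⟨φ, hφ, hx, H⟩ := h x
  obtain ⟨V, hVt, hV, hxV, hC, c, hc, hcL, hcx⟩ := H (conj (E := E) (fwd φ x) (bwd φ (φ x)) d) (by
    rw [localFam_apply hx]; exact ⟨d, hd, rfl⟩)
  have key := pairing_dorfman hφ isOpen_univ ha.1 hb.1 (ofChart φ c) (Set.mem_univ x) hx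
  have hcd : ofChart φ c x = d := by
    unfold ofChart
    rw [hcx]
    exact conj_conj (E := E) (bwd_comp_fwd hφ hx) d
  rw [hcd, courant_congr (Filter.EventuallyEq.refl _ _) (Filter.EventuallyEq.refl _ _)
    (chartSec_ofChart hφ (φ.map_source hx) c)] at key
  rw [key]
  refine hC V subset_rfl hV _ _ _ (ha.1.contDiffOn_chartSec hφ isOpen_univ fun e he =>
    ⟨hVt he, trivial⟩) (hb.1.contDiffOn_chartSec hφ isOpen_univ fun e he => ⟨hVt he, trivial⟩) hc
    (fun e he => chartSec_mem (ha.2 _))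
    (fun e he => chartSec_mem (hb.2 _)) hcL _ hxV

end LocalFamilies

/-! ### Fibrewise form of L[F] and of the Magri recipe -/

section Fibres

variable {E : Type*} [NormedAddCommGroup E] [NormedSpace ℝ E]
  {M : Type*} [TopologicalSpace M] [ChartedSpace E M]

/-- A fibre of a family of tangent vectors, as a subspace of the model space. -/
def tfib (F : TangentFamily E M) (x : M) : Submodule ℝ E := F x

theorem fib_closestLagrangian (L : Family E M) (F : TangentFamily E M) (x : M) :
    fib (closestLagrangian L (ofTangent F)) x = closest (fib L x) (tfib F x) := by
  ext a
  rw [mem_closest]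
  refine (Submodule.mem_sup (p := L x ⊓ orth (ofTangent F) x) (p' := ofTangent F x)).trans ?_
  constructor
  · rintro ⟨b, ⟨hb, hbo⟩, _, ⟨f, hf, rfl⟩, rfl⟩
    refine ⟨fun g hg => ?_, f, hf, ?_⟩
    · have := hbo (g, 0) ⟨g, hg, rfl⟩
      have h2 : b.2 g = 0 := by simpa [pairing] using this
      exact (congrArg (· + (0 : ℝ)) h2).trans (add_zero 0)
    · have e : ((b.1 + f - f, b.2 + 0) : GenTangent E x) = b :=
        Prod.ext (add_sub_cancel_right b.1 f) (add_zero b.2)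
      have hb' : ((b.1 + f - f, b.2 + 0) : GenTangent E x) ∈ L x := by
        rw [e]
        exact hb
      exact hb'
  · rintro ⟨h1, f, hf, h2⟩
    refine ⟨(a.1 - f, a.2), ⟨h2, ?_⟩, (f, 0), ⟨f, hf, rfl⟩, ?_⟩
    · rintro _ ⟨g, hg, rfl⟩
      exact (zero_add (a.2 g)).trans (h1 g hg)
    · exact Prod.ext (sub_add_cancel a.1 f) (add_zero a.2)

/-- In 𝓝(L, R) a vector f arises from f + ξ ∈ L and f = v + w with v − ξ ∈ R and −w − ξ ∈ L. Adding
the two elements of L gives v ∈ L, and negating the one in R gives −v + ξ ∈ R. -/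
theorem mem_kernel_magri (L R : Family E M) (x : M) (f : TangentSpace 𝓘(ℝ, E) x) :
    f ∈ kernel (magri L R) x ↔ InMagri (fib L x) (fib R x) f := by
  have h : f ∈ kernel (magri L R) x ↔ f ∈ kernel (magriN L R) x := by
    constructor
    · exact fun h => h.1
    · exact fun h => ⟨h, fun v _ => rfl⟩
  rw [h]
  constructor
  · rintro ⟨u, ξ, η, h1, ⟨v, w, ζ, hv, ⟨⟨u', ξ'⟩, hw, hwe⟩, he⟩, hf⟩
    obtain ⟨hu, hη⟩ := Prod.mk.inj hf
    have hu' : f = u := hu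
    subst hu'
    obtain ⟨h2, rfl⟩ := Prod.mk.inj he
    obtain ⟨h3, h4⟩ := Prod.mk.inj hwe
    have h3' : -u' = w := h3
    have h4' : ξ' = η := h4
    subst h3' h4'
    have hξ : ξ' = -ξ := (neg_eq_of_add_eq_zero_right hη.symm).symm
    subst hξ
    have h5 := (L x).add_mem h1 hw
    have h6 := (R x).neg_mem hv
    have e1 : ((f, ξ) : GenTangent E x) + (u', -ξ) = (v, 0) :=
      Prod.ext (by rw [h2]; exact neg_add_cancel_right v u') (add_neg_cancel ξ)
    have e2 : -((v, -ξ) : GenTangent E x) = (-v, ξ) := Prod.ext rfl (by simp)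
    rw [e1] at h5
    rw [e2] at h6
    exact ⟨ξ, v, h1, h5, h6⟩
  · have key : ∀ (ξ : Cotangent E x) (v : TangentSpace 𝓘(ℝ, E) x), (f, ξ) ∈ L x → (v, 0) ∈ L x →
        (-v, ξ) ∈ R x → f ∈ kernel (magriN L R) x := by
      intro ξ v h1' h2' h3'
      have h5 := (L x).sub_mem h2' h1'
      have h6 := (R x).neg_mem h3'
      have e2 : -((-v, ξ) : GenTangent E x) = (v, -ξ) := Prod.ext (neg_neg v) rfl
      rw [e2] at h6
      refine ⟨f, ξ, -ξ, h1', ⟨v, f - v, -ξ, h6, ⟨_, h5, ?_⟩, ?_⟩, ?_⟩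
      · exact Prod.ext (neg_sub v f) (zero_sub ξ)
      · exact Prod.ext (add_sub_cancel v f).symm rfl
      · exact Prod.ext rfl (add_neg_cancel ξ).symm
    rintro ⟨ξ, v, h1, h2, h3⟩
    exact key ξ v h1 h2 h3

theorem mem_kernel_cotangentProd (A B : Family E M) (x : M) (f : TangentSpace 𝓘(ℝ, E) x) :
    f ∈ kernel (cotangentProd A B) x ↔ ∃ u v, u + v = f ∧ u ∈ kernel A x ∧ v ∈ kernel B x := by
  constructor
  · rintro ⟨u, v, ξ, hu, hv, h⟩
    obtain ⟨h1, rfl⟩ := Prod.mk.inj h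
    exact ⟨u, v, h1.symm, hu, hv⟩
  · rintro ⟨u, v, rfl, hu, hv⟩
    exact ⟨u, v, 0, hu, hv, rfl⟩

theorem localFam_closestLagrangian {φ : OpenPartialHomeomorph M E}
    (hφ : φ ∈ IsManifold.maximalAtlas 𝓘(ℝ, E) ∞ M) (L : Family E M) (F : TangentFamily E M)
    {e : E} (he : e ∈ φ.target) :
    localFam φ (closestLagrangian L (ofTangent F)) e =
      closest (localFam φ L e) ((tfib F (φ.symm e)).map (fwd φ (φ.symm e)).toLinearMap) := by
  have h1 := bwd_comp_fwd hφ (φ.map_target he)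
  rw [φ.right_inv he] at h1
  unfold localFam
  rw [fib_closestLagrangian, map_closest h1 (fwd_comp_bwd' hφ he)]

end Fibres

/-! ### Adapted charts of submersions -/

section Submersions

variable {E : Type*} [NormedAddCommGroup E] [NormedSpace ℝ E]
  {M : Type*} [TopologicalSpace M] [ChartedSpace E M]
  {E' : Type*} [NormedAddCommGroup E'] [NormedSpace ℝ E']
  {P : Type*} [TopologicalSpace P] [ChartedSpace E' P]

/-- Charts in which a map is the linear surjection `π`. -/
structure Adapted (p : M → P) (φ : OpenPartialHomeomorph M E) (ψ : OpenPartialHomeomorph P E')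
    (π : E →L[ℝ] E') : Prop where
  left_mem : φ ∈ IsManifold.maximalAtlas 𝓘(ℝ, E) ∞ M
  right_mem : ψ ∈ IsManifold.maximalAtlas 𝓘(ℝ, E') ∞ P
  surjective : Function.Surjective π
  mem_source : ∀ y ∈ φ.source, p y ∈ ψ.source
  eq : ∀ y ∈ φ.source, ψ (p y) = π (φ y)

theorem exists_adapted {p : M → P} (hp : Manifold.IsSubmersion 𝓘(ℝ, E) 𝓘(ℝ, E') ∞ p) (x : M) :
    ∃ (φ : OpenPartialHomeomorph M E) (ψ : OpenPartialHomeomorph P E') (π : E →L[ℝ] E'),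
      x ∈ φ.source ∧ Adapted p φ ψ π := by
  have h := hp.isSubmersionAt x
  refine ⟨h.domChart, h.codChart,
    (ContinuousLinearMap.fst ℝ E' h.complement).comp (h.equiv : E →L[ℝ] E' × h.complement),
    h.mem_domChart_source, h.domChart_mem_maximalAtlas, h.codChart_mem_maximalAtlas,
    fun y => ⟨h.equiv.symm (y, 0), by simp⟩, fun y hy => h.source_subset_preimage_source hy,
    fun y hy => ?_⟩
  have hw : Set.EqOn _ _ _ := h.writtenInCharts
  have := hw (show h.domChart y ∈ (h.domChart.extend 𝓘(ℝ, E)).target by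
    simpa using h.domChart.map_source hy)
  simpa [h.domChart.left_inv hy] using this

/-- The derivative of a map, between the model spaces. -/
def dmap (E E' : Type*) [NormedAddCommGroup E] [NormedSpace ℝ E]
    [NormedAddCommGroup E'] [NormedSpace ℝ E']
    {M : Type*} [TopologicalSpace M] [ChartedSpace E M]
    {P : Type*} [TopologicalSpace P] [ChartedSpace E' P] (p : M → P) (x : M) : E →L[ℝ] E' :=
  mfderiv 𝓘(ℝ, E) 𝓘(ℝ, E') p x

variable {p : M → P} {φ : OpenPartialHomeomorph M E} {ψ : OpenPartialHomeomorph P E'}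
  {π : E →L[ℝ] E'}

theorem Adapted.fwd_comp (h : Adapted p φ ψ π) (hp : MDifferentiable 𝓘(ℝ, E) 𝓘(ℝ, E') p) {y : M}
    (hy : y ∈ φ.source) : (fwd ψ (p y)).comp (dmap E E' p y) = π.comp (fwd φ y) := by
  have h1 := mfderiv_comp (I := 𝓘(ℝ, E)) (I' := 𝓘(ℝ, E')) (I'' := 𝓘(ℝ, E')) y (g := ψ) (f := p)
    ((mdifferentiable_of_mem_maximalAtlas h.right_mem).mdifferentiableAt (h.mem_source y hy))
    (hp y)
  have h2 := mfderiv_comp (I := 𝓘(ℝ, E)) (I' := 𝓘(ℝ, E)) (I'' := 𝓘(ℝ, E')) y (g := π) (f := φ)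
    π.differentiableAt.mdifferentiableAt
    ((mdifferentiable_of_mem_maximalAtlas h.left_mem).mdifferentiableAt hy)
  rw [mfderiv_eq_fderiv, π.fderiv] at h2
  have h3 : mfderiv 𝓘(ℝ, E) 𝓘(ℝ, E') (ψ ∘ p) y = mfderiv 𝓘(ℝ, E) 𝓘(ℝ, E') (π ∘ φ) y := by
    apply Filter.EventuallyEq.mfderiv_eq
    filter_upwards [φ.open_source.mem_nhds hy] with z hz
    exact h.eq z hz
  exact h1.symm.trans (h3.trans h2)

theorem Adapted.surjective_dmap (h : Adapted p φ ψ π)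
    (hp : MDifferentiable 𝓘(ℝ, E) 𝓘(ℝ, E') p) {y : M} (hy : y ∈ φ.source) :
    Function.Surjective (dmap E E' p y) := by
  intro v
  obtain ⟨u, hu⟩ := h.surjective (fwd ψ (p y) v)
  refine ⟨bwd φ (φ y) u, ?_⟩
  have h1 := DFunLike.congr_fun (h.fwd_comp hp hy) (bwd φ (φ y) u)
  rw [ContinuousLinearMap.comp_apply, ContinuousLinearMap.comp_apply, fwd_bwd h.left_mem hy,
    hu] at h1
  rw [← bwd_fwd h.right_mem (h.mem_source y hy) v, ← h1,
    bwd_fwd h.right_mem (h.mem_source y hy)]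

theorem Adapted.map_vertical (h : Adapted p φ ψ π)
    (hp : MDifferentiable 𝓘(ℝ, E) 𝓘(ℝ, E') p) {y : M} (hy : y ∈ φ.source) :
    (tfib (vertical E E' p) y).map (fwd φ y).toLinearMap = LinearMap.ker π.toLinearMap := by
  have h1 := h.fwd_comp hp hy
  ext v
  constructor
  · rintro ⟨u, hu, rfl⟩
    have hu' : dmap E E' p y u = 0 := hu
    have h2 := DFunLike.congr_fun h1 u
    simp only [ContinuousLinearMap.comp_apply, hu', map_zero] at h2
    exact h2.symm
  · intro hv
    have hv' : π v = 0 := hv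
    refine ⟨bwd φ (φ y) v, ?_, fwd_bwd h.left_mem hy v⟩
    have h2 := DFunLike.congr_fun h1 (bwd φ (φ y) v)
    simp only [ContinuousLinearMap.comp_apply, fwd_bwd h.left_mem hy, hv'] at h2
    change dmap E E' p y (bwd φ (φ y) v) = 0
    rw [← bwd_fwd h.right_mem (h.mem_source y hy) (dmap E E' p y (bwd φ (φ y) v)), h2, map_zero]

/-- The forward image of the fibre of a family. -/
def pushFib (E' : Type*) [NormedAddCommGroup E'] [NormedSpace ℝ E']
    {P : Type*} [TopologicalSpace P] [ChartedSpace E' P] (p : M → P) (L : Family E M) (x : M) :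
    Submodule ℝ (Pontryagin E') :=
  push (dmap E E' p x) (fib L x)

/-- The charts intertwine the derivative of p with π (`Adapted.fwd_comp`), so taking forward images
commutes with passing to coordinates. -/
theorem Adapted.push_localFam (h : Adapted p φ ψ π)
    (hp : MDifferentiable 𝓘(ℝ, E) 𝓘(ℝ, E') p) {y : M} (hy : y ∈ φ.source) (L : Family E M) :
    push π (localFam φ L (φ y)) =
      (pushFib E' p L y).map (conjL (fwd ψ (p y)) (bwd ψ (ψ (p y)))) := by
  have h1 := h.fwd_comp hp hy
  have h2 : ∀ v, fwd ψ (p y) (dmap E E' p y v) = π (fwd φ y v) := DFunLike.congr_fun h1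
  have hψ := h.mem_source y hy
  ext b
  rw [mem_map_conjL (bwd_comp_fwd h.right_mem hψ) (fwd_comp_bwd h.right_mem hψ)]
  constructor
  · rintro ⟨a, ha, hab⟩
    have ha' := (mem_localFam h.left_mem hy).1 ha
    refine ⟨_, ha', ?_, ?_⟩
    · have h3 := h2 (bwd φ (φ y) a.1)
      rw [fwd_bwd h.left_mem hy, hab.1] at h3
      change dmap E E' p y (bwd φ (φ y) a.1) = bwd ψ (ψ (p y)) b.1
      rw [← h3, bwd_fwd h.right_mem hψ]
    · ext w
      change a.2 (fwd φ y w) = b.2 (fwd ψ (p y) (dmap E E' p y w))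
      rw [h2, hab.2]
      rfl
  · rintro ⟨a, ha, hab⟩
    refine ⟨conj (fwd φ y) (bwd φ (φ y)) a, ?_, ?_, ?_⟩
    · rw [localFam_apply hy]
      exact ⟨a, ha, rfl⟩
    · change π (fwd φ y a.1) = b.1
      rw [← h2, hab.1]
      exact fwd_bwd h.right_mem hψ b.1
    · ext w
      change a.2 (bwd φ (φ y) w) = b.2 (π w)
      rw [hab.2]
      change b.2 (fwd ψ (p y) (dmap E E' p y (bwd φ (φ y) w))) = b.2 (π w)
      rw [h2, fwd_bwd h.left_mem hy]

end Submersions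

/-! ### Local form of weakly concurring Dirac structures -/

section Concurrence

variable {E : Type*} [NormedAddCommGroup E] [NormedSpace ℝ E]

theorem HasFrameAt.congr {Λ Λ' : E → Submodule ℝ (Pontryagin E)} {e : E} (h : HasFrameAt Λ e)
    {U : Set E} (hU : IsOpen U) (he : e ∈ U) (hΛ : ∀ e ∈ U, Λ e = Λ' e) : HasFrameAt Λ' e := by
  obtain ⟨V, hV, heV, k, g, hg, H⟩ := h
  exact ⟨V ∩ U, hV.inter hU, ⟨heV, he⟩, k, g, fun i => (hg i).mono Set.inter_subset_left,
    fun e' he' => ⟨(H e' he'.1).1, (H e' he'.1).2.trans (hΛ e' he'.2)⟩⟩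

variable {M : Type*} [TopologicalSpace M] [ChartedSpace E M]

theorem IsLagrangian.pairing_eq_zero {L : Family E M} (hL : IsLagrangian L) {x : M}
    {a b : GenTangent E x} (ha : a ∈ L x) (hb : b ∈ L x) : pairing a b = 0 :=
  ((isLagrangian_iff L).1 hL x a).1 ha b hb

theorem IsLagrangian.pairing_cotangentProd {L R : Family E M} (hL : IsLagrangian L)
    (hR : IsLagrangian R) {x : M} {a b : GenTangent E x} (ha : a ∈ cotangentProd L R x)
    (hb : b ∈ cotangentProd L R x) : pairing a b = 0 := by
  obtain ⟨u, v, ξ, hu, hv, rfl⟩ := ha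
  obtain ⟨u', v', ξ', hu', hv', rfl⟩ := hb
  have h1 := hL.pairing_eq_zero hu hu'
  have h2 := hR.pairing_eq_zero hv hv'
  simp only [pairing, map_add] at h1 h2 ⊢
  linarith

variable [FiniteDimensional ℝ E] [IsManifold 𝓘(ℝ, E) ∞ M] {φ : OpenPartialHomeomorph M E}

theorem IsDirac.exists_hasSmoothEqs (hφ : φ ∈ IsManifold.maximalAtlas 𝓘(ℝ, E) ∞ M)
    {L : Family E M} (hL : IsDirac L) {U : Set E} (hU : IsOpen U) (hUt : U ⊆ φ.target) {e : E}
    (he : e ∈ U) : ∃ V ⊆ U, IsOpen V ∧ e ∈ V ∧ HasSmoothEqs (localFam φ L) V :=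
  (hL.subbundle.hasFrameAt hφ (hUt he)).hasSmoothEqs hU he fun _ he' =>
    hL.lagrangian.isLag_localFam hφ (hUt he')

variable [T2Space M]

theorem IsDirac.exists_concurOn (hφ : φ ∈ IsManifold.maximalAtlas 𝓘(ℝ, E) ∞ M)
    {L R : Family E M} (hL : IsDirac L) (hR : IsDirac R) (hLR : WeaklyConcur L R) {U : Set E}
    (hU : IsOpen U) (hUt : U ⊆ φ.target) {e : E} (he : e ∈ U) :
    ∃ V ⊆ U, IsOpen V ∧ e ∈ V ∧ ConcurOn (localFam φ L) (localFam φ R) V := by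
  obtain ⟨V₁, hV₁, oV₁, eV₁, h₁⟩ := hL.exists_hasSmoothEqs hφ hU hUt he
  obtain ⟨V₂, hV₂, oV₂, eV₂, h₂⟩ := hR.exists_hasSmoothEqs hφ oV₁ (hV₁.trans hUt) eV₁
  have ht : V₂ ⊆ φ.target := (hV₂.trans hV₁).trans hUt
  refine ⟨V₂, hV₂.trans hV₁, oV₂, eV₂,
    fun e he => hL.lagrangian.isLag_localFam hφ (ht he),
    fun e he => hR.lagrangian.isLag_localFam hφ (ht he), h₁.mono hV₂, h₂,
    (hL.involutive.courantZero hφ fun x a ha b hb => hL.lagrangian.pairing_eq_zero ha hb).mono ht,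
    (hR.involutive.courantZero hφ fun x a ha b hb => hR.lagrangian.pairing_eq_zero ha hb).mono ht,
    ?_⟩
  have h := (IsInvolutive.courantZero hφ hLR fun x a ha b hb =>
    hL.lagrangian.pairing_cotangentProd hR.lagrangian ha hb).mono ht
  intro W hW oW a b c ca cb cc ha hb hc
  refine h W hW oW a b c ca cb cc (fun e he => ?_) (fun e he => ?_) (fun e he => ?_)
  · exact (cotProd_localFam hφ L R (ht (hW he))).le (ha e he)
  · exact (cotProd_localFam hφ L R (ht (hW he))).le (hb e he)
  · exact (cotProd_localFam hφ L R (ht (hW he))).le (hc e he)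

omit [T2Space M] [FiniteDimensional ℝ E] [IsManifold 𝓘(ℝ, E) ∞ M] in
theorem WeaklyConcur.symm [IsManifold 𝓘(ℝ, E) ∞ M] {L R : Family E M} (h : WeaklyConcur L R) :
    WeaklyConcur R L := by
  have : cotangentProd R L = cotangentProd L R := by
    funext x
    ext a
    exact iff_of_eq (congrArg (fun S : Set (Pontryagin E) => a ∈ S)
      (cotProd_comm (fib R x) (fib L x)))
  unfold WeaklyConcur
  rwa [this]

end Concurrence

/-! ### From local sections to subbundles -/

section LocalSections

variable {E : Type*} [NormedAddCommGroup E] [NormedSpace ℝ E]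
  {M : Type*} [TopologicalSpace M] [ChartedSpace E M]

/-- Through each vector of the fibre at `z` there is a smooth local section. -/
def LocalSections (ψ : OpenPartialHomeomorph M E) (L : Family E M) (e₀ : E) : Prop :=
  ∀ b₀ ∈ localFam ψ L e₀, ∃ W ⊆ ψ.target, IsOpen W ∧ e₀ ∈ W ∧ ∃ b : E → Pontryagin E,
    ContDiffOn ℝ ∞ b W ∧ (∀ e ∈ W, b e ∈ localFam ψ L e) ∧ b e₀ = b₀

variable [FiniteDimensional ℝ E] [IsManifold 𝓘(ℝ, E) ∞ M]

theorem IsLagrangian.isSubbundle {L : Family E M} (hL : IsLagrangian L)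
    (h : ∀ x, ∃ ψ ∈ IsManifold.maximalAtlas 𝓘(ℝ, E) ∞ M, x ∈ ψ.source ∧
      LocalSections ψ L (ψ x)) : IsSubbundle L := by
  intro x
  obtain ⟨ψ, hψ, hx, H⟩ := h x
  have hlag := hL.isLag_localFam hψ (ψ.map_source hx)
  let v := Module.finBasis ℝ (localFam ψ L (ψ x))
  choose W hWt hW hxW b hb hbL hbx using fun i => H (v i) (v i).2
  have hind₀ : LinearIndependent ℝ (fun i => b i (ψ x)) := by
    simp only [hbx]
    exact v.linearIndependent.map' (Submodule.subtype _) (Submodule.ker_subtype _)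
  have hWall : IsOpen (⋂ i, W i) := isOpen_iInter_of_finite hW
  have hcont : ContinuousAt (fun e => fun i => b i e) (ψ x) :=
    continuousAt_pi.2 fun i => (hb i).continuousOn.continuousAt ((hW i).mem_nhds (hxW i))
  -- Linear independence is an open condition, and all Lagrangian fibres have the same dimension; so
  -- sections through a basis of one fibre form a frame nearby.
  have hind : ∀ᶠ e in 𝓝 (ψ x), LinearIndependent ℝ (fun i => b i e) :=
    hcont.eventually (isOpen_setOfPred_linearIndependent.mem_nhds hind₀)
  refine ⟨{y | y ∈ ψ.source ∧ ψ y ∈ (⋂ i, W i) ∧ LinearIndependent ℝ (fun i => b i (ψ y))}, ?_,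
    _, fun i => ofChart ψ (b i), fun i => ?_, ?_⟩
  · have hψc := ψ.continuousAt hx
    filter_upwards [ψ.open_source.mem_nhds hx,
      hψc.eventually (hWall.mem_nhds (Set.mem_iInter.2 hxW)), hψc.eventually hind]
      with y h1 h2 h3 using ⟨h1, h2, h3⟩
  · exact smoothSectionOn_ofChart hψ (hW i) (hb i) fun y hy =>
      ⟨hy.1, Set.mem_iInter.1 hy.2.1 i⟩
  · rintro y ⟨hy, hyW, hyi⟩
    let T : Pontryagin E →ₗ[ℝ] GenTangent E y := conjL (bwd ψ (ψ y)) (fwd ψ y)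
    have hker : LinearMap.ker (conjL (bwd ψ (ψ y)) (fwd ψ y)) = ⊥ :=
      LinearMap.ker_eq_bot_of_inverse (g := conjL (fwd ψ y) (bwd ψ (ψ y)))
        (LinearMap.ext fun c => conj_conj (fwd_comp_bwd hψ hy) c)
    have hli : LinearIndependent ℝ (fun i => ofChart ψ (b i) y) := hyi.map' T hker
    refine ⟨hli, ?_⟩
    have hle : Submodule.span ℝ (Set.range fun i => ofChart ψ (b i) y) ≤ L y := by
      rw [Submodule.span_le]
      rintro _ ⟨i, rfl⟩
      exact ofChart_mem hψ hy (hbL i _ (Set.mem_iInter.1 hyW i))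
    have : FiniteDimensional ℝ (GenTangent E y) :=
      inferInstanceAs (FiniteDimensional ℝ (Pontryagin E))
    refine Submodule.eq_of_le_of_finrank_eq hle ?_
    rw [finrank_span_eq_card hli, Fintype.card_fin]
    exact hlag.finrank_eq.trans (((isLagrangian_iff L).1 hL y).finrank_eq).symm

end LocalSections

/-! ### Global forward images along connected fibres -/

section Reduction

variable {E : Type*} [NormedAddCommGroup E] [NormedSpace ℝ E] [FiniteDimensional ℝ E]
  {M : Type*} [TopologicalSpace M] [ChartedSpace E M] [IsManifold 𝓘(ℝ, E) ∞ M]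
  {E' : Type*} [NormedAddCommGroup E'] [NormedSpace ℝ E'] [FiniteDimensional ℝ E']
  {P : Type*} [TopologicalSpace P] [ChartedSpace E' P] [IsManifold 𝓘(ℝ, E') ∞ P]

/-- The fibres of `L'` are the forward images of the fibres of `L`. -/
def PushesTo (p : M → P) (L : Family E M) (L' : Family E' P) : Prop :=
  ∀ x, fib L' (p x) = pushFib E' p L x

variable {p : M → P}

omit [FiniteDimensional ℝ E] [IsManifold 𝓘(ℝ, E) ∞ M] [FiniteDimensional ℝ E']
  [IsManifold 𝓘(ℝ, E') ∞ P] in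
theorem PushesTo.isForward {L : Family E M} {L' : Family E' P} (h : PushesTo p L L') :
    IsForward p L L' := fun x _ hb => (h x).le hb

omit [FiniteDimensional ℝ E] [IsManifold 𝓘(ℝ, E) ∞ M] [FiniteDimensional ℝ E']
  [IsManifold 𝓘(ℝ, E') ∞ P] in
theorem PushesTo.localFam_eq {L : Family E M} {L' : Family E' P} (h : PushesTo p L L')
    {φ : OpenPartialHomeomorph M E} {ψ : OpenPartialHomeomorph P E'} {π : E →L[ℝ] E'}
    (had : Adapted p φ ψ π) (hp : MDifferentiable 𝓘(ℝ, E) 𝓘(ℝ, E') p) {e : E}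
    (he : e ∈ φ.target) : localFam ψ L' (π e) = push π (localFam φ L e) := by
  obtain ⟨y, hy, rfl⟩ : ∃ y ∈ φ.source, φ y = e := ⟨φ.symm e, φ.map_target he, φ.right_inv he⟩
  rw [had.push_localFam hp hy, ← had.eq y hy, localFam_apply (had.mem_source y hy), h y]

/-- Invariance of `L` along the fibres of `p`, in adapted charts. -/
def Invariant (E' : Type*) [NormedAddCommGroup E'] [NormedSpace ℝ E']
    {P : Type*} [TopologicalSpace P] [ChartedSpace E' P] (p : M → P) (L : Family E M) : Prop :=
  ∀ (φ : OpenPartialHomeomorph M E) (ψ : OpenPartialHomeomorph P E') (π : E →L[ℝ] E'),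
    Adapted p φ ψ π → ∀ e ∈ φ.target, ∃ U ⊆ φ.target, IsOpen U ∧ e ∈ U ∧
      HasSmoothEqs (localFam φ L) U ∧ InvariantOn (localFam φ L) (LinearMap.ker π.toLinearMap) U

theorem exists_pushesTo (hp : IsSurjectiveSubmersion E E' p) (hfib : HasConnectedFibres p)
    {L : Family E M} (hL : IsLagrangian L) (hinv : Invariant E' p L)
    (hcl : IsSubbundle (closestLagrangian L (ofTangent (vertical E E' p)))) :
    ∃ L' : Family E' P, PushesTo p L L' ∧ IsLagrangian L' ∧ IsSubbundle L' := by
  have hpd : MDifferentiable 𝓘(ℝ, E) 𝓘(ℝ, E') p := hp.1.contMDiff.mdifferentiable (by simp)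
  have hred : ∀ (φ : OpenPartialHomeomorph M E) (ψ : OpenPartialHomeomorph P E')
      (π : E →L[ℝ] E'), Adapted p φ ψ π → ∀ e₀ ∈ φ.target, ∃ r > 0,
      Metric.ball e₀ r ⊆ φ.target ∧
      (∀ e ∈ Metric.ball e₀ r, ∀ e' ∈ Metric.ball e₀ r, π e = π e' →
        push π (localFam φ L e) = push π (localFam φ L e')) ∧
      ∀ b₀ ∈ push π (localFam φ L e₀), ∃ W, IsOpen W ∧ π e₀ ∈ W ∧ ∃ b : E' → Pontryagin E',
        ContDiffOn ℝ ∞ b W ∧ b (π e₀) = b₀ ∧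
        ∀ y ∈ W, ∃ e ∈ Metric.ball e₀ r, π e = y ∧ b y ∈ push π (localFam φ L e) := by
    intro φ ψ π had e₀ he₀
    obtain ⟨U, hUt, hU, heU, heqs, hI⟩ := hinv φ ψ π had e₀ he₀
    have hfr : HasFrameAt (fun e => closest (localFam φ L e) (LinearMap.ker π.toLinearMap)) e₀ := by
      refine (hcl.hasFrameAt had.left_mem he₀).congr φ.open_target he₀ fun e he => ?_
      rw [localFam_closestLagrangian had.left_mem L _ he,
        had.map_vertical hpd (φ.map_target he)]
    obtain ⟨r, hr, hrU, h1, h2⟩ := hI.exists_reduction had.surjective heqs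
      (fun e he => hL.isLag_localFam had.left_mem (hUt he)) hU heU hfr
    exact ⟨r, hr, hrU.trans hUt, h1, h2⟩
  have hconst : ∀ x y, p x = p y → pushFib E' p L x = pushFib E' p L y := by
    intro x y hxy
    -- For the discrete topology, continuity along a fibre is local constancy, so preconnectedness
    -- gives constancy.
    let _ : TopologicalSpace (Submodule ℝ (Pontryagin E')) := ⊥
    have : DiscreteTopology (Submodule ℝ (Pontryagin E')) := ⟨rfl⟩
    refine (hfib (p y)).isPreconnected.constant (f := pushFib E' p L) ?_ hxy rfl
    intro z hz
    obtain ⟨φ, ψ, π, hzφ, had⟩ := exists_adapted hp.1 z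
    obtain ⟨r, hr, hrt, h1, -⟩ := hred φ ψ π had (φ z) (φ.map_source hzφ)
    refine (tendsto_const_nhds (x := pushFib E' p L z)).congr' ?_
    have hn : ∀ᶠ w in 𝓝[p ⁻¹' {p y}] z, w ∈ φ.source ∧ φ w ∈ Metric.ball (φ z) r :=
      nhdsWithin_le_nhds ((φ.open_source.eventually_mem hzφ).and
        ((φ.continuousAt hzφ).eventually (Metric.ball_mem_nhds _ hr)))
    filter_upwards [hn, self_mem_nhdsWithin] with w hw hwy
    have hzw : p z = p w := (show p z = p y from hz).trans (show p w = p y from hwy).symm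
    have h3 := h1 (φ z) (Metric.mem_ball_self hr) (φ w) hw.2 (by
      rw [← had.eq z hzφ, ← had.eq w hw.1, hzw])
    rw [had.push_localFam hpd hzφ, had.push_localFam hpd hw.1, hzw] at h3
    have hψ := had.mem_source w hw.1
    ext c
    have h4 : ∀ Λ : Submodule ℝ (Pontryagin E'), c ∈ Λ ↔
        conj (fwd ψ (p w)) (bwd ψ (ψ (p w))) c ∈
          Λ.map (conjL (fwd ψ (p w)) (bwd ψ (ψ (p w)))) := fun Λ => by
      rw [mem_map_conjL (bwd_comp_fwd had.right_mem hψ) (fwd_comp_bwd had.right_mem hψ),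
        conj_conj (bwd_comp_fwd had.right_mem hψ)]
    rw [h4 (pushFib E' p L z), h3, ← h4]
  -- By `hconst` any other choice of preimages defines the same family.
  let L' : Family E' P := fun z => pushFib E' p L (Function.surjInv hp.2 z)
  have hL' : PushesTo p L L' := fun x => hconst _ _ (Function.surjInv_eq hp.2 (p x))
  have hlag : IsLagrangian L' := by
    rw [isLagrangian_iff]
    intro z
    obtain ⟨φ, ψ, π, hzφ, had⟩ := exists_adapted hp.1 (Function.surjInv hp.2 z)
    exact IsLag.push (had.surjective_dmap hpd hzφ) ((isLagrangian_iff L).1 hL _)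
  refine ⟨L', hL', hlag, hlag.isSubbundle fun z => ?_⟩
  obtain ⟨x, rfl⟩ := hp.2 z
  obtain ⟨φ, ψ, π, hx, had⟩ := exists_adapted hp.1 x
  refine ⟨ψ, had.right_mem, had.mem_source x hx, ?_⟩
  obtain ⟨r, hr, hrt, -, h2⟩ := hred φ ψ π had (φ x) (φ.map_source hx)
  intro b₀ hb₀
  rw [had.eq x hx, hL'.localFam_eq had hpd (φ.map_source hx)] at hb₀
  obtain ⟨W, hW, hxW, b, hb, hbx, hbW⟩ := h2 b₀ hb₀
  rw [had.eq x hx]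
  refine ⟨W, fun y hy => ?_, hW, hxW, b, hb, fun y hy => ?_, hbx⟩
  · obtain ⟨e, he, rfl, -⟩ := hbW y hy
    rw [← φ.right_inv (hrt he), ← had.eq _ (φ.map_target (hrt he))]
    exact ψ.map_source (had.mem_source _ (φ.map_target (hrt he)))
  · obtain ⟨e, he, rfl, hbe⟩ := hbW y hy
    rwa [hL'.localFam_eq had hpd (hrt he)]

end Reduction

/-! ### Lagrangian families with trivial kernel -/

section Bivectors

variable {E : Type*} [NormedAddCommGroup E] [NormedSpace ℝ E] [FiniteDimensional ℝ E]

omit [FiniteDimensional ℝ E] in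
theorem HasFrameAt.exists_section {Λ : E → Submodule ℝ (Pontryagin E)} {e₀ : E}
    (h : HasFrameAt Λ e₀) {c₀ : Pontryagin E} (hc₀ : c₀ ∈ Λ e₀) :
    ∃ U, IsOpen U ∧ e₀ ∈ U ∧ ∃ c : E → Pontryagin E, ContDiffOn ℝ ∞ c U ∧
      (∀ e ∈ U, c e ∈ Λ e) ∧ c e₀ = c₀ := by
  obtain ⟨U, hU, heU, k, g, hg, H⟩ := h
  rw [← (H e₀ heU).2, Submodule.mem_span_range_iff_exists_fun] at hc₀
  obtain ⟨r, hr⟩ := hc₀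
  refine ⟨U, hU, heU, fun e => ∑ i, r i • g i e, ContDiffOn.sum fun i _ =>
    contDiffOn_const.fun_smul (hg i), fun e he => ?_, hr⟩
  rw [← (H e he).2]
  exact Submodule.sum_mem _ fun i _ =>
    Submodule.smul_mem _ _ (Submodule.subset_span ⟨i, rfl⟩)

/-- A smooth Lagrangian family with trivial kernel is the graph of a smooth bivector field. -/
theorem HasFrameAt.exists_bivector {Λ : E → Submodule ℝ (Pontryagin E)} {e₀ : E}
    (h : HasFrameAt Λ e₀) {U : Set E} (hU : IsOpen U) (he₀ : e₀ ∈ U)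
    (hlag : ∀ e ∈ U, IsLag (Λ e)) (hker : ∀ e ∈ U, ∀ u, (u, 0) ∈ Λ e → u = 0) :
    ∃ V ⊆ U, IsOpen V ∧ e₀ ∈ V ∧ ∃ B : E → (E →L[ℝ] ℝ) →L[ℝ] E, ContDiffOn ℝ ∞ B V ∧
      ∀ e ∈ V, ∀ a, a ∈ Λ e ↔ a.1 = B e a.2 := by
  obtain ⟨r, hr, hrU, S, Q, hS, -, H⟩ := h.exists_graph (hU.mem_nhds he₀)
  let T : E → Λ e₀ →L[ℝ] (E →L[ℝ] ℝ) := fun e =>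
    (ContinuousLinearMap.snd ℝ E (E →L[ℝ] ℝ)).comp (S e)
  -- Trivial kernel makes the projection to covectors injective, and equality of dimensions makes it
  -- invertible; the bivector is the vector part after its inverse.
  have hinj : ∀ e ∈ Metric.ball e₀ r, Function.Injective (T e) := by
    intro e he
    rw [injective_iff_map_eq_zero]
    intro d hd
    have hd2 : (S e d).2 = 0 := hd
    have hd1 : (S e d).1 = 0 := hker e (hrU he) _ (hd2 ▸ (H e he).1 d)
    have hd0 : S e d = 0 := Prod.ext hd1 hd2
    rw [← (H e he).2.1 d, hd0, map_zero]
  have hfin : Module.finrank ℝ (Λ e₀) = Module.finrank ℝ (E →L[ℝ] ℝ) := by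
    rw [(hlag e₀ he₀).finrank_eq, finrank_dual_eq]
  have hequiv : ∀ e ∈ Metric.ball e₀ r, ∃ t : Λ e₀ ≃L[ℝ] (E →L[ℝ] ℝ),
      (t : Λ e₀ →L[ℝ] (E →L[ℝ] ℝ)) = T e := by
    intro e he
    refine ⟨(LinearEquiv.ofInjectiveOfFinrankEq (T e).toLinearMap (hinj e he)
      hfin).toContinuousLinearEquiv, ?_⟩
    ext d
    rfl
  have hT : ContDiffOn ℝ ∞ T (Metric.ball e₀ r) := contDiffOn_const.clm_comp hS
  refine ⟨Metric.ball e₀ r, hrU, Metric.isOpen_ball, Metric.mem_ball_self hr,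
    fun e => ((ContinuousLinearMap.fst ℝ E (E →L[ℝ] ℝ)).comp (S e)).comp (T e).inverse,
    (contDiffOn_const.clm_comp hS).clm_comp fun e he => ?_, fun e he a => ?_⟩
  · obtain ⟨t, ht⟩ := hequiv e he
    have := contDiffAt_map_inverse (𝕜 := ℝ) (n := ∞) t
    rw [ht] at this
    exact this.comp_contDiffWithinAt e (hT e he)
  · obtain ⟨t, ht⟩ := hequiv e he
    have hinv : (T e).inverse = t.symm := by rw [← ht, ContinuousLinearMap.inverse_equiv]
    have hTt : ∀ d, (S e d).2 = t d := fun d => (DFunLike.congr_fun ht d).symm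
    simp only [hinv, ContinuousLinearMap.comp_apply, ContinuousLinearMap.coe_fst',
      ContinuousLinearEquiv.coe_coe]
    constructor
    · intro ha
      obtain ⟨d, rfl⟩ := (H e he).2.2 a ha
      rw [hTt, t.symm_apply_apply]
    · intro ha
      have : a = S e (t.symm a.2) := Prod.ext ha (by rw [hTt, t.apply_symm_apply])
      rw [this]
      exact (H e he).1 _

/-- With trivial kernel every covector occurs in Λ. Subtracting the vector that Λ attaches to the
covector of a leaves an element orthogonal to Ρ, hence in Ρ. -/
theorem IsLag.mem_cotProd {Λ Ρ : Submodule ℝ (Pontryagin E)} (hΛ : IsLag Λ) (hΡ : IsLag Ρ)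
    (hker : ∀ u, (u, 0) ∈ Λ → u = 0) {a : Pontryagin E} (ha : ∀ b ∈ cotProd Λ Ρ, dot a b = 0) :
    a ∈ cotProd Λ Ρ := by
  have hex : ∀ ξ, ∃ u, (u, ξ) ∈ Λ := fun ξ =>
    exists_mem_of_annihilates hΛ fun k hk => by rw [hker k hk, map_zero]
  obtain ⟨u, hu⟩ := hex a.2
  refine ⟨u, a.1 - u, a.2, hu, (hΡ _).2 fun b hb => ?_, Prod.ext (add_sub_cancel u a.1).symm rfl⟩
  obtain ⟨w, hw⟩ := hex b.2
  have h1 := ha (w + b.1, b.2) ⟨w, b.1, b.2, hw, hb, rfl⟩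
  have h2 := (hΛ _).1 hu _ hw
  simp only [dot, map_add, map_sub] at h1 h2 ⊢
  linarith

end Bivectors

/-! ### Descent of invariance, involutivity and weak concurrence -/

section Descent

variable {E : Type*} [NormedAddCommGroup E] [NormedSpace ℝ E] [FiniteDimensional ℝ E]
  {E' : Type*} [NormedAddCommGroup E'] [NormedSpace ℝ E'] [FiniteDimensional ℝ E']

omit [FiniteDimensional ℝ E] [FiniteDimensional ℝ E'] in
theorem CourantZero.push {S : E → Set (Pontryagin E)} {S' : E' → Set (Pontryagin E')}
    {π : E →L[ℝ] E'} {V : Set E} (hS : CourantZero S V) (hV : IsOpen V)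
    (hlift : ∀ (V' : Set E) (W : Set E') (b : E' → Pontryagin E'), V' ⊆ V → Set.MapsTo π V' W →
      ContDiffOn ℝ ∞ b W → (∀ e ∈ W, b e ∈ S' e) → LiftsOn π S b V') :
    CourantZero S' (π '' V) := by
  intro W hW oW a b c ha hb hc haS hbS hcS y hy
  obtain ⟨e, he, rfl⟩ := hW hy
  exact courant_eq_zero_of_lifts (hS.mono Set.inter_subset_left)
    (hV.inter (oW.preimage π.continuous)) oW (fun e he => he.2) ha hb hc
    (hlift _ W a Set.inter_subset_left (fun e he => he.2) ha haS)
    (hlift _ W b Set.inter_subset_left (fun e he => he.2) hb hbS)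
    (hlift _ W c Set.inter_subset_left (fun e he => he.2) hc hcS) e ⟨he, hy⟩

variable {M : Type*} [TopologicalSpace M] [ChartedSpace E M] [IsManifold 𝓘(ℝ, E) ∞ M] [T2Space M]
  {P : Type*} [TopologicalSpace P] [ChartedSpace E' P] [IsManifold 𝓘(ℝ, E') ∞ P] {p : M → P}

-- Two pairs are allowed so that one statement serves all three submersions: for a single vertical
-- bundle K(𝓝(L, R)) the pairs coincide, for r they are (L, R) and (R, L).
omit [FiniteDimensional ℝ E'] [IsManifold 𝓘(ℝ, E') ∞ P] in
theorem invariant_of_concur (hp : MDifferentiable 𝓘(ℝ, E) 𝓘(ℝ, E') p)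
    {L₁ R₁ L₂ R₂ : Family E M} (hL₁ : IsDirac L₁) (hR₁ : IsDirac R₁) (hL₂ : IsDirac L₂)
    (hR₂ : IsDirac R₂) (h₁ : WeaklyConcur L₁ R₁) (h₂ : WeaklyConcur L₂ R₂)
    (hV : ∀ x f, f ∈ vertical E E' p x ↔ ∃ f₁ f₂, f₁ + f₂ = f ∧ f₁ ∈ kernel (magri L₁ R₁) x ∧
      f₂ ∈ kernel (magri L₂ R₂) x) {L : Family E M} (hLL₁ : L = L₁ ∨ L = R₁)
    (hLL₂ : L = L₂ ∨ L = R₂) : Invariant E' p L := by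
  intro φ ψ π had e he
  obtain ⟨V₁, hV₁, oV₁, eV₁, c₁⟩ :=
    hL₁.exists_concurOn had.left_mem hR₁ h₁ φ.open_target subset_rfl he
  obtain ⟨V₂, hV₂, oV₂, eV₂, c₂⟩ :=
    hL₂.exists_concurOn had.left_mem hR₂ h₂ oV₁ hV₁ eV₁
  refine ⟨V₂, hV₂.trans hV₁, oV₂, eV₂, ?_, ?_⟩
  · rcases hLL₂ with rfl | rfl
    · exact c₂.eqs_left
    · exact c₂.eqs_right
  · refine invariantOn_of_concurOn (c₁.mono hV₂) c₂ (fun e' he' f => ?_)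
      (hLL₁.imp (congrArg _) (congrArg _)) (hLL₂.imp (congrArg _) (congrArg _))
    obtain ⟨y, hy, rfl⟩ : ∃ y ∈ φ.source, φ y = e' :=
      ⟨φ.symm e', φ.map_target (hV₁ (hV₂ he')), φ.right_inv (hV₁ (hV₂ he'))⟩
    have hm : ∀ (A B : Family E M) (g : E), InMagri (localFam φ A (φ y)) (localFam φ B (φ y)) g ↔
        (bwd φ (φ y) g : TangentSpace 𝓘(ℝ, E) y) ∈ kernel (magri A B) y := by
      intro A B g
      rw [localFam_apply hy, localFam_apply hy,
        inMagri_map (bwd_comp_fwd had.left_mem hy) (fwd_comp_bwd had.left_mem hy)]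
      exact (mem_kernel_magri A B y _).symm
    have hk : f ∈ LinearMap.ker π.toLinearMap ↔
        (bwd φ (φ y) f : TangentSpace 𝓘(ℝ, E) y) ∈ vertical E E' p y := by
      rw [← had.map_vertical hp hy]
      constructor
      · rintro ⟨u, hu, rfl⟩
        have hb := bwd_fwd had.left_mem hy u
        exact (show (bwd φ (φ y) (fwd φ y u)) ∈ tfib (vertical E E' p) y from hb.symm ▸ hu)
      · exact fun h => ⟨_, h, fwd_bwd had.left_mem hy f⟩
    refine (hk.trans (hV y _)).trans ?_
    simp only [hm]
    constructor
    · rintro ⟨f₁, f₂, hf, h1, h2⟩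
      refine ⟨fwd φ y f₁, fwd φ y f₂, ?_, ?_, ?_⟩
      · have := congrArg (fwd φ y) hf
        exact ((map_add (fwd φ y) f₁ f₂).symm.trans this).trans (fwd_bwd had.left_mem hy f)
      · exact (bwd_fwd had.left_mem hy f₁).symm ▸ h1
      · exact (bwd_fwd had.left_mem hy f₂).symm ▸ h2
    · rintro ⟨f₁, f₂, rfl, h1, h2⟩
      exact ⟨_, _, (map_add (bwd φ (φ y)) f₁ f₂).symm, h1, h2⟩

theorem PushesTo.isInvolutive (hp : IsSurjectiveSubmersion E E' p) {L : Family E M}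
    {L' : Family E' P} (hL : IsDirac L) (h : PushesTo p L L') (hlag : IsLagrangian L')
    (hsub : IsSubbundle L') : IsInvolutive L' := by
  have hpd : MDifferentiable 𝓘(ℝ, E) 𝓘(ℝ, E') p := hp.1.contMDiff.mdifferentiable (by simp)
  refine isInvolutive_of_courantZero
    (fun x a ha => ((isLagrangian_iff L').1 hlag x a).2 ha) fun z => ?_
  obtain ⟨x, rfl⟩ := hp.2 z
  obtain ⟨φ, ψ, π, hx, had⟩ := exists_adapted hp.1 x
  refine ⟨ψ, had.right_mem, had.mem_source x hx, fun c₀ hc₀ => ?_⟩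
  have hψx := ψ.map_source (had.mem_source x hx)
  obtain ⟨W, hW, hxW, c, hc, hcL, hcx⟩ :=
    (hsub.hasFrameAt had.right_mem hψx).exists_section hc₀
  obtain ⟨V, hVt, oV, xV, heqs⟩ :=
    hL.exists_hasSmoothEqs had.left_mem φ.open_target subset_rfl (φ.map_source hx)
  have hz : CourantZero (fun e => (localFam ψ L' e : Set (Pontryagin E'))) (π '' V) := by
    refine CourantZero.push ((hL.involutive.courantZero had.left_mem fun x a ha b hb =>
      hL.lagrangian.pairing_eq_zero ha hb).mono hVt) oV fun V' W b hV' hm hb hbL => ?_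
    refine (heqs.mono hV').liftsOn_push had.surjective hm hb fun e he => ?_
    rw [← h.localFam_eq had hpd (hVt (hV' he))]
    exact hbL _ (hm he)
  have oπ : IsOpen (π '' V) := π.isOpenMap had.surjective V oV
  refine ⟨ψ.target ∩ (W ∩ π '' V), Set.inter_subset_left, ψ.open_target.inter (hW.inter oπ),
    ⟨hψx, hxW, φ x, xV, (had.eq x hx).symm⟩,
    hz.mono fun e he => he.2.2, c, hc.mono fun e he => he.2.1, fun e he => hcL e he.2.1, hcx⟩

/-- The trivial kernel of L' is used twice: it makes L' ⊛ R' contain its orthogonal, and it provides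
the smooth sections through arbitrary elements needed to test involutivity. -/
theorem PushesTo.weaklyConcur (hp : IsSurjectiveSubmersion E E' p) {L R : Family E M}
    {L' R' : Family E' P} (hL : IsDirac L) (hR : IsDirac R) (hLR : WeaklyConcur L R)
    (h : PushesTo p L L') (h' : PushesTo p R R') (hlag : IsLagrangian L')
    (hsub : IsSubbundle L') (hlag' : IsLagrangian R') (hsub' : IsSubbundle R')
    (hker : ∀ z, kernel L' z = ⊥) : WeaklyConcur L' R' := by
  have hpd : MDifferentiable 𝓘(ℝ, E) 𝓘(ℝ, E') p := hp.1.contMDiff.mdifferentiable (by simp)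
  have hker' : ∀ z, ∀ u : E', (u, 0) ∈ fib L' z → u = 0 := fun z u hu => by
    have : (u : TangentSpace 𝓘(ℝ, E') z) ∈ kernel L' z := hu
    rw [hker z] at this
    exact this
  refine isInvolutive_of_courantZero (fun z a ha => ?_) fun z => ?_
  · exact ((isLagrangian_iff L').1 hlag z).mem_cotProd ((isLagrangian_iff R').1 hlag' z)
      (hker' z) ha
  obtain ⟨x, rfl⟩ := hp.2 z
  obtain ⟨φ, ψ, π, hx, had⟩ := exists_adapted hp.1 x
  refine ⟨ψ, had.right_mem, had.mem_source x hx, fun c₀ hc₀ => ?_⟩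
  have hψx := ψ.map_source (had.mem_source x hx)
  rw [← SetLike.mem_coe, ← cotProd_localFam had.right_mem L' R' hψx] at hc₀
  obtain ⟨u, v, ξ, hu, hv, rfl⟩ := hc₀
  obtain ⟨W, hW, hxW, c, hc, hcL, hcx⟩ :=
    (hsub'.hasFrameAt had.right_mem hψx).exists_section hv
  obtain ⟨W', hW't, hW', hxW', B, hB, hBL⟩ :=
    (hsub.hasFrameAt had.right_mem hψx).exists_bivector ψ.open_target hψx
      (fun e he => hlag.isLag_localFam had.right_mem he) (fun e he w hw => by
        obtain ⟨y, hy, rfl⟩ : ∃ y ∈ ψ.source, ψ y = e :=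
          ⟨ψ.symm e, ψ.map_target he, ψ.right_inv he⟩
        have h1 := (mem_localFam had.right_mem hy).1 hw
        have h2 : bwd ψ (ψ y) w = 0 := hker' y _ (by simpa [conj] using h1)
        rw [← fwd_bwd had.right_mem hy w, h2, map_zero])
  obtain ⟨V, hVt, oV, xV, con⟩ :=
    hL.exists_concurOn had.left_mem hR hLR φ.open_target subset_rfl (φ.map_source hx)
  have hz : CourantZero (fun e => cotProd (localFam ψ L' e) (localFam ψ R' e)) (π '' V) := by
    refine CourantZero.push con.courant_prod oV fun V' W b hV' hm hb hbL => ?_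
    refine (con.eqs_left.mono hV').liftsOn_cotProd (con.eqs_right.mono hV') had.surjective hm hb
      fun e he => ?_
    rw [← h.localFam_eq had hpd (hVt (hV' he)), ← h'.localFam_eq had hpd (hVt (hV' he))]
    exact hbL _ (hm he)
  have oπ : IsOpen (π '' V) := π.isOpenMap had.surjective V oV
  have hcp : ∀ e ∈ ψ.target, cotProd (localFam ψ L' e) (localFam ψ R' e)
      = (localFam ψ (cotangentProd L' R') e : Set (Pontryagin E')) := fun e he =>
    cotProd_localFam had.right_mem L' R' he
  -- To extend u + v + ξ, extend v + ξ to a section c of R' and add to its vector the value of the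
  -- bivector `B` of L' on its covector.
  refine ⟨W' ∩ (W ∩ π '' V), fun e he => hW't he.1, hW'.inter (hW.inter oπ),
    ⟨hxW', hxW, φ x, xV, (had.eq x hx).symm⟩, ?_, fun e => (B e (c e).2 + (c e).1, (c e).2), ?_,
    fun e he => ?_, ?_⟩
  · intro W₁ hW₁ oW₁ a₁ a₂ a₃ h₁ h₂ h₃ m₁ m₂ m₃
    have hs : ∀ e ∈ W₁, e ∈ ψ.target := fun e he => hW't (hW₁ he).1
    exact hz W₁ (fun e he => (hW₁ he).2.2) oW₁ a₁ a₂ a₃ h₁ h₂ h₃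
      (fun e he => (hcp e (hs e he)).ge (m₁ e he)) (fun e he => (hcp e (hs e he)).ge (m₂ e he))
      (fun e he => (hcp e (hs e he)).ge (m₃ e he))
  · have hc' := hc.mono (show W' ∩ (W ∩ π '' V) ⊆ W from fun e he => he.2.1)
    exact (((hB.mono fun e he => he.1).clm_apply hc'.snd).add hc'.fst).prodMk hc'.snd
  · refine (hcp e (hW't he.1)).le ⟨B e (c e).2, (c e).1, (c e).2, ?_, hcL e he.2.1, rfl⟩
    rw [hBL e he.1]
  · have h1 := (hBL _ hxW' (u, ξ)).1 hu
    simp only [hcx]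
    exact Prod.ext (congrArg (· + v) h1.symm) rfl

end Descent

/-! ### The Jacobi identity on a vector space -/

section LocalPoisson

variable {E : Type*} [NormedAddCommGroup E] [NormedSpace ℝ E]

/-- The bracket of functions on the model space defined by a bivector field. -/
def localBracket (B : E → (E →L[ℝ] ℝ) →L[ℝ] E) (F G : E → ℝ) (e : E) : ℝ :=
  fderiv ℝ G e (B e (fderiv ℝ F e))

variable {B : E → (E →L[ℝ] ℝ) →L[ℝ] E} {V : Set E}

theorem contDiffOn_hamiltonian (hV : IsOpen V) (hB : ContDiffOn ℝ ∞ B V) {F : E → ℝ}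
    (hF : ContDiffOn ℝ ∞ F V) : ContDiffOn ℝ ∞ (fun e => B e (fderiv ℝ F e)) V :=
  hB.clm_apply (hF.fderiv_of_isOpen hV (by simp))

theorem contDiffOn_localBracket (hV : IsOpen V) (hB : ContDiffOn ℝ ∞ B V) {F G : E → ℝ}
    (hF : ContDiffOn ℝ ∞ F V) (hG : ContDiffOn ℝ ∞ G V) :
    ContDiffOn ℝ ∞ (localBracket B F G) V :=
  (hG.fderiv_of_isOpen hV (by simp)).clm_apply (contDiffOn_hamiltonian hV hB hF)

/-- The Jacobi identity expresses the vanishing of the Courant tensor on the graph. -/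
theorem localBracket_jacobi (hV : IsOpen V) (hB : ContDiffOn ℝ ∞ B V)
    (hskew : ∀ e ∈ V, ∀ ξ η : E →L[ℝ] ℝ, η (B e ξ) = -ξ (B e η))
    (hC : CourantZero (fun e => {a | a.1 = B e a.2}) V) {F G H : E → ℝ}
    (hF : ContDiffOn ℝ ∞ F V) (hG : ContDiffOn ℝ ∞ G V) (hH : ContDiffOn ℝ ∞ H V) {e : E}
    (he : e ∈ V) :
    localBracket B F (localBracket B G H) e + localBracket B G (localBracket B H F) e
      + localBracket B H (localBracket B F G) e = 0 := by
  have dX : ∀ {K : E → ℝ}, ContDiffOn ℝ ∞ K V →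
      DifferentiableAt ℝ (fun e => B e (fderiv ℝ K e)) e := fun hK =>
    ((contDiffOn_hamiltonian hV hB hK).contDiffAt (hV.mem_nhds he)).differentiableAt (by simp)
  have d2 : ∀ {K : E → ℝ}, ContDiffOn ℝ ∞ K V → DifferentiableAt ℝ (fderiv ℝ K) e := fun hK =>
    ((hK.fderiv_of_isOpen hV (m := ∞) (by simp)).contDiffAt
      (hV.mem_nhds he)).differentiableAt (by simp)
  have symm : ∀ {K : E → ℝ}, ContDiffOn ℝ ∞ K V → ∀ v w,
      fderiv ℝ (fderiv ℝ K) e v w = fderiv ℝ (fderiv ℝ K) e w v := fun hK v w =>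
    (((hK.contDiffAt (hV.mem_nhds he)).of_le (m := 2) (by norm_cast)).isSymmSndFDerivAt
      (by simp)) v w
  have hder : ∀ {K K' : E → ℝ}, ContDiffOn ℝ ∞ K V → ContDiffOn ℝ ∞ K' V → ∀ v,
      fderiv ℝ (localBracket B K K') e v = fderiv ℝ (fderiv ℝ K') e v (B e (fderiv ℝ K e))
        + fderiv ℝ K' e (fderiv ℝ (fun e => B e (fderiv ℝ K e)) e v) := by
    intro K K' hK hK' v
    have := fderiv_clm_apply (d2 hK') (dX hK)
    have h2 := DFunLike.congr_fun this v
    refine h2.trans ?_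
    simp [add_comm]
  -- With this sign change the three double brackets expand into the Courant tensor of the
  -- Hamiltonian sections of F, G, H plus second derivatives that cancel in pairs.
  have hsw : localBracket B H F =ᶠ[𝓝 e] fun e => -localBracket B F H e := by
    filter_upwards [hV.mem_nhds he] with e' he'
    exact hskew e' he' _ _
  have h0 := hC V subset_rfl hV (fun e => (B e (fderiv ℝ F e), fderiv ℝ F e))
    (fun e => (B e (fderiv ℝ G e), fderiv ℝ G e)) (fun e => (B e (fderiv ℝ H e), fderiv ℝ H e))
    ((contDiffOn_hamiltonian hV hB hF).prodMk (hF.fderiv_of_isOpen hV (by simp)))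
    ((contDiffOn_hamiltonian hV hB hG).prodMk (hG.fderiv_of_isOpen hV (by simp)))
    ((contDiffOn_hamiltonian hV hB hH).prodMk (hH.fderiv_of_isOpen hV (by simp)))
    (fun _ _ => rfl) (fun _ _ => rfl) (fun _ _ => rfl) e he
  rw [courant_mk (dX hF) (dX hG) (d2 hF) (d2 hG)] at h0
  have e1 : localBracket B F (localBracket B G H) e
      = fderiv ℝ (localBracket B G H) e (B e (fderiv ℝ F e)) := rfl
  have e2 : localBracket B G (localBracket B H F) e
      = fderiv ℝ (localBracket B H F) e (B e (fderiv ℝ G e)) := rfl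
  have e3 : localBracket B H (localBracket B F G) e
      = fderiv ℝ (localBracket B F G) e (B e (fderiv ℝ H e)) := rfl
  have e4 : fderiv ℝ (fun e => -localBracket B F H e) e (B e (fderiv ℝ G e))
      = -fderiv ℝ (localBracket B F H) e (B e (fderiv ℝ G e)) := by
    rw [fderiv_fun_neg]
    rfl
  rw [e1, e2, e3, hsw.fderiv_eq, e4, hder hG hH, hder hF hH, hder hF hG]
  have s1 := symm hH (B e (fderiv ℝ F e)) (B e (fderiv ℝ G e))
  have s2 := symm hG (B e (fderiv ℝ F e)) (B e (fderiv ℝ H e))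
  have s3 := symm hF (B e (fderiv ℝ G e)) (B e (fderiv ℝ H e))
  linarith

theorem IsLag.exists_linearMap [FiniteDimensional ℝ E] {Λ : Submodule ℝ (Pontryagin E)}
    (hΛ : IsLag Λ) (hker : ∀ u, (u, 0) ∈ Λ → u = 0) :
    ∃ B : (E →L[ℝ] ℝ) →ₗ[ℝ] E, ∀ a : Pontryagin E, a ∈ Λ ↔ a.1 = B a.2 := by
  have hex : ∀ ξ, ∃ u, (u, ξ) ∈ Λ := fun ξ =>
    exists_mem_of_annihilates hΛ fun k hk => by rw [hker k hk, map_zero]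
  choose B hB using hex
  have huniq : ∀ {u v ξ}, (u, ξ) ∈ Λ → (v, ξ) ∈ Λ → u = v := fun hu hv =>
    sub_eq_zero.1 (hker _ (by simpa using Λ.sub_mem hu hv))
  refine ⟨⟨⟨B, fun ξ η => huniq (hB _) (Λ.add_mem (hB ξ) (hB η))⟩,
    fun r ξ => huniq (hB _) (Λ.smul_mem r (hB ξ))⟩, fun a => ⟨fun ha => huniq ha (hB _), ?_⟩⟩
  rintro (ha : a.1 = B a.2)
  have := hB a.2
  rwa [← ha] at this

end LocalPoisson

/-! ### Dirac structures with trivial kernel are Poisson -/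

section Poisson

variable {E : Type*} [NormedAddCommGroup E] [NormedSpace ℝ E] [FiniteDimensional ℝ E]
  {M : Type*} [TopologicalSpace M] [ChartedSpace E M] [IsManifold 𝓘(ℝ, E) ∞ M] [T2Space M]

/-- A Dirac structure with trivial kernel is Poisson. -/
theorem IsDirac.isPoisson {L : Family E M} (hL : IsDirac L) (hker : ∀ x, kernel L x = ⊥) :
    IsPoisson L := by
  have hker' : ∀ x, ∀ u : E, (u, 0) ∈ fib L x → u = 0 := fun x u hu => by
    have : (u : TangentSpace 𝓘(ℝ, E) x) ∈ kernel L x := hu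
    rw [hker x] at this
    exact this
  choose β hβ using fun x => ((isLagrangian_iff L).1 hL.lagrangian x).exists_linearMap (hker' x)
  let π : BivectorMap E M := β
  have hπ : ∀ (x : M) (a : GenTangent E x), a ∈ L x ↔ a.1 = π x a.2 := hβ
  have hskew : ∀ (x : M) (ξ η : Cotangent E x), η (π x ξ) = -ξ (π x η) := by
    intro x ξ η
    have h1 := hL.lagrangian.pairing_eq_zero ((hπ x (π x ξ, ξ)).2 rfl) ((hπ x (π x η, η)).2 rfl)
    exact eq_neg_of_add_eq_zero_left h1
  -- the bivector field in a chart
  have hloc : ∀ x : M, ∃ V ⊆ (chartAt E x).target, IsOpen V ∧ chartAt E x x ∈ V ∧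
      ∃ B : E → (E →L[ℝ] ℝ) →L[ℝ] E, ContDiffOn ℝ ∞ B V ∧
        (∀ e ∈ V, ∀ a, a ∈ localFam (chartAt E x) L e ↔ a.1 = B e a.2) ∧
        ∀ y ∈ (chartAt E x).source, chartAt E x y ∈ V → ∀ η : E →L[ℝ] ℝ,
          (β y (η.comp (fwd (chartAt E x) y)) : E) =
            bwd (chartAt E x) (chartAt E x y) (B (chartAt E x y) η) := by
    intro x
    have hφ := chartAt_mem_maximalAtlas (E := E) x
    have hx := mem_chart_source E x
    obtain ⟨V, hVt, hV, hxV, B, hB, hBL⟩ :=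
      (hL.subbundle.hasFrameAt hφ ((chartAt E x).map_source hx)).exists_bivector
        (chartAt E x).open_target ((chartAt E x).map_source hx)
        (fun e he => hL.lagrangian.isLag_localFam hφ he) (fun e he w hw => by
          obtain ⟨y, hy, rfl⟩ : ∃ y ∈ (chartAt E x).source, chartAt E x y = e :=
            ⟨(chartAt E x).symm e, (chartAt E x).map_target he, (chartAt E x).right_inv he⟩
          have h1 := (mem_localFam hφ hy).1 hw
          have h2 : bwd (chartAt E x) (chartAt E x y) w = 0 := hker' y _ (by simpa [conj] using h1)
          rw [← fwd_bwd hφ hy w, h2, map_zero])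
    refine ⟨V, hVt, hV, hxV, B, hB, hBL, fun y hy hyV η => ?_⟩
    have h1 := (hBL _ hyV (B (chartAt E x y) η, η)).2 rfl
    exact ((hβ y _).1 ((mem_localFam hφ hy).1 h1)).symm
  refine ⟨π, ⟨hskew, ?_, ?_⟩, hπ⟩
  · intro ξ hξ x _
    obtain ⟨V, hVt, hV, hxV, B, hB, -, hβB⟩ := hloc x
    have hφ := chartAt_mem_maximalAtlas (E := E) x
    have hx := mem_chart_source E x
    have h1 := contDiffAt_chart_oneForm hφ hx isOpen_univ (Set.mem_univ x) hξ
    have h2 := contMDiffAt_ofChart_vectorField hφ hx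
      ((hB.contDiffAt (hV.mem_nhds hxV)).clm_apply h1)
    refine (h2.congr_of_eventuallyEq ?_).contMDiffWithinAt
    filter_upwards [(chartAt E x).open_source.mem_nhds hx,
      ((chartAt E x).continuousAt hx).eventually (hV.mem_nhds hxV)] with y hy hyV
    refine congrArg (Bundle.TotalSpace.mk y) (Eq.trans ?_ (hβB y hy hyV _))
    -- Non-dependent copies allow the base point to be rewritten, since the chart followed by its
    -- inverse is the identity at y only propositionally.
    let ξ' : M → E →L[ℝ] ℝ := ξ
    let β' : M → (E →L[ℝ] ℝ) →ₗ[ℝ] E := β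
    have key : ∀ z, z = y → β' y (ξ' y) = β' y (((ξ' z).comp
        (bwd (chartAt E x) (chartAt E x y))).comp (fwd (chartAt E x) y)) := by
      rintro z rfl
      refine congrArg _ (ContinuousLinearMap.ext fun w => ?_)
      exact (congrArg (ξ' z) (bwd_fwd hφ hy w)).symm
    exact key _ ((chartAt E x).left_inv hy)
  · intro f g h hf hg hh x
    obtain ⟨V, hVt, hV, hxV, B, hB, hBL, hβB⟩ := hloc x
    have hφ := chartAt_mem_maximalAtlas (E := E) x
    have hx := mem_chart_source E x
    have hO : IsOpen ((chartAt E x).source ∩ chartAt E x ⁻¹' V) :=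
      (chartAt E x).isOpen_inter_preimage hV
    have hrep : ∀ (f : M → ℝ) (F : E → ℝ), ContDiffOn ℝ ∞ F V →
        (∀ y ∈ (chartAt E x).source ∩ chartAt E x ⁻¹' V, f y = F (chartAt E x y)) →
        ∀ y ∈ (chartAt E x).source ∩ chartAt E x ⁻¹' V,
          mvfderiv 𝓘(ℝ, E) f y = (fderiv ℝ F (chartAt E x y)).comp (fwd (chartAt E x) y) := by
      intro f F hF hfF y hy
      have h1 : f =ᶠ[𝓝 y] fun y => F (chartAt E x y) := by
        filter_upwards [hO.mem_nhds hy] with z hz using hfF z hz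
      have h2 := h1.mfderiv_eq (I := 𝓘(ℝ, E)) (I' := 𝓘(ℝ, ℝ))
      refine ContinuousLinearMap.ext fun w => ?_
      exact (DFunLike.congr_fun h2 w).trans (mvfderiv_comp_chart hφ hy.1
        ((hF.contDiffAt (hV.mem_nhds hy.2)).differentiableAt (by simp)) w)
    have hbr : ∀ (f g : M → ℝ) (F G : E → ℝ), ContDiffOn ℝ ∞ F V → ContDiffOn ℝ ∞ G V →
        (∀ y ∈ (chartAt E x).source ∩ chartAt E x ⁻¹' V, f y = F (chartAt E x y)) →
        (∀ y ∈ (chartAt E x).source ∩ chartAt E x ⁻¹' V, g y = G (chartAt E x y)) →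
        ∀ y ∈ (chartAt E x).source ∩ chartAt E x ⁻¹' V,
          poissonBracket π f g y = localBracket B F G (chartAt E x y) := by
      intro f g F G hF hG hfF hgG y hy
      unfold poissonBracket localBracket
      have h1 := hrep f F hF hfF y hy
      have h2 := hrep g G hG hgG y hy
      have h3 : (π y (mvfderiv 𝓘(ℝ, E) f y) : E) = bwd (chartAt E x) (chartAt E x y)
          (B (chartAt E x y) (fderiv ℝ F (chartAt E x y))) :=
        (congrArg (β y) h1).trans (hβB y hy.1 hy.2 _)
      refine (DFunLike.congr_fun h2 _).trans ?_
      refine congrArg (fderiv ℝ G (chartAt E x y)) ?_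
      exact (congrArg (fwd (chartAt E x) y) h3).trans (fwd_bwd hφ hy.1 _)
    have hsm : ∀ f : M → ℝ, ContMDiff 𝓘(ℝ, E) 𝓘(ℝ, ℝ) ∞ f →
        ContDiffOn ℝ ∞ (fun e => f ((chartAt E x).symm e)) V := by
      intro f hf e he
      have h1 := contDiffAt_comp_chart_symm hφ ((chartAt E x).map_target (hVt he)) (hf _)
      rw [(chartAt E x).right_inv (hVt he)] at h1
      exact h1.contDiffWithinAt
    have hself : ∀ f : M → ℝ, ∀ y ∈ (chartAt E x).source ∩ chartAt E x ⁻¹' V,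
        f y = (fun e => f ((chartAt E x).symm e)) (chartAt E x y) := fun f y hy => by
      simp only [(chartAt E x).left_inv hy.1]
    have hsk : ∀ e ∈ V, ∀ ξ η : E →L[ℝ] ℝ, η (B e ξ) = -ξ (B e η) := by
      intro e he ξ η
      have h1 := (hL.lagrangian.isLag_localFam hφ (hVt he) _).1
        ((hBL e he (B e ξ, ξ)).2 rfl) _ ((hBL e he (B e η, η)).2 rfl)
      exact eq_neg_of_add_eq_zero_left h1
    have hC : CourantZero (fun e => {a | a.1 = B e a.2}) V := by
      have h1 := (hL.involutive.courantZero hφ fun x a ha b hb =>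
        hL.lagrangian.pairing_eq_zero ha hb).mono hVt
      intro W hW oW a b c ca cb cc ha hb hc
      exact h1 W hW oW a b c ca cb cc (fun e he => (hBL e (hW he) _).2 (ha e he))
        (fun e he => (hBL e (hW he) _).2 (hb e he)) (fun e he => (hBL e (hW he) _).2 (hc e he))
    have cf := hsm f hf
    have cg := hsm g hg
    have ch := hsm h hh
    have hxO : x ∈ (chartAt E x).source ∩ chartAt E x ⁻¹' V := ⟨hx, hxV⟩
    rw [hbr f _ _ _ cf (contDiffOn_localBracket hV hB cg ch) (hself f)
        (hbr g h _ _ cg ch (hself g) (hself h)) x hxO,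
      hbr g _ _ _ cg (contDiffOn_localBracket hV hB ch cf) (hself g)
        (hbr h f _ _ ch cf (hself h) (hself f)) x hxO,
      hbr h _ _ _ ch (contDiffOn_localBracket hV hB cf cg) (hself h)
        (hbr f g _ _ cf cg (hself f) (hself g)) x hxO]
    exact localBracket_jacobi hV hB hsk hC cf cg ch hxV

end Poisson

/-! ### Kernels, compositions and the diamond -/

section Diamond

variable {E : Type*} [NormedAddCommGroup E] [NormedSpace ℝ E]
  {M : Type*} [TopologicalSpace M] [ChartedSpace E M]
  {E' : Type*} [NormedAddCommGroup E'] [NormedSpace ℝ E']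
  {P : Type*} [TopologicalSpace P] [ChartedSpace E' P] {p : M → P}

theorem kernel_le_kernel_magri (L R : Family E M) (x : M) :
    kernel L x ≤ kernel (magri L R) x := fun u hu =>
  (mem_kernel_magri L R x u).2 ⟨0, 0, hu, (L x).zero_mem, by
    have h : (((-0 : E), 0) : Pontryagin E) = 0 := by simp
    rw [h]
    exact (fib R x).zero_mem⟩

/-- A kernel vector downstairs lifts to an element of L whose covector is pulled back from zero,
hence to a vector of K(L), which is vertical. -/
theorem PushesTo.kernel_eq_bot (hp : Function.Surjective p) {L : Family E M} {L' : Family E' P}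
    (h : PushesTo p L L') (hker : ∀ x, kernel L x ≤ vertical E E' p x) (z : P) :
    kernel L' z = ⊥ := by
  obtain ⟨x, rfl⟩ := hp z
  refine (Submodule.eq_bot_iff _).2 fun v hv => ?_
  obtain ⟨⟨u, ξ⟩, ha, hu, hξ⟩ := (h x).le hv
  have hξ' : ξ = 0 := hξ.trans (ContinuousLinearMap.zero_comp _)
  subst hξ'
  have h1 : dmap E E' p x u = 0 := hker x ha
  exact hu.symm.trans h1

/-- Forward images along a composition can be computed in two steps. -/
theorem PushesTo.isForward_of_comp {E'' : Type*} [NormedAddCommGroup E''] [NormedSpace ℝ E'']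
    {Q : Type*} [TopologicalSpace Q] [ChartedSpace E'' Q] {q : P → Q}
    (hp : Function.Surjective p) (hpd : MDifferentiable 𝓘(ℝ, E) 𝓘(ℝ, E') p)
    (hqd : MDifferentiable 𝓘(ℝ, E') 𝓘(ℝ, E'') q) {L : Family E M} {L' : Family E' P}
    {L'' : Family E'' Q} (h : PushesTo p L L') (h' : PushesTo (q ∘ p) L L'') :
    IsForward q L' L'' := by
  intro y b hb
  obtain ⟨x, rfl⟩ := hp y
  have hD : dmap E E'' (q ∘ p) x = (dmap E' E'' q (p x)).comp (dmap E E' p x) :=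
    mfderiv_comp x (hqd _) (hpd x)
  obtain ⟨a, ha, h1, h2⟩ := (h' x).le hb
  rw [hD] at h1 h2
  exact ⟨(dmap E E' p x a.1, b.2.comp (dmap E' E'' q (p x))),
    (h x).ge ⟨a, ha, rfl, h2⟩, h1, rfl⟩

/-- The kernel of (q ∘ p)_* is the preimage of p_*(E_x), and ker p_* = K(A) already lies in E = K(A)
+ K(B), so it is E itself. -/
theorem mem_vertical_comp {E'' : Type*} [NormedAddCommGroup E''] [NormedSpace ℝ E'']
    {Q : Type*} [TopologicalSpace Q] [ChartedSpace E'' Q] {q : P → Q}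
    (hpd : MDifferentiable 𝓘(ℝ, E) 𝓘(ℝ, E') p)
    (hqd : MDifferentiable 𝓘(ℝ, E') 𝓘(ℝ, E'') q) {A B : Family E M}
    (hA : vertical E E' p = kernel A)
    (hq : ∀ x, vertical E' E'' q (p x) = imageAt E' p (kernel (cotangentProd A B)) x) (x : M)
    (f : TangentSpace 𝓘(ℝ, E) x) : f ∈ vertical E E'' (q ∘ p) x ↔
      ∃ f₁ f₂, f₁ + f₂ = f ∧ f₁ ∈ kernel A x ∧ f₂ ∈ kernel B x := by
  have hD : dmap E E'' (q ∘ p) x = (dmap E' E'' q (p x)).comp (dmap E E' p x) :=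
    mfderiv_comp x (hqd _) (hpd x)
  have h1 : f ∈ vertical E E'' (q ∘ p) x ↔
      (dmap E E' p x f : TangentSpace 𝓘(ℝ, E') (p x)) ∈ vertical E' E'' q (p x) :=
    Iff.of_eq (congrArg (fun D : E →L[ℝ] E'' => D f = 0) hD)
  rw [h1, hq, ← mem_kernel_cotangentProd]
  constructor
  · rintro ⟨g, hg, hgf⟩
    have hfg : f - g ∈ kernel A x := by
      rw [← hA]
      exact (map_sub (dmap E E' p x) f g).trans (sub_eq_zero.2 hgf.symm)
    have h2 : f - g ∈ kernel (cotangentProd A B) x :=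
      (mem_kernel_cotangentProd A B x _).2 ⟨f - g, 0, add_zero _, hfg, (kernel B x).zero_mem⟩
    exact sub_add_cancel f g ▸ (kernel (cotangentProd A B) x).add_mem h2 hg
  · exact fun hf => ⟨f, hf, rfl⟩

variable [FiniteDimensional ℝ E] [IsManifold 𝓘(ℝ, E) ∞ M] [T2Space M]
  [FiniteDimensional ℝ E'] [IsManifold 𝓘(ℝ, E') ∞ P]

/-- Reduction of a Dirac structure which is invariant along the fibres of `p`. -/
theorem IsDirac.exists_pushesTo (hp : IsSurjectiveSubmersion E E' p)
    (hfib : HasConnectedFibres p) {L : Family E M} (hL : IsDirac L) (hinv : Invariant E' p L)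
    (hcl : IsSubbundle (closestLagrangian L (ofTangent (vertical E E' p)))) :
    ∃ L' : Family E' P, PushesTo p L L' ∧ IsDirac L' := by
  obtain ⟨L', h, hlag, hsub⟩ := DiracReduction.exists_pushesTo hp hfib hL.lagrangian hinv hcl
  exact ⟨L', h, hlag, hsub, h.isInvolutive hp hL hlag hsub⟩

omit [FiniteDimensional ℝ E'] [IsManifold 𝓘(ℝ, E') ∞ P] in
theorem invariant_of_vertical_eq (hp : IsSurjectiveSubmersion E E' p) {L R : Family E M}
    (hL : IsDirac L) (hR : IsDirac R) (hLR : WeaklyConcur L R)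
    (hV : vertical E E' p = kernel (magri L R)) : Invariant E' p L ∧ Invariant E' p R := by
  have hpd : MDifferentiable 𝓘(ℝ, E) 𝓘(ℝ, E') p := hp.1.contMDiff.mdifferentiable (by simp)
  have hV' : ∀ x f, f ∈ vertical E E' p x ↔ ∃ f₁ f₂, f₁ + f₂ = f ∧
      f₁ ∈ kernel (magri L R) x ∧ f₂ ∈ kernel (magri L R) x := fun x f => by
    rw [hV]
    constructor
    · exact fun hf => ⟨f, 0, add_zero f, hf, (kernel (magri L R) x).zero_mem⟩
    · rintro ⟨f₁, f₂, rfl, h1, h2⟩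
      exact (kernel (magri L R) x).add_mem h1 h2
  exact ⟨invariant_of_concur hpd hL hR hL hR hLR hLR hV' (.inl rfl) (.inl rfl),
    invariant_of_concur hpd hL hR hL hR hLR hLR hV' (.inr rfl) (.inr rfl)⟩

end Diamond

end DiracReduction

end

/-! ### The Magri diamond -/

theorem mainTheorem6
    {E EL ER EB : Type*}
    [NormedAddCommGroup E] [NormedSpace ℝ E] [FiniteDimensional ℝ E]
    [NormedAddCommGroup EL] [NormedSpace ℝ EL] [FiniteDimensional ℝ EL]
    [NormedAddCommGroup ER] [NormedSpace ℝ ER] [FiniteDimensional ℝ ER]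
    [NormedAddCommGroup EB] [NormedSpace ℝ EB] [FiniteDimensional ℝ EB]
    {M ML MR MB : Type*}
    [TopologicalSpace M] [T2Space M] [SecondCountableTopology M]
    [ChartedSpace E M] [IsManifold 𝓘(ℝ, E) ∞ M]
    [TopologicalSpace ML] [T2Space ML] [SecondCountableTopology ML]
    [ChartedSpace EL ML] [IsManifold 𝓘(ℝ, EL) ∞ ML]
    [TopologicalSpace MR] [T2Space MR] [SecondCountableTopology MR]
    [ChartedSpace ER MR] [IsManifold 𝓘(ℝ, ER) ∞ MR]
    [TopologicalSpace MB] [T2Space MB] [SecondCountableTopology MB]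
    [ChartedSpace EB MB] [IsManifold 𝓘(ℝ, EB) ∞ MB]
    -- weakly concurring Dirac structures
    (L R : Family E M) (hL : IsDirac L) (hR : IsDirac R) (hLR : WeaklyConcur L R)
    -- the diamond
    (pL : M → ML) (pR : M → MR) (r : M → MB) (qR : ML → MB) (qL : MR → MB)
    (hpL : IsSurjectiveSubmersion E EL pL) (hpR : IsSurjectiveSubmersion E ER pR)
    (hr : IsSurjectiveSubmersion E EB r)
    (hqR : IsSurjectiveSubmersion EL EB qR) (hqL : IsSurjectiveSubmersion ER EB qL)
    (hcommL : qR ∘ pL = r) (hcommR : qL ∘ pR = r)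
    (hfibL : HasConnectedFibres pL) (hfibR : HasConnectedFibres pR)
    (hfib : HasConnectedFibres r)
    -- the vertical bundles
    (hkerL : vertical E EL pL = kernel (magri L R))
    (hkerR : vertical E ER pR = kernel (magri R L))
    (hkerqR : ∀ x, vertical EL EB qR (pL x)
      = imageAt EL pL (kernel (cotangentProd (magri L R) (magri R L))) x)
    (hkerqL : ∀ x, vertical ER EB qL (pR x)
      = imageAt ER pR (kernel (cotangentProd (magri L R) (magri R L))) x)
    -- smoothness of `L[F]` and `R[F]`, for `F` the vertical bundles of `pL`, `pR` and `r`
    (hLpL : IsSubbundle (closestLagrangian L (ofTangent (vertical E EL pL))))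
    (hRpL : IsSubbundle (closestLagrangian R (ofTangent (vertical E EL pL))))
    (hLpR : IsSubbundle (closestLagrangian L (ofTangent (vertical E ER pR))))
    (hRpR : IsSubbundle (closestLagrangian R (ofTangent (vertical E ER pR))))
    (hLr : IsSubbundle (closestLagrangian L (ofTangent (vertical E EB r))))
    (hRr : IsSubbundle (closestLagrangian R (ofTangent (vertical E EB r)))) :
    ∃ (L₁ R₁ : Family EL ML) (L₂ R₂ : Family ER MR) (L₃ R₃ : Family EB MB),
      (IsDirac L₁ ∧ IsDirac R₁ ∧ IsForward pL L L₁ ∧ IsForward pL R R₁ ∧ WeaklyConcur L₁ R₁) ∧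
      (IsDirac L₂ ∧ IsDirac R₂ ∧ IsForward pR L L₂ ∧ IsForward pR R R₂ ∧ WeaklyConcur L₂ R₂) ∧
      (IsDirac L₃ ∧ IsDirac R₃ ∧ IsForward r L L₃ ∧ IsForward r R R₃ ∧ WeaklyConcur L₃ R₃) ∧
      (IsForward qR L₁ L₃ ∧ IsForward qR R₁ R₃) ∧
      (IsForward qL L₂ L₃ ∧ IsForward qL R₂ R₃) ∧
      IsPoisson L₁ ∧ IsPoisson R₂ ∧ IsPoisson L₃ ∧ IsPoisson R₃ := by
  have dpL : MDifferentiable 𝓘(ℝ, E) 𝓘(ℝ, EL) pL := hpL.1.contMDiff.mdifferentiable (by simp)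
  have dpR : MDifferentiable 𝓘(ℝ, E) 𝓘(ℝ, ER) pR := hpR.1.contMDiff.mdifferentiable (by simp)
  have dr : MDifferentiable 𝓘(ℝ, E) 𝓘(ℝ, EB) r := hr.1.contMDiff.mdifferentiable (by simp)
  have dqR : MDifferentiable 𝓘(ℝ, EL) 𝓘(ℝ, EB) qR := hqR.1.contMDiff.mdifferentiable (by simp)
  have dqL : MDifferentiable 𝓘(ℝ, ER) 𝓘(ℝ, EB) qL := hqL.1.contMDiff.mdifferentiable (by simp)
  have hRL := hLR.symm
  have hV : ∀ x f, f ∈ vertical E EB r x ↔ ∃ f₁ f₂, f₁ + f₂ = f ∧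
      f₁ ∈ kernel (magri L R) x ∧ f₂ ∈ kernel (magri R L) x := by
    rw [← hcommL]
    exact mem_vertical_comp dpL dqR hkerL hkerqR
  have iL := invariant_of_vertical_eq hpL hL hR hLR hkerL
  have iR := invariant_of_vertical_eq hpR hR hL hRL hkerR
  obtain ⟨L₁, pL₁, dL₁⟩ := hL.exists_pushesTo hpL hfibL iL.1 hLpL
  obtain ⟨R₁, pR₁, dR₁⟩ := hR.exists_pushesTo hpL hfibL iL.2 hRpL
  obtain ⟨L₂, pL₂, dL₂⟩ := hL.exists_pushesTo hpR hfibR iR.2 hLpR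
  obtain ⟨R₂, pR₂, dR₂⟩ := hR.exists_pushesTo hpR hfibR iR.1 hRpR
  -- Along E_L + E_R each structure plays both roles: L is the left member of (L, R) and the right
  -- member of (R, L), and conversely for R.
  obtain ⟨L₃, pL₃, dL₃⟩ := hL.exists_pushesTo hr hfib
    (invariant_of_concur dr hL hR hR hL hLR hRL hV (.inl rfl) (.inr rfl)) hLr
  obtain ⟨R₃, pR₃, dR₃⟩ := hR.exists_pushesTo hr hfib
    (invariant_of_concur dr hL hR hR hL hLR hRL hV (.inr rfl) (.inl rfl)) hRr
  have kL₁ := pL₁.kernel_eq_bot hpL.2 fun x => hkerL ▸ kernel_le_kernel_magri L R x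
  have kR₂ := pR₂.kernel_eq_bot hpR.2 fun x => hkerR ▸ kernel_le_kernel_magri R L x
  have kL₃ := pL₃.kernel_eq_bot hr.2 fun x u hu =>
    (hV x u).2 ⟨u, 0, add_zero u, kernel_le_kernel_magri L R x hu, Submodule.zero_mem _⟩
  have kR₃ := pR₃.kernel_eq_bot hr.2 fun x u hu =>
    (hV x u).2 ⟨0, u, zero_add u, Submodule.zero_mem _, kernel_le_kernel_magri R L x hu⟩
  -- Descent of weak concurrence needs one factor with zero kernel. On the right branch this is
  -- `R₂`, so there it is applied to the pair (R, L) and then reversed.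
  refine ⟨L₁, R₁, L₂, R₂, L₃, R₃,
    ⟨dL₁, dR₁, pL₁.isForward, pR₁.isForward, pL₁.weaklyConcur hpL hL hR hLR pR₁ dL₁.lagrangian
      dL₁.subbundle dR₁.lagrangian dR₁.subbundle kL₁⟩,
    ⟨dL₂, dR₂, pL₂.isForward, pR₂.isForward, (pR₂.weaklyConcur hpR hR hL hRL pL₂ dR₂.lagrangian
      dR₂.subbundle dL₂.lagrangian dL₂.subbundle kR₂).symm⟩,
    ⟨dL₃, dR₃, pL₃.isForward, pR₃.isForward, pL₃.weaklyConcur hr hL hR hLR pR₃ dL₃.lagrangian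
      dL₃.subbundle dR₃.lagrangian dR₃.subbundle kL₃⟩,
    ⟨pL₁.isForward_of_comp hpL.2 dpL dqR ?_, pR₁.isForward_of_comp hpL.2 dpL dqR ?_⟩,
    ⟨pL₂.isForward_of_comp hpR.2 dpR dqL ?_, pR₂.isForward_of_comp hpR.2 dpR dqL ?_⟩,
    dL₁.isPoisson kL₁, dR₂.isPoisson kR₂, dL₃.isPoisson kL₃, dR₃.isPoisson kR₃⟩
  · exact hcommL ▸ pL₃
  · exact hcommL ▸ pR₃
  · exact hcommR ▸ pL₃
  · exact hcommR ▸ pR₃
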